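/- Let $\mathbb D=\{z\in\mathbb C:|z|<1\}$. For $\lambda\in\mathbb D$ put $\mathsf A_\lambda=\{\sum_{n\ge 0}a_n\lambda^n : a_n\in\{-1,1\}\}$, and let $$\mathcal M=\{\lambda\in\mathbb D:\mathsf A_\lambda\text{ is connected}\},\qquad \mathcal M_0=\{\lambda\in\mathbb D: 0\in\mathsf A_\lambda\}.$$ Let $\mathcal F_\lambda$ be the set of power series $f(z)=\sum_{j\ge 0}c_jz^j$ with $c_0=1$, $c_j\in\{-1,0,1\}$ for all $j$, and $f(\lambda)=0$. Such an $f$ is of rational type $(\ell,p)$ if $\ell\ge 0$ and $p\ge 1$ are the minimal integers with $$f(z)=\sum_{j=0}^{\ell}c_jz^j+\frac{c_{\ell+1}z^{\ell+1}+\dots+c_{\ell+p}z^{\ell+p}}{1-z^p}.$$ Let $\lambda\in\mathcal M\setminus\mathbb R$ with $|\lambda|\le 2^{-1/2}$, and suppose that $\mathcal F_\lambda=\{f\}$, where $f$ is of rational type $(\ell,p)$ and none of the coefficients $c_j$ of $f$ is zero. Write $f_k(z)=\sum_{j=0}^{k}c_jz^j$ and suppose that for every $0\le n\le p-1$: (i)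 $\displaystyle |f_{\ell+1+n}(\lambda)|>\frac12\,\frac{|\lambda^{\ell+1+n+1}|}{1-|\lambda|}$; (ii) $\displaystyle |f_{\ell+1+n}(\lambda)|+|f_{\ell+1+n+1}(\lambda)|>\frac{|\lambda^{\ell+1+n+1}|}{1-|\lambda|}$; (iii) if $Q$ is the polynomial with $2f_\ell(z)+z^{\ell+1}Q(z)=2f_{\ell+1+n}(z)$, then $2|f_{\ell+1+n}(\lambda)|<|2f_\ell(\lambda)+\lambda^{\ell+1}P(\lambda)|$ for every polynomial $P\ne Q$ of degree at most $n$ with coefficients in $\{-2,-1,0,1,2\}$. Then $\lambda\in\partial\mathcal M\cap\partial\mathcal M_0$. Moreover, $\lambda$ is accessible from a connected component of $\mathbb D\setminus\mathcal M$: there are a connected component $U$ of $\mathbb D\setminus\mathcal M$ and a continuous path $\gamma:[0,1]\to\mathbb C$ with $\gamma(t)\in U$ for $0\le t<1$ and $\gamma(1)=\lambda$. -/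

import Mathlib

open scoped PowerSeries

/-- The attractor `A_z` of the iterated function system `w ↦ z w - 1`, `w ↦ z w + 1`: all sums
`∑ a_n z ^ n` with `a_n ∈ {-1, 1}` (absolutely convergent for `‖z‖ < 1`). -/
def attractor (z : ℂ) : Set ℂ :=
  {w | ∃ a : ℕ → ℤ, (∀ n, a n = -1 ∨ a n = 1) ∧ w = ∑' n, (a n : ℂ) * z ^ n}

/-- The connectedness locus `𝓜`. -/
def connectednessLocus : Set ℂ :=
  {z | ‖z‖ < 1 ∧ IsConnected (attractor z)}

/-- The Thurston set `𝓜₀`. -/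
def thurstonSet : Set ℂ :=
  {z | ‖z‖ < 1 ∧ (0 : ℂ) ∈ attractor z}

/-- The set `𝓟` of power series with coefficients in `{-1, 0, 1}` and constant coefficient `1`. -/
def normalizedSeries : Set ℤ⟦X⟧ :=
  {f | (∀ j, f.coeff j = -1 ∨ f.coeff j = 0 ∨ f.coeff j = 1) ∧ f.coeff 0 = 1}

/-- The set `𝓕_z` of the series in `𝓟` that vanish at `z` (used for `‖z‖ < 1`). -/
def vanishingSeries (z : ℂ) : Set ℤ⟦X⟧ :=
  {f | f ∈ normalizedSeries ∧ ∑' j, (f.coeff j : ℂ) * z ^ j = 0}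

/-- The coefficients from index `l + 1` on repeat with period `p ≥ 1`, i.e.
`f = ∑_{j ≤ l} c_j X^j + (c_{l+1} X^{l+1} + ⋯ + c_{l+p} X^{l+p}) / (1 - X^p)`. -/
def HasRationalForm (f : ℤ⟦X⟧) (l p : ℕ) : Prop :=
  1 ≤ p ∧ ∀ j, l < j → f.coeff (j + p) = f.coeff j

/-- `f` is of rational type `(l, p)`: `l` and `p` are minimal with `HasRationalForm f l p`. -/
def IsRationalType (f : ℤ⟦X⟧) (l p : ℕ) : Prop :=
  HasRationalForm f l p ∧ ∀ l' p', HasRationalForm f l' p' → l ≤ l' ∧ p ≤ p'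

/-- The Taylor polynomial `f_k = ∑_{j ≤ k} c_j X^j`. -/
noncomputable def taylorPoly (f : ℤ⟦X⟧) (k : ℕ) : Polynomial ℤ :=
  PowerSeries.trunc (k + 1) f

/-- The three conditions on the Taylor polynomials at `z` of a series of rational type `(l, p)`. -/
def TaylorConditions (f : ℤ⟦X⟧) (l p : ℕ) (z : ℂ) : Prop :=
  ∀ n, n < p →
    ‖Polynomial.aeval z (taylorPoly f (l + 1 + n))‖
        > 1 / 2 * (‖z ^ (l + 1 + n + 1)‖ / (1 - ‖z‖)) ∧
    ‖Polynomial.aeval z (taylorPoly f (l + 1 + n))‖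
        + ‖Polynomial.aeval z (taylorPoly f (l + 1 + n + 1))‖
        > ‖z ^ (l + 1 + n + 1)‖ / (1 - ‖z‖) ∧
    ∀ Q : Polynomial ℤ,
      2 * taylorPoly f l + Polynomial.X ^ (l + 1) * Q = 2 * taylorPoly f (l + 1 + n) →
      ∀ P : Polynomial ℤ, P.natDegree ≤ n →
        (∀ i, P.coeff i ∈ ({-2, -1, 0, 1, 2} : Set ℤ)) → P ≠ Q →
        2 * ‖Polynomial.aeval z (taylorPoly f (l + 1 + n))‖
          < ‖2 * Polynomial.aeval z (taylorPoly f l) + z ^ (l + 1) * Polynomial.aeval z P‖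

/-- There is a path that ends at `z` and runs in `U` before its end point. -/
def IsPathAccessibleFrom (U : Set ℂ) (z : ℂ) : Prop :=
  ∃ γ : ℝ → ℂ, ContinuousOn γ (Set.Icc 0 1) ∧ (∀ t ∈ Set.Ico (0 : ℝ) 1, γ t ∈ U) ∧ γ 1 = z

/-- `U` is a connected component of the set `V`. -/
def IsComponentOf (U V : Set ℂ) : Prop :=
  ∃ x ∈ V, U = connectedComponentIn V x

namespace BoxCheck

/-- The directions `(p, q, n, s)`, standing for the unit vector `(p ± i q) / n`, with the sign `-`
if `s` holds. -/
def directions : List (ℕ × ℕ × ℕ × Bool) :=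
  [(1, 0, 1, false), (4, 3, 5, false), (4, 3, 5, true), (3, 4, 5, false), (3, 4, 5, true),
    (12, 5, 13, false), (12, 5, 13, true), (5, 12, 13, false), (5, 12, 13, true),
    (24, 7, 25, false), (24, 7, 25, true), (7, 24, 25, false), (7, 24, 25, true),
    (15, 8, 17, false), (15, 8, 17, true), (8, 15, 17, false), (8, 15, 17, true),
    (20, 21, 29, false), (20, 21, 29, true), (40, 9, 41, false), (40, 9, 41, true),
    (9, 40, 41, false), (9, 40, 41, true), (35, 12, 37, false), (35, 12, 37, true),
    (12, 35, 37, false), (12, 35, 37, true)]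

/-- Certificates for a square of parameters: nothing to do, no root of a `±1` series, all orbit
points are good, or subdivide. -/
inductive Cert
  | s
  | o (n : ℕ)
  | k (M n T : ℕ) (us : List ℕ)
  | q (c₁ c₂ c₃ c₄ : Cert)

/-- Numerical data of a square: its centre `(a, b)`, an upper bound `eta` for the distance to the
centre, bounds `rm` for the modulus of the centre, `rl`, `rh` for the modulus of the points, and
bounds `Sl`, `Sh` for `1 / (1 - r)`. Everything is in units of `2 ^ (-16)`. -/
structure Data where
  a : ℕ
  b : ℕ
  eta : ℕ
  rm : ℕ
  rh : ℕ
  Sh : ℕ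
  Sl : ℕ

noncomputable def consIf (c : Bool) (p : ℕ × ℕ × ℕ) (l : List (ℕ × ℕ × ℕ)) : List (ℕ × ℕ × ℕ) :=
  bif c then p :: l else l

noncomputable def keep (e eA w x : ℕ) : Bool :=
  bif Nat.ble (x + e) 245759 then false else Nat.ble w ((x - 229376) * (x - 229376) * eA)

noncomputable def emitBoth (e eA w x x' y z : ℕ) (l : List (ℕ × ℕ × ℕ)) : List (ℕ × ℕ × ℕ) :=
  consIf (keep e eA w x) (x, y, z) (consIf (keep e eA w x') (x', z, y) l)

noncomputable def emit (e eA eB eC eK x y z : ℕ) (l : List (ℕ × ℕ × ℕ)) : List (ℕ × ℕ × ℕ) :=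
  emitBoth e eA (eC + eB * (y * z) - eK) x (524288 - x) y z l

noncomputable def emitY (e eA eB eC eK x y : ℕ) (l : List (ℕ × ℕ × ℕ)) : List (ℕ × ℕ × ℕ) :=
  emit e eA eB eC eK x y (524288 - y) l

noncomputable def prepend (a b c d e eA eB eC eK : ℕ) (L : List (ℕ × ℕ × ℕ)) :
    List (ℕ × ℕ × ℕ) :=
  List.rec (motive := fun _ => List (ℕ × ℕ × ℕ)) []
    (fun p _ ih => emitY e eA eB eC eK ((a * p.1 + b * p.2.2 + c) / 65536)
      ((b * p.1 + a * p.2.1 + d) / 65536) ih) L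

noncomputable def level (D : Data) (e S : ℕ) (L : List (ℕ × ℕ × ℕ)) : List (ℕ × ℕ × ℕ) :=
  prepend D.a D.b (17179869184 - (196608 * D.a + 262144 * D.b))
    (17179869184 - (262144 * D.a + 196608 * D.b)) e
    (4 * (S * S - 4294967296)) (4 * (S * S)) (S * S * (S * S - 4294967296))
    (274877906944 * (S * S)) L

noncomputable def levels (D : Data) (M : ℕ) (n : ℕ) :
    ℕ → List (ℕ × ℕ × ℕ) → (ℕ → List (ℕ × ℕ × ℕ) → Bool) → Bool :=
  Nat.rec (motive := fun _ => ℕ → List (ℕ × ℕ × ℕ) → (ℕ → List (ℕ × ℕ × ℕ) → Bool) → Bool)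
    (fun e L f => f e L)
    (fun _ ih e L f =>
      (fun e' => ih e' (level D e' (D.Sl - 2 * e') L) f) ((D.rm * e + D.eta * M) / 65536 + 3)) n

noncomputable def allPts (f : ℕ → ℕ → ℕ → Bool) (L : List (ℕ × ℕ × ℕ)) : Bool :=
  List.rec (motive := fun _ => Bool) true
    (fun p _ ih => bif f p.1 p.2.1 p.2.2 then ih else false) L

/-- Powers of the centre `(X, Y, 2 - Y)`, their error bounds, and bounds for powers of `rh`. -/
abbrev Pow := ℕ × ℕ × ℕ × ℕ × ℕ

noncomputable def nextPow (D : Data) (p : Pow) : Pow :=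
  (fun y => ((D.a * p.1 + D.b * p.2.2.1 + 4294967296 - (D.a + D.b) * 65536) / 65536, y,
    131072 - y, (D.rm * p.2.2.2.1 + D.eta * p.2.2.2.2) / 65536 + 3,
    D.rh * p.2.2.2.2 / 65536 + 1))
    ((D.b * p.1 + D.a * p.2.1 + 4294967296 - (D.a + D.b) * 65536) / 65536)

/-- The powers with exponents `1, …, n`, most significant last. -/
noncomputable def powers (D : Data) (n : ℕ) : Pow → List Pow :=
  Nat.rec (motive := fun _ => Pow → List Pow) (fun _ => [])
    (fun _ ih p => nextPow D p :: ih (nextPow D p)) n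

noncomputable def dist (x y : ℕ) : ℕ := (x - y) + (y - x)

/-- Sum of the absolute values of the components of the powers in a direction. -/
noncomputable def sumAbs (p q : ℕ) (s : Bool) (L : List Pow) : ℕ :=
  List.rec (motive := fun _ => ℕ) 0
    (fun P _ ih => dist (p * P.1 + q * (bif s then P.2.2.1 else P.2.1)) ((p + q) * 65536) + ih) L

noncomputable def sumErr (L : List Pow) : ℕ :=
  List.rec (motive := fun _ => ℕ) 0 (fun P _ ih => P.2.2.2.1 + ih) L

noncomputable def lookup (l : List (ℕ × ℕ × ℕ × Bool)) (i : ℕ) : ℕ × ℕ × ℕ × Bool :=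
  List.rec (motive := fun _ => ℕ → ℕ × ℕ × ℕ × Bool) (fun _ => (1, 0, 1, false))
    (fun u _ ih j => Nat.rec (motive := fun _ => ℕ × ℕ × ℕ × Bool) u (fun j' _ => ih j') j) l i

/-- Thresholds `(p, q, s, α, β)` for a direction. -/
noncomputable def thresholds (T : ℕ) (u : ℕ × ℕ × ℕ × Bool) (base H : ℕ) :
    ℕ × ℕ × Bool × ℕ × ℕ :=
  (u.1, u.2.1, u.2.2.2, base + H + 1 - 13107200 * u.1 / (200 + T),
    base + 100 * H / (100 + T) + 1)

noncomputable def tests (T e err : ℕ) (L : List Pow) (us : List ℕ) :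
    List (ℕ × ℕ × Bool × ℕ × ℕ) :=
  List.rec (motive := fun _ => List (ℕ × ℕ × Bool × ℕ × ℕ)) []
    (fun i _ ih => (fun u => thresholds T u (262144 * (u.1 + u.2.1) + u.2.2.1 * e)
      (sumAbs u.1 u.2.1 u.2.2.2 L + u.2.2.1 * err) :: ih) (lookup directions i)) us

noncomputable def passA (x y z : ℕ) (l : List (ℕ × ℕ × Bool × ℕ × ℕ)) : Bool :=
  List.rec (motive := fun _ => Bool) false
    (fun u _ ih => bif Nat.ble u.2.2.2.1 (u.1 * x + u.2.1 * (bif u.2.2.1 then z else y))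
      then true else ih) l

noncomputable def passB (x y z : ℕ) (l : List (ℕ × ℕ × Bool × ℕ × ℕ)) : Bool :=
  List.rec (motive := fun _ => Bool) false
    (fun u _ ih => bif Nat.ble u.2.2.2.2 (u.1 * x + u.2.1 * (bif u.2.2.1 then z else y))
      then true else ih) l

noncomputable def lastPow (l : List Pow) (p : Pow) : Pow :=
  List.rec (motive := fun _ => Pow → Pow) (fun p => p) (fun p _ ih _ => ih p) l p

noncomputable def onePow : Pow := (131072, 65536, 65536, 0, 65536)

/-- Upper bound for `rh / (1 - rh)`. -/
noncomputable def tailBound (D : Data) : ℕ := D.rh * D.Sh / 65536 + 1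

noncomputable def finalTest (N T e : ℕ) (D : Data) (us : List ℕ) (L : List (ℕ × ℕ × ℕ)) : Bool :=
  (fun pw => (fun ts => allPts (fun x y z => passA x y z ts && passB x y z ts) L)
    (tests T e (sumErr pw + ((lastPow pw onePow).2.2.2.2 * tailBound D / 65536 + 1)) pw us))
    (powers D N onePow)

noncomputable def normTest (M x y z : ℕ) : Bool :=
  Nat.ble (dist x 196608 * dist x 196608 + 68719476736) (M * M + y * z)

noncomputable def orbitCheck (D : Data) (M n T : ℕ) (us : List ℕ) : Bool :=
  levels D D.Sh 6 (tailBound D) [(262144, 262144, 262144)] fun e L =>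
    bif allPts (normTest (4096 * M - e)) L then
      (bif Nat.ble e (4096 * M) then levels D (4096 * M) n e L fun e' L' =>
        finalTest 24 T e' D us L' else false) else false

noncomputable def addPow (thr x y : ℕ) (l : List (ℕ × ℕ)) : List (ℕ × ℕ) :=
  bif Nat.ble 137438953472 (thr * thr + x * (524288 - x) + y * (524288 - y)) then (x, y) :: l
  else l

noncomputable def extend (P : Pow) (thr : ℕ) (L : List (ℕ × ℕ)) : List (ℕ × ℕ) :=
  List.rec (motive := fun _ => List (ℕ × ℕ)) []
    (fun p _ ih => addPow thr (p.1 + P.1 - 65536) (p.2 + P.2.1 - 65536)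
      (addPow thr (p.1 + 65536 - P.1) (p.2 + 65536 - P.2.1) ih)) L

noncomputable def noRoot (D : Data) (n : ℕ) : Pow → ℕ → List (ℕ × ℕ) → Bool :=
  Nat.rec (motive := fun _ => Pow → ℕ → List (ℕ × ℕ) → Bool)
    (fun _ _ L => List.rec (motive := fun _ => Bool) true (fun _ _ _ => false) L)
    (fun _ ih p e L => (fun p' => (fun e' =>
      (fun thr => bif Nat.ble thr 196608 then ih p' e' (extend p' thr L) else false)
        (e' + (p'.2.2.2.2 * tailBound D / 65536 + 1)))
        (e + p'.2.2.2.1)) (nextPow D p)) n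

/-- Integer square root by Newton's method; correctness is tested where it is used. -/
noncomputable def approxSqrt (n : ℕ) : ℕ :=
  (fun x => (fun x => (fun x => (fun x => (fun x => (x + n / x) / 2) ((x + n / x) / 2))
    ((x + n / x) / 2)) ((x + n / x) / 2)) ((x + n / x) / 2)) 42000

noncomputable def mkData (a b eta s : ℕ) : Data :=
  (fun rh => (fun rl => ⟨a, b, eta, s + 1, rh, 4294967296 / (65536 - rh) + 1,
    4294967296 / (65536 - rl)⟩)
    (bif Nat.ble (s - 1 - eta) 32768 then 32768 else s - 1 - eta))
    (bif Nat.ble (s + 1 + eta) 46341 then s + 1 + eta else 46341)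

noncomputable def goodSqrt (n s : ℕ) : Bool :=
  bif Nat.ble n ((s + 1) * (s + 1)) then
    (bif Nat.ble ((s - 1) * (s - 1)) n then Nat.ble s 47000 else false) else false

noncomputable def check (c : Cert) : ℕ → ℕ → ℕ → Bool :=
  Cert.rec (motive := fun _ => ℕ → ℕ → ℕ → Bool)
    (fun a b h => bif Nat.ble 2147483649 ((a - h) * (a - h) + (b - h) * (b - h)) then true
      else Nat.ble ((a + h) * (a + h) + (b + h) * (b + h)) 1073741823)
    (fun n a b h => (fun s => bif goodSqrt (a * a + b * b) s then
      noRoot (mkData a b (h * 92682 / 65536 + 1) s) n onePow 0 [(327680, 262144)] else false)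
      (approxSqrt (a * a + b * b)))
    (fun M n T us a b h => (fun s => bif goodSqrt (a * a + b * b) s then
      (bif Nat.ble 1 T then
        orbitCheck (mkData a b (h * 92682 / 65536 + 1) s) M n T us else false) else false)
      (approxSqrt (a * a + b * b)))
    (fun _ _ _ _ f₁ f₂ f₃ f₄ a b h => (fun h' =>
      bif Nat.beq (2 * h') h then bif f₁ (a - h') (b - h') h' then (bif f₂ (a + h') (b - h') h' then
        (bif f₃ (a - h') (b + h') h' then f₄ (a + h') (b + h') h' else false) else false)
        else false else false) (h / 2)) c

end BoxCheck

open Complex ComplexConjugate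

/-- The points at which the two geometric conditions hold. -/
def IsGood (z σ : ℂ) : Prop := 1 / (1 - ‖z‖) < ‖σ‖ + ‖σ - 1‖ ∧ 3 / 4 ≤ σ.re

/-- Starting points of infinite orbits `s k = 1 ± z * s (k + 1)` consisting of good points. -/
def orbitPoints (z : ℂ) : Set ℂ :=
  {σ | ∃ s : ℕ → ℂ, s 0 = σ ∧ ∀ k, IsGood z (s k) ∧ ‖s k‖ ≤ 1 / (1 - ‖z‖) ∧
    (s k = 1 + z * s (k + 1) ∨ s k = 1 - z * s (k + 1))}

theorem orbitPoints_step {z σ : ℂ} (h : σ ∈ orbitPoints z) :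
    IsGood z σ ∧ ‖σ‖ ≤ 1 / (1 - ‖z‖) ∧
      ∃ σ' ∈ orbitPoints z, σ = 1 + z * σ' ∨ σ = 1 - z * σ' := by
  obtain ⟨s, rfl, hs⟩ := h
  exact ⟨(hs 0).1, (hs 0).2.1, s 1, ⟨fun k => s (k + 1), rfl, fun k => hs (k + 1)⟩, (hs 0).2.2⟩

/-- The support function of the zonoid `∑ k ≥ 1, [-1, 1] z ^ k`. -/
noncomputable def zonoidSupport (z u : ℂ) : ℝ := ∑' k : ℕ, |(conj u * z ^ (k + 1)).re|

namespace BoxCheck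

/-- The data bound the parameter `z`. -/
structure Valid (D : Data) (z : ℂ) : Prop where
  center : D.a * D.a + D.b * D.b ≤ D.rm * D.rm
  eta : ‖z - (⟨D.a / 65536, D.b / 65536⟩ : ℂ)‖ ≤ D.eta / 65536
  rm : D.rm ≤ 47001
  rh : ‖z‖ ≤ D.rh / 65536
  rh_le : D.rh ≤ 46341
  Sl : (D.Sl : ℝ) / 65536 ≤ 1 / (1 - ‖z‖)
  Sh : 1 / (1 - ‖z‖) ≤ D.Sh / 65536

/-- The centre of the square. -/
noncomputable def Data.c (D : Data) : ℂ := ⟨D.a / 65536, D.b / 65536⟩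

/-- The point with fixed-point coordinates `(x, y)`. -/
noncomputable def pt (x y : ℕ) : ℂ := ⟨x / 65536 - 3, y / 65536 - 4⟩

theorem norm_mk_le {x y c : ℝ} (hc : 0 ≤ c) (h : x * x + y * y ≤ c * c) : ‖(⟨x, y⟩ : ℂ)‖ ≤ c := by
  rw [Complex.norm_def, Complex.normSq_mk]
  exact Real.sqrt_le_iff.2 ⟨hc, by nlinarith⟩

theorem Valid.norm_c {D : Data} {z : ℂ} (h : Valid D z) : ‖D.c‖ ≤ D.rm / 65536 := by
  refine norm_mk_le (by positivity) ?_
  have : (D.a * D.a + D.b * D.b : ℝ) ≤ D.rm * D.rm := by exact_mod_cast h.center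
  nlinarith

theorem Valid.norm_lt {D : Data} {z : ℂ} (h : Valid D z) : ‖z‖ < 3 / 4 := by
  have h1 := h.rh
  have h2 : (D.rh : ℝ) ≤ 46341 := by exact_mod_cast h.rh_le
  have : (D.rh : ℝ) / 65536 ≤ 46341 / 65536 := by gcongr
  norm_num at this ⊢
  linarith

theorem Valid.lin {D : Data} {z : ℂ} (h : Valid D z) :
    196608 * D.a + 262144 * D.b ≤ 17179869184 ∧ 262144 * D.a + 196608 * D.b ≤ 17179869184 ∧
      (D.a + D.b) * 65536 ≤ 4294967296 + 65536 * 950 := by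
  have h1 := h.center
  have h2 : D.rm * D.rm ≤ 47001 * 47001 := Nat.mul_le_mul h.rm h.rm
  refine ⟨?_, ?_, ?_⟩
  · by_contra hc
    have : 262144 < 3 * D.a + 4 * D.b := by omega
    zify at *
    nlinarith [sq_nonneg (4 * (D.a : ℤ) - 3 * D.b)]
  · by_contra hc
    have : 262144 < 4 * D.a + 3 * D.b := by omega
    zify at *
    nlinarith [sq_nonneg (3 * (D.a : ℤ) - 4 * D.b)]
  · by_contra hc
    have : 66486 < D.a + D.b := by omega
    zify at *
    nlinarith [sq_nonneg ((D.a : ℤ) - D.b)]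

theorem div_bounds (n : ℕ) :
    ((n / 65536 : ℕ) : ℝ) ≤ n / 65536 ∧ (n : ℝ) / 65536 < ((n / 65536 : ℕ) : ℝ) + 1 := by
  constructor
  · exact_mod_cast Nat.cast_div_le (α := ℝ) (m := n) (n := 65536)
  · rw [div_lt_iff₀ (by norm_num)]
    have : n < (n / 65536 + 1) * 65536 := by omega
    exact_mod_cast this

theorem norm_sub_le_two {w v : ℂ} (h1 : v.re ≤ w.re) (h2 : w.re < v.re + 1 / 65536)
    (h3 : v.im ≤ w.im) (h4 : w.im < v.im + 1 / 65536) : ‖w - v‖ ≤ 2 / 65536 := by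
  have : ‖w - v‖ ≤ |(w - v).re| + |(w - v).im| := Complex.norm_le_abs_re_add_abs_im _
  rw [Complex.sub_re, Complex.sub_im, abs_of_nonneg (by linarith), abs_of_nonneg (by linarith)]
    at this
  linarith

/-- The fixed-point version of `c ↦ 1 + λ₀ * c`. -/
theorem pt_step {D : Data} {z : ℂ} (h : Valid D z) {x y w : ℕ} (hyw : y + w = 524288)
    (hc : ‖pt x y‖ ≤ 4) :
    let x' := (D.a * x + D.b * w + (17179869184 - (196608 * D.a + 262144 * D.b))) / 65536
    let y' := (D.b * x + D.a * y + (17179869184 - (262144 * D.a + 196608 * D.b))) / 65536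
    ‖1 + D.c * pt x y - pt x' y'‖ ≤ 2 / 65536 ∧ x' ≤ 524288 ∧ y' ≤ 524288 ∧ ‖pt x' y'‖ ≤ 4 ∧
      ‖pt (524288 - x') (524288 - y')‖ ≤ 4 ∧
      1 - D.c * pt x y - pt (524288 - x') (524288 - y') = -(1 + D.c * pt x y - pt x' y') := by
  intro x' y'
  obtain ⟨l1, l2, -⟩ := h.lin
  have hw : (w : ℝ) = 524288 - y := by
    have : ((y + w : ℕ) : ℝ) = 524288 := by exact_mod_cast hyw
    push_cast at this; linarith
  have hx := div_bounds (D.a * x + D.b * w + (17179869184 - (196608 * D.a + 262144 * D.b)))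
  have hy := div_bounds (D.b * x + D.a * y + (17179869184 - (262144 * D.a + 196608 * D.b)))
  change ((x' : ℕ) : ℝ) ≤ _ ∧ _ < (x' : ℝ) + 1 at hx
  change ((y' : ℕ) : ℝ) ≤ _ ∧ _ < (y' : ℝ) + 1 at hy
  push_cast [Nat.cast_sub l1, Nat.cast_sub l2, hw] at hx hy
  have hre : (1 + D.c * pt x y).re
      = (D.a * x + D.b * (524288 - y) + (17179869184 - (196608 * D.a + 262144 * D.b)))
        / 65536 / 65536 - 3 := by
    simp [Data.c, pt]; ring
  have him : (1 + D.c * pt x y).im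
      = (D.b * x + D.a * y + (17179869184 - (262144 * D.a + 196608 * D.b)))
        / 65536 / 65536 - 4 := by
    simp [Data.c, pt]; ring
  have hpre : (pt x' y').re = x' / 65536 - 3 := rfl
  have hpim : (pt x' y').im = y' / 65536 - 4 := rfl
  have h1 : ‖1 + D.c * pt x y - pt x' y'‖ ≤ 2 / 65536 := by
    apply norm_sub_le_two <;> simp only [hre, hpre, him, hpim] <;> linarith [hx.1, hx.2, hy.1, hy.2]
  have h2 : ‖D.c * pt x y‖ ≤ 47001 / 65536 * 4 := by
    rw [norm_mul]
    have hr : (D.rm : ℝ) ≤ 47001 := by exact_mod_cast h.rm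
    have := h.norm_c
    gcongr
    linarith [div_le_div_of_nonneg_right hr (by norm_num : (0 : ℝ) ≤ 65536)]
  have h3 : ‖pt x' y' - 1‖ ≤ 3 := by
    have : pt x' y' - 1 = D.c * pt x y - (1 + D.c * pt x y - pt x' y') := by ring
    rw [this]
    exact (norm_sub_le _ _).trans (by linarith)
  have hx8 : x' ≤ 524288 := by
    have := (Complex.abs_re_le_norm _).trans h3
    rw [Complex.sub_re, hpre, Complex.one_re, abs_le] at this
    have : (x' : ℝ) ≤ 524288 := by linarith [this.2]
    exact_mod_cast this
  have hy8 : y' ≤ 524288 := by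
    have := (Complex.abs_im_le_norm _).trans h3
    rw [Complex.sub_im, hpim, Complex.one_im, abs_le] at this
    have : (y' : ℝ) ≤ 524288 := by linarith [this.2]
    exact_mod_cast this
  have hneg : pt (524288 - x') (524288 - y') = 2 - pt x' y' := by
    apply Complex.ext
    · simp only [pt, Nat.cast_sub hx8, Complex.sub_re, Complex.re_ofNat]; push_cast; ring
    · simp only [pt, Nat.cast_sub hy8, Complex.sub_im, Complex.im_ofNat]; push_cast; ring
  refine ⟨h1, hx8, hy8, ?_, ?_, ?_⟩
  · calc ‖pt x' y'‖ = ‖(pt x' y' - 1) + 1‖ := by ring_nf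
      _ ≤ 3 + 1 := (norm_add_le _ _).trans (by simpa using h3)
      _ = 4 := by norm_num
  · rw [hneg]
    calc ‖2 - pt x' y'‖ = ‖1 - (pt x' y' - 1)‖ := by ring_nf
      _ ≤ 1 + 3 := (norm_sub_le _ _).trans (by simpa using h3)
      _ = 4 := by norm_num
  · rw [hneg]; ring

/-- Points inside an ellipse with foci `0` and `1`. -/
theorem ellipse {X v T : ℝ} (hT : 1 < T)
    (h : 4 * (T ^ 2 - 1) * X ^ 2 + 4 * T ^ 2 * v ^ 2 ≤ T ^ 2 * (T ^ 2 - 1)) :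
    ‖(⟨X + 1 / 2, v⟩ : ℂ)‖ + ‖(⟨X + 1 / 2, v⟩ : ℂ) - 1‖ ≤ T := by
  set A := ‖(⟨X + 1 / 2, v⟩ : ℂ)‖
  set B := ‖(⟨X + 1 / 2, v⟩ : ℂ) - 1‖
  have hA : A ^ 2 = (X + 1 / 2) ^ 2 + v ^ 2 := by
    rw [Complex.sq_norm, Complex.normSq_mk]; ring
  have hB : B ^ 2 = (X - 1 / 2) ^ 2 + v ^ 2 := by
    rw [Complex.sq_norm, Complex.normSq_apply]; simp; ring
  have hA0 : 0 ≤ A := norm_nonneg _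
  have hB0 : 0 ≤ B := norm_nonneg _
  have h1 : 2 * X ^ 2 + 1 / 2 + 2 * v ^ 2 ≤ T ^ 2 := by
    have h2 : 0 < T ^ 2 - 1 := by nlinarith
    have : 4 * (T ^ 2 - 1) * (X ^ 2 + v ^ 2) ≤ T ^ 2 * (T ^ 2 - 1) := by nlinarith [sq_nonneg v]
    have : 4 * (X ^ 2 + v ^ 2) ≤ T ^ 2 := by
      by_contra hc; push Not at hc; nlinarith
    nlinarith
  have h3 : A * B ≤ (T ^ 2 - (2 * X ^ 2 + 1 / 2 + 2 * v ^ 2)) / 2 := by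
    refine abs_le_of_sq_le_sq' ?_ (by linarith) |>.2
    rw [mul_pow, hA, hB]
    nlinarith
  nlinarith [sq_nonneg (A + B - T), mul_nonneg hA0 hB0, abs_le_of_sq_le_sq' (a := A + B) (b := T)
    (by nlinarith) (by linarith)]

theorem bif_ble {α : Type*} (m n : ℕ) (a b : α) :
    (bif Nat.ble m n then a else b) = if m ≤ n then a else b := by
  by_cases h : m ≤ n
  · rw [if_pos h, Nat.ble_eq_true_of_le h]; rfl
  · rw [if_neg h, Bool.eq_false_iff.2 (fun hc => h (Nat.le_of_ble_eq_true hc))]; rfl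

theorem keep_eq_true {e eA w x : ℕ} :
    keep e eA w x = true ↔ 245760 ≤ x + e ∧ w ≤ (x - 229376) * (x - 229376) * eA := by
  unfold keep
  rw [bif_ble]
  split_ifs with h
  · simp; omega
  · rw [Nat.ble_eq]; omega

theorem keep_of_isGood {D : Data} {z : ℂ} (h : Valid D z) {σ : ℂ} (hσ : IsGood z σ) {x y w e : ℕ}
    (hyw : y + w = 524288) (he : ‖σ - pt x y‖ ≤ e / 65536) {S : ℕ} (hS : S = D.Sl - 2 * e) :
    keep e (4 * (S * S - 4294967296))
      (S * S * (S * S - 4294967296) + 4 * (S * S) * (y * w) - 274877906944 * (S * S)) x = true := by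
  have hre : (pt x y).re = x / 65536 - 3 := rfl
  have him : (pt x y).im = y / 65536 - 4 := rfl
  have h1 : |σ.re - (x / 65536 - 3)| ≤ e / 65536 := by
    have := (Complex.abs_re_le_norm _).trans he
    rwa [Complex.sub_re, hre] at this
  have h2 := hσ.2
  rw [keep_eq_true]
  constructor
  · by_contra hc
    have : x + e ≤ 245759 := by omega
    have : (x + e : ℝ) ≤ 245759 := by exact_mod_cast this
    rw [abs_le] at h1
    linarith [h1.2]
  by_cases hS1 : S * S ≤ 4294967296
  · rw [Nat.sub_eq_zero_of_le hS1]
    have : y * w ≤ 68719476736 := by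
      zify at *
      nlinarith [sq_nonneg ((y : ℤ) - w)]
    have : 4 * (S * S) * (y * w) ≤ 4 * (S * S) * 68719476736 := Nat.mul_le_mul_left _ this
    omega
  push Not at hS1
  have hS2 : 65536 < S := by by_contra hc; push Not at hc; nlinarith
  set u : ℕ := x - 229376 with hu
  have hSr : (S : ℝ) = D.Sl - 2 * e := by
    have : 2 * e ≤ D.Sl := by omega
    rw [hS]; push_cast [Nat.cast_sub this]; ring
  by_contra hc
  push Not at hc
  have hc2 : u * u * (4 * (S * S - 4294967296)) + 274877906944 * (S * S)
      < S * S * (S * S - 4294967296) + 4 * (S * S) * (y * w) := by omega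
  have hw : (w : ℝ) = 524288 - y := by
    have : ((y + w : ℕ) : ℝ) = 524288 := by exact_mod_cast hyw
    push_cast at this; linarith
  have hc3 : ((u * u * (4 * (S * S - 4294967296)) + 274877906944 * (S * S) : ℕ) : ℝ)
      < ((S * S * (S * S - 4294967296) + 4 * (S * S) * (y * w) : ℕ) : ℝ) := by exact_mod_cast hc2
  push_cast [Nat.cast_sub hS1.le, hw] at hc3
  obtain ⟨T, hT⟩ : ∃ T : ℝ, T = S / 65536 := ⟨_, rfl⟩
  obtain ⟨U, hU⟩ : ∃ U : ℝ, U = u / 65536 := ⟨_, rfl⟩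
  obtain ⟨V, hV⟩ : ∃ V : ℝ, V = y / 65536 := ⟨_, rfl⟩
  have hST : (S : ℝ) = 65536 * T := by rw [hT]; ring
  have hUu : (u : ℝ) = 65536 * U := by rw [hU]; ring
  have hVy : (y : ℝ) = 65536 * V := by rw [hV]; ring
  have hT1 : 1 < T := by
    rw [hT, lt_div_iff₀ (by norm_num)]
    exact_mod_cast (by omega : 1 * 65536 < S)
  have key := ellipse (X := U) (v := V - 4) hT1 (by
    rw [hST, hUu, hVy] at hc3
    have e1 : (18446744073709551616 : ℝ) * (4 * (T ^ 2 - 1) * U ^ 2 + 4 * T ^ 2 * (V - 4) ^ 2)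
        = 65536 * U * (65536 * U) * (4 * (65536 * T * (65536 * T) - 4294967296)) +
          274877906944 * (65536 * T * (65536 * T)) -
          4 * (65536 * T * (65536 * T)) * (65536 * V * (524288 - 65536 * V)) := by ring
    have e2 : (18446744073709551616 : ℝ) * (T ^ 2 * (T ^ 2 - 1))
        = 65536 * T * (65536 * T) * (65536 * T * (65536 * T) - 4294967296) := by ring
    have : (18446744073709551616 : ℝ) * (4 * (T ^ 2 - 1) * U ^ 2 + 4 * T ^ 2 * (V - 4) ^ 2)
        ≤ 18446744073709551616 * (T ^ 2 * (T ^ 2 - 1)) := by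
      rw [e1, e2]; linarith only [hc3]
    exact le_of_mul_le_mul_left this (by positivity))
  set s : ℂ := ⟨U + 1 / 2, V - 4⟩ with hs_def
  have hs : ‖σ - s‖ ≤ e / 65536 := by
    refine le_trans ?_ he
    rw [Complex.norm_def, Complex.norm_def, Complex.normSq_apply, Complex.normSq_apply]
    apply Real.sqrt_le_sqrt
    have e1 : (σ - s).im = σ.im - (V - 4) := by rw [Complex.sub_im]
    have e2 : (σ - s).re = σ.re - (U + 1 / 2) := by rw [Complex.sub_re]
    rw [e1, e2, Complex.sub_re, Complex.sub_im, hre, him, ← hV]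
    suffices (σ.re - (U + 1 / 2)) * (σ.re - (U + 1 / 2))
        ≤ (σ.re - (x / 65536 - 3)) * (σ.re - (x / 65536 - 3)) by linarith
    rcases le_total 229376 x with hx | hx
    · have : (u : ℝ) = x - 229376 := by rw [hu]; push_cast [Nat.cast_sub hx]; ring
      rw [hU, this]; apply le_of_eq; ring
    · have h0 : U = 0 := by rw [hU, hu, Nat.sub_eq_zero_of_le hx]; simp
      have hx' : (x : ℝ) ≤ 229376 := by exact_mod_cast hx
      rw [h0]
      exact mul_self_le_mul_self (by linarith) (by linarith)
  have t1 : ‖σ‖ ≤ ‖s‖ + e / 65536 := by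
    have := norm_add_le s (σ - s)
    rw [add_sub_cancel] at this; linarith
  have t2 : ‖σ - 1‖ ≤ ‖s - 1‖ + e / 65536 := by
    have := norm_add_le (s - 1) (σ - s)
    rw [show s - 1 + (σ - s) = σ - 1 by ring] at this; linarith
  have t3 := hσ.1
  have t4 := h.Sl
  have t5 : T = D.Sl / 65536 - 2 * (e / 65536) := by rw [hT, hSr]; ring
  linarith


/-- The points of the list approximate all orbit points up to `e`. -/
def Covers (z : ℂ) (e : ℕ) (L : List (ℕ × ℕ × ℕ)) : Prop :=
  ∀ σ ∈ orbitPoints z, ∃ p ∈ L, p.2.1 + p.2.2 = 524288 ∧ ‖pt p.1 p.2.1‖ ≤ 4 ∧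
    ‖σ - pt p.1 p.2.1‖ ≤ e / 65536

theorem mem_consIf {c : Bool} {p q : ℕ × ℕ × ℕ} {l : List (ℕ × ℕ × ℕ)} :
    q ∈ consIf c p l ↔ (c = true ∧ q = p) ∨ q ∈ l := by
  unfold consIf; cases c <;> simp

theorem prepend_cons (a b c d e eA eB eC eK : ℕ) (p : ℕ × ℕ × ℕ) (L : List (ℕ × ℕ × ℕ)) :
    prepend a b c d e eA eB eC eK (p :: L) = emitY e eA eB eC eK
      ((a * p.1 + b * p.2.2 + c) / 65536) ((b * p.1 + a * p.2.1 + d) / 65536)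
      (prepend a b c d e eA eB eC eK L) := rfl

theorem mem_prepend {a b c d e eA eB eC eK : ℕ} {p q : ℕ × ℕ × ℕ} {L : List (ℕ × ℕ × ℕ)}
    (hp : p ∈ L)
    (hq : q ∈ emitY e eA eB eC eK ((a * p.1 + b * p.2.2 + c) / 65536)
      ((b * p.1 + a * p.2.1 + d) / 65536) []) :
    q ∈ prepend a b c d e eA eB eC eK L := by
  induction L with
  | nil => simp at hp
  | cons p' L ih =>
    rw [prepend_cons]
    rcases List.mem_cons.1 hp with rfl | hp
    · simp only [emitY, emit, emitBoth, mem_consIf, List.not_mem_nil, or_false] at hq ⊢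
      tauto
    · have := ih hp
      simp only [emitY, emit, emitBoth, mem_consIf]
      tauto

theorem Covers.level {D : Data} {z : ℂ} (h : Valid D z) {e M : ℕ} {L : List (ℕ × ℕ × ℕ)}
    (hL : Covers z e L) (hM : ∀ σ ∈ orbitPoints z, ‖σ‖ ≤ M / 65536) :
    Covers z ((D.rm * e + D.eta * M) / 65536 + 3)
      (level D ((D.rm * e + D.eta * M) / 65536 + 3)
        (D.Sl - 2 * ((D.rm * e + D.eta * M) / 65536 + 3)) L) := by
  set e' := (D.rm * e + D.eta * M) / 65536 + 3 with he'
  intro σ hσ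
  obtain ⟨hgood, -, σ', hσ', hstep⟩ := orbitPoints_step hσ
  obtain ⟨p, hpL, hp1, hp2, hp3⟩ := hL σ' hσ'
  obtain ⟨k1, k2, k3, k4, k5, k6⟩ := pt_step h hp1 hp2
  set x' := (D.a * p.1 + D.b * p.2.2 + (17179869184 - (196608 * D.a + 262144 * D.b))) / 65536
  set y' := (D.b * p.1 + D.a * p.2.1 + (17179869184 - (262144 * D.a + 196608 * D.b))) / 65536
  have herr : ‖z * σ' - D.c * pt p.1 p.2.1‖ + 2 / 65536 ≤ e' / 65536 := by
    have h1 : z * σ' - D.c * pt p.1 p.2.1 = D.c * (σ' - pt p.1 p.2.1) + (z - D.c) * σ' := by ring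
    have h2 : ‖D.c * (σ' - pt p.1 p.2.1)‖ ≤ D.rm / 65536 * (e / 65536) := by
      rw [norm_mul]
      exact mul_le_mul h.norm_c hp3 (norm_nonneg _) (by positivity)
    have h3 : ‖(z - D.c) * σ'‖ ≤ D.eta / 65536 * (M / 65536) := by
      rw [norm_mul]
      exact mul_le_mul h.eta (hM _ hσ') (norm_nonneg _) (by positivity)
    have h4 := norm_add_le (D.c * (σ' - pt p.1 p.2.1)) ((z - D.c) * σ')
    have h5 := (div_bounds (D.rm * e + D.eta * M)).2
    rw [h1, he']
    push_cast at h5 ⊢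
    have h6 : (D.rm : ℝ) / 65536 * (e / 65536) + D.eta / 65536 * (M / 65536)
      = (D.rm * e + D.eta * M) / 65536 / 65536 := by ring
    linarith
  have hx8 : x' + (524288 - x') = 524288 := by omega
  have hy8 : y' + (524288 - y') = 524288 := by omega
  rcases hstep with hs | hs
  · have hd : ‖σ - pt x' y'‖ ≤ e' / 65536 := by
      refine le_trans ?_ herr
      have : σ - pt x' y'
          = (z * σ' - D.c * pt p.1 p.2.1) + (1 + D.c * pt p.1 p.2.1 - pt x' y') := by
        rw [hs]; ring
      rw [this]
      exact (norm_add_le _ _).trans (by gcongr)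
    refine ⟨(x', y', 524288 - y'), mem_prepend hpL ?_, hy8, k4, hd⟩
    simp only [emitY, emit, emitBoth, mem_consIf]
    exact Or.inl ⟨keep_of_isGood h hgood hy8 hd rfl, rfl⟩
  · have hd : ‖σ - pt (524288 - x') (524288 - y')‖ ≤ e' / 65536 := by
      refine le_trans ?_ herr
      have : σ - pt (524288 - x') (524288 - y')
          = -(z * σ' - D.c * pt p.1 p.2.1) - (1 + D.c * pt p.1 p.2.1 - pt x' y') := by
        rw [hs, sub_eq_add_neg _ (1 + D.c * pt p.1 p.2.1 - pt x' y'), ← k6]; ring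
      rw [this]
      exact (norm_sub_le _ _).trans (by rw [norm_neg]; gcongr)
    have hy8' : (524288 - y') + y' = 524288 := by omega
    refine ⟨(524288 - x', 524288 - y', y'), mem_prepend hpL ?_, hy8', k5, hd⟩
    simp only [emitY, emit, emitBoth, mem_consIf]
    refine Or.inr (Or.inl ⟨?_, rfl⟩)
    have := keep_of_isGood h hgood hy8' hd rfl
    rwa [mul_comm (524288 - y') y'] at this

theorem exists_of_levels {D : Data} {z : ℂ} (h : Valid D z) {M : ℕ}
    (hM : ∀ σ ∈ orbitPoints z, ‖σ‖ ≤ M / 65536) {f : ℕ → List (ℕ × ℕ × ℕ) → Bool} (n : ℕ) :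
    ∀ (e : ℕ) (L : List (ℕ × ℕ × ℕ)), Covers z e L → levels D M n e L f = true →
      ∃ e' L', Covers z e' L' ∧ f e' L' = true := by
  induction n with
  | zero => exact fun e L hL hf => ⟨e, L, hL, hf⟩
  | succ n ih => exact fun e L hL hf => ih _ _ (hL.level h hM) hf

theorem of_allPts {f : ℕ → ℕ → ℕ → Bool} {L : List (ℕ × ℕ × ℕ)} (h : allPts f L = true) :
    ∀ p ∈ L, f p.1 p.2.1 p.2.2 = true := by
  induction L with
  | nil => simp
  | cons p L ih =>
    have h' : (bif f p.1 p.2.1 p.2.2 then allPts f L else false) = true := h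
    rw [cond_eq_ite] at h'
    split_ifs at h' with hf
    intro q hq
    rcases List.mem_cons.1 hq with rfl | hq
    · exact hf
    · exact ih h' q hq

theorem dist_cast (x y : ℕ) : (dist x y : ℝ) = |(x : ℝ) - y| := by
  unfold dist
  rcases le_total x y with h | h
  · rw [Nat.sub_eq_zero_of_le h, zero_add, Nat.cast_sub h, abs_sub_comm, abs_of_nonneg]
    simpa using h
  · rw [Nat.sub_eq_zero_of_le h, add_zero, Nat.cast_sub h, abs_of_nonneg]
    simpa using h

theorem norm_le_of_normTest {M x y w : ℕ} (hyw : y + w = 524288) (h : normTest M x y w = true) :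
    ‖pt x y‖ ≤ M / 65536 := by
  have h1 : dist x 196608 * dist x 196608 + 68719476736 ≤ M * M + y * w := Nat.le_of_ble_eq_true h
  have hw : (w : ℝ) = 524288 - y := by
    have : ((y + w : ℕ) : ℝ) = 524288 := by exact_mod_cast hyw
    push_cast at this; linarith
  have h2 : (dist x 196608 * dist x 196608 + 68719476736 : ℝ) ≤ M * M + y * w := by
    exact_mod_cast h1
  rw [dist_cast, abs_mul_abs_self, hw] at h2
  push_cast at h2
  refine norm_mk_le (by positivity) ?_
  nlinarith

/-- `P` describes the power `z ^ j`. -/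
structure PowValid (z : ℂ) (j : ℕ) (P : Pow) : Prop where
  compl : P.2.1 + P.2.2.1 = 131072
  norm_le : ‖(⟨P.1 / 65536 - 1, P.2.1 / 65536 - 1⟩ : ℂ)‖ ≤ 1
  err : ‖z ^ j - (⟨P.1 / 65536 - 1, P.2.1 / 65536 - 1⟩ : ℂ)‖ ≤ P.2.2.2.1 / 65536
  pow : ‖z‖ ^ j ≤ P.2.2.2.2 / 65536

theorem powValid_one (z : ℂ) : PowValid z 0 onePow := by
  have : (⟨(131072 : ℕ) / 65536 - 1, (65536 : ℕ) / 65536 - 1⟩ : ℂ) = 1 := by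
    apply Complex.ext <;> norm_num
  constructor
  · rfl
  · change ‖(⟨(131072 : ℕ) / 65536 - 1, (65536 : ℕ) / 65536 - 1⟩ : ℂ)‖ ≤ 1
    rw [this]; simp
  · change ‖_ - (⟨(131072 : ℕ) / 65536 - 1, (65536 : ℕ) / 65536 - 1⟩ : ℂ)‖ ≤ ((0 : ℕ) : ℝ) / _
    rw [this]; simp
  · change _ ≤ ((65536 : ℕ) : ℝ) / 65536
    norm_num

theorem PowValid.next {D : Data} {z : ℂ} (h : Valid D z) {j : ℕ} {P : Pow} (hP : PowValid z j P) :
    PowValid z (j + 1) (nextPow D P) := by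
  obtain ⟨X, Y, Z, er, rq⟩ := P
  obtain ⟨h1, h2, h3, h4⟩ := hP
  dsimp only at h1 h2 h3 h4
  set p : ℂ := ⟨X / 65536 - 1, Y / 65536 - 1⟩ with hp
  have hZ : (Z : ℝ) = 131072 - Y := by
    have : ((Y + Z : ℕ) : ℝ) = 131072 := by exact_mod_cast h1
    push_cast at this; linarith
  have hcp : ‖D.c * p‖ ≤ 47001 / 65536 := by
    rw [norm_mul]
    have hr : (D.rm : ℝ) ≤ 47001 := by exact_mod_cast h.rm
    have := mul_le_mul h.norm_c h2 (norm_nonneg _) (by positivity)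
    linarith [div_le_div_of_nonneg_right hr (by norm_num : (0 : ℝ) ≤ 65536)]
  have hre : (1 + D.c * p).re = (D.a * X + D.b * Z + 4294967296 - (D.a + D.b) * 65536)
      / 65536 / 65536 := by
    rw [hZ]; simp [Data.c, hp]; ring
  have him : (D.c * p).im + 1 = (D.b * X + D.a * Y + 4294967296 - (D.a + D.b) * 65536)
      / 65536 / 65536 := by
    simp [Data.c, hp]; ring
  have b1 := (abs_le.1 ((Complex.abs_re_le_norm _).trans hcp)).1
  have b2 := (abs_le.1 ((Complex.abs_im_le_norm _).trans hcp)).1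
  have n1 : (D.a + D.b) * 65536 ≤ D.a * X + D.b * Z + 4294967296 := by
    have : (0 : ℝ) ≤ (1 + D.c * p).re := by
      rw [Complex.add_re, Complex.one_re]; linarith
    rw [hre] at this
    have : ((D.a + D.b) * 65536 : ℝ) ≤ D.a * X + D.b * Z + 4294967296 := by linarith
    exact_mod_cast this
  have n2 : (D.a + D.b) * 65536 ≤ D.b * X + D.a * Y + 4294967296 := by
    have : (0 : ℝ) ≤ (D.c * p).im + 1 := by linarith
    rw [him] at this
    have : ((D.a + D.b) * 65536 : ℝ) ≤ D.b * X + D.a * Y + 4294967296 := by linarith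
    exact_mod_cast this
  have d1 := div_bounds (D.a * X + D.b * Z + 4294967296 - (D.a + D.b) * 65536)
  have d2 := div_bounds (D.b * X + D.a * Y + 4294967296 - (D.a + D.b) * 65536)
  have d3 := (div_bounds (D.rm * er + D.eta * rq)).2
  have d4 := (div_bounds (D.rh * rq)).2
  have hnext : nextPow D (X, Y, Z, er, rq)
    = ((D.a * X + D.b * Z + 4294967296 - (D.a + D.b) * 65536) / 65536,
      (D.b * X + D.a * Y + 4294967296 - (D.a + D.b) * 65536) / 65536,
      131072 - (D.b * X + D.a * Y + 4294967296 - (D.a + D.b) * 65536) / 65536,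
      (D.rm * er + D.eta * rq) / 65536 + 3, D.rh * rq / 65536 + 1) := rfl
  rw [hnext]
  generalize (D.a * X + D.b * Z + 4294967296 - (D.a + D.b) * 65536) / 65536 = x' at *
  generalize (D.b * X + D.a * Y + 4294967296 - (D.a + D.b) * 65536) / 65536 = y' at *
  push_cast [Nat.cast_sub n1, Nat.cast_sub n2] at d1 d2 d3 d4
  set p' : ℂ := ⟨x' / 65536 - 1, y' / 65536 - 1⟩ with hp'
  have e1 : ‖D.c * p - p'‖ ≤ 2 / 65536 := by
    rw [Complex.add_re, Complex.one_re] at hre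
    apply norm_sub_le_two <;> simp only [hp'] <;> linarith [d1.1, d1.2, d2.1, d2.2]
  have e2 : ‖p'‖ ≤ 1 := by
    have : p' = D.c * p - (D.c * p - p') := by ring
    rw [this]
    exact (norm_sub_le _ _).trans (by linarith)
  have hy : y' ≤ 131072 := by
    have := (abs_le.1 ((Complex.abs_im_le_norm _).trans e2)).2
    have : (y' : ℝ) ≤ 131072 := by
      have e3 : p'.im = y' / 65536 - 1 := rfl
      rw [e3] at this
      linarith
    exact_mod_cast this
  refine ⟨by dsimp only; omega, e2, ?_, ?_⟩
  · have : z ^ (j + 1) - p' = D.c * (z ^ j - p) + (z - D.c) * z ^ j + (D.c * p - p') := by ring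
    dsimp only
    rw [this]
    have f1 : ‖D.c * (z ^ j - p)‖ ≤ D.rm / 65536 * (er / 65536) := by
      rw [norm_mul]
      exact mul_le_mul h.norm_c h3 (norm_nonneg _) (by positivity)
    have f2 : ‖(z - D.c) * z ^ j‖ ≤ D.eta / 65536 * (rq / 65536) := by
      rw [norm_mul, norm_pow]
      exact mul_le_mul h.eta h4 (by positivity) (by positivity)
    have f3 := norm_add₃_le (a := D.c * (z ^ j - p)) (b := (z - D.c) * z ^ j) (c := D.c * p - p')
    push_cast
    have f4 : (D.rm : ℝ) / 65536 * (er / 65536) + D.eta / 65536 * (rq / 65536)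
      = (D.rm * er + D.eta * rq) / 65536 / 65536 := by ring
    linarith
  · dsimp only
    have : ‖z‖ ^ (j + 1) ≤ rq / 65536 * (D.rh / 65536) := by
      rw [pow_succ]
      exact mul_le_mul h4 h.rh (norm_nonneg _) (by positivity)
    push_cast
    have f4 : (rq : ℝ) / 65536 * (D.rh / 65536) = D.rh * rq / 65536 / 65536 := by ring
    linarith


/-- The unit vector of a direction. -/
noncomputable def dir (u : ℕ × ℕ × ℕ × Bool) : ℂ :=
  ⟨u.1 / u.2.2.1, (bif u.2.2.2 then -(u.2.1 : ℝ) else u.2.1) / u.2.2.1⟩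

def DirValid (u : ℕ × ℕ × ℕ × Bool) : Prop :=
  0 < u.2.2.1 ∧ u.1 * u.1 + u.2.1 * u.2.1 = u.2.2.1 * u.2.2.1

theorem dirValid_lookup (i : ℕ) : DirValid (lookup directions i) := by
  have key : ∀ (l : List (ℕ × ℕ × ℕ × Bool)), (∀ u ∈ l, DirValid u) →
      ∀ i, DirValid (lookup l i) := by
    intro l
    induction l with
    | nil => intro _ i; exact ⟨Nat.one_pos, rfl⟩
    | cons u l ih =>
      intro h i
      cases i with
      | zero => exact h u List.mem_cons_self
      | succ i => exact ih (fun v hv => h v (List.mem_cons_of_mem _ hv)) i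
  have h : ∀ u ∈ directions, DirValid u := by simp [directions, DirValid]
  exact key directions h i

theorem norm_dir {u : ℕ × ℕ × ℕ × Bool} (h : DirValid u) : ‖dir u‖ = 1 := by
  obtain ⟨p, q, n, s⟩ := u
  obtain ⟨h1, h2⟩ := h
  dsimp only at h1 h2
  have h3 : (p * p + q * q : ℝ) = n * n := by exact_mod_cast h2
  have h4 : (n : ℝ) ≠ 0 := by exact_mod_cast h1.ne'
  rw [dir, Complex.norm_def, Complex.normSq_mk]
  dsimp only
  have : (bif s then -(q : ℝ) else q) * (bif s then -(q : ℝ) else q) = q * q := by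
    cases s <;> simp
  rw [div_mul_div_comm, div_mul_div_comm, this, ← add_div, h3, div_self (by positivity),
    Real.sqrt_one]

theorem re_conj_dir_mul {u : ℕ × ℕ × ℕ × Bool} (h : DirValid u) (w : ℂ) :
    u.2.2.1 * (conj (dir u) * w).re = u.1 * w.re + u.2.1 * (bif u.2.2.2 then -w.im else w.im) := by
  obtain ⟨p, q, n, s⟩ := u
  have h4 : (n : ℝ) ≠ 0 := by exact_mod_cast h.1.ne'
  cases s <;> simp [dir] <;> field_simp

theorem re_conj_mul_le {u : ℂ} (hu : ‖u‖ = 1) (w : ℂ) : |(conj u * w).re| ≤ ‖w‖ := by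
  refine (Complex.abs_re_le_norm _).trans ?_
  rw [norm_mul, RCLike.norm_conj, hu, one_mul]

theorem summable_zonoid {z : ℂ} (hz : ‖z‖ < 1) (u : ℂ) :
    Summable fun k : ℕ => |(conj u * z ^ (k + 1)).re| := by
  have h : Summable fun k : ℕ => ‖u‖ * ‖z‖ * ‖z‖ ^ k :=
    (summable_geometric_of_lt_one (norm_nonneg _) hz).mul_left _
  refine Summable.of_nonneg_of_le (fun _ => abs_nonneg _) (fun k => ?_) h
  refine (Complex.abs_re_le_norm _).trans (le_of_eq ?_)
  rw [norm_mul, RCLike.norm_conj, norm_pow, pow_succ]; ring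

theorem zonoidSupport_le {z : ℂ} (hz : ‖z‖ < 1) {u : ℂ} (hu : ‖u‖ = 1) (n : ℕ) :
    zonoidSupport z u ≤ (∑ k ∈ Finset.range n, |(conj u * z ^ (k + 1)).re|)
      + ‖z‖ ^ n * (‖z‖ / (1 - ‖z‖)) := by
  unfold zonoidSupport
  rw [← (summable_zonoid hz u).sum_add_tsum_nat_add n]
  gcongr
  have h1 : HasSum (fun k : ℕ => ‖z‖ ^ n * (‖z‖ * ‖z‖ ^ k)) (‖z‖ ^ n * (‖z‖ * (1 - ‖z‖)⁻¹)) :=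
    ((hasSum_geometric_of_lt_one (norm_nonneg z) hz).mul_left _).mul_left _
  rw [div_eq_mul_inv, ← h1.tsum_eq]
  refine Summable.tsum_le_tsum (fun k => ?_) ((summable_nat_add_iff n).2 (summable_zonoid hz u))
    h1.summable
  refine (re_conj_mul_le hu _).trans (le_of_eq ?_)
  rw [norm_pow, pow_add, pow_add]; ring

theorem sumAbs_cons (p q : ℕ) (s : Bool) (P : Pow) (L : List Pow) :
    sumAbs p q s (P :: L) =
      dist (p * P.1 + q * (bif s then P.2.2.1 else P.2.1)) ((p + q) * 65536) + sumAbs p q s L := rfl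

theorem sumErr_cons (P : Pow) (L : List Pow) : sumErr (P :: L) = P.2.2.2.1 + sumErr L := rfl

theorem PowValid.term_le {z : ℂ} {j : ℕ} {P : Pow} (hP : PowValid z j P)
    {u : ℕ × ℕ × ℕ × Bool} (hu : DirValid u) :
    u.2.2.1 * |(conj (dir u) * z ^ j).re| * 65536
      ≤ dist (u.1 * P.1 + u.2.1 * (bif u.2.2.2 then P.2.2.1 else P.2.1)) ((u.1 + u.2.1) * 65536)
        + u.2.2.1 * P.2.2.2.1 := by
  set p : ℂ := ⟨P.1 / 65536 - 1, P.2.1 / 65536 - 1⟩ with hp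
  have h1 : |(conj (dir u) * z ^ j).re| ≤ |(conj (dir u) * p).re| + P.2.2.2.1 / 65536 := by
    have e : (conj (dir u) * z ^ j).re
        = (conj (dir u) * p).re + (conj (dir u) * (z ^ j - p)).re := by
      rw [← Complex.add_re]; ring_nf
    rw [e]
    exact (abs_add_le _ _).trans
      (by gcongr; exact (re_conj_mul_le (norm_dir hu) _).trans hP.err)
  have h2 : u.2.2.1 * |(conj (dir u) * p).re| * 65536 =
      dist (u.1 * P.1 + u.2.1 * (bif u.2.2.2 then P.2.2.1 else P.2.1)) ((u.1 + u.2.1) * 65536) := by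
    have hZ : (P.2.2.1 : ℝ) = 131072 - P.2.1 := by
      have : ((P.2.1 + P.2.2.1 : ℕ) : ℝ) = 131072 := by exact_mod_cast hP.compl
      push_cast at this; linarith
    have e : (u.2.2.1 : ℝ) * |(conj (dir u) * p).re| = |u.2.2.1 * (conj (dir u) * p).re| := by
      rw [abs_mul, Nat.abs_cast]
    rw [e, re_conj_dir_mul hu, dist_cast]
    have e2 : ∀ a : ℝ, |a| * 65536 = |a * 65536| := fun a => by
      rw [abs_mul, abs_of_nonneg (by norm_num : (0 : ℝ) ≤ 65536)]
    rw [e2]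
    congr 1
    cases u.2.2.2 <;> simp only [hp, cond_true, cond_false] <;> push_cast [hZ] <;> ring
  have h3 : (0 : ℝ) ≤ u.2.2.1 := by positivity
  calc (u.2.2.1 : ℝ) * |(conj (dir u) * z ^ j).re| * 65536
      ≤ u.2.2.1 * (|(conj (dir u) * p).re| + P.2.2.2.1 / 65536) * 65536 := by gcongr
    _ = u.2.2.1 * |(conj (dir u) * p).re| * 65536 + u.2.2.1 * P.2.2.2.1 := by ring
    _ = _ := by rw [h2]

theorem powers_succ (D : Data) (n : ℕ) (P : Pow) :
    powers D (n + 1) P = nextPow D P :: powers D n (nextPow D P) := rfl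

theorem lastPow_cons (P Q : Pow) (L : List Pow) : lastPow (P :: L) Q = lastPow L P := rfl

theorem PowValid.lastPow {D : Data} {z : ℂ} (h : Valid D z) (n : ℕ) :
    ∀ (j : ℕ) (P : Pow), PowValid z j P → PowValid z (j + n) (lastPow (powers D n P) P) := by
  induction n with
  | zero => exact fun j P hP => hP
  | succ n ih =>
    intro j P hP
    rw [powers_succ, lastPow_cons, show j + (n + 1) = j + 1 + n by ring]
    exact ih _ _ (hP.next h)

theorem sum_powers_le {D : Data} {z : ℂ} (h : Valid D z) {u : ℕ × ℕ × ℕ × Bool} (hu : DirValid u)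
    (n : ℕ) : ∀ (j : ℕ) (P : Pow), PowValid z j P →
      u.2.2.1 * (∑ k ∈ Finset.range n, |(conj (dir u) * z ^ (j + k + 1)).re|) * 65536
        ≤ (sumAbs u.1 u.2.1 u.2.2.2 (powers D n P) + u.2.2.1 * sumErr (powers D n P) : ℕ) := by
  induction n with
  | zero =>
    intro j P _
    rw [Finset.range_zero, Finset.sum_empty, mul_zero, zero_mul]
    exact Nat.cast_nonneg _
  | succ n ih =>
    intro j P hP
    have i2 := ih (j + 1) (nextPow D P) (hP.next h)
    have t := (hP.next h).term_le hu
    rw [powers_succ, Finset.sum_range_succ', sumAbs_cons, sumErr_cons]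
    generalize nextPow D P = P' at i2 t ⊢
    push_cast at i2 t ⊢
    have e3 : ∀ k, j + (k + 1) + 1 = j + 1 + k + 1 := fun k => by ring
    simp only [e3, add_zero]
    linarith

/-- The bound for the support function that is used by `finalTest`. -/
theorem zonoidSupport_dir_le {D : Data} {z : ℂ} (h : Valid D z) {u : ℕ × ℕ × ℕ × Bool}
    (hu : DirValid u) (N : ℕ) :
    u.2.2.1 * zonoidSupport z (dir u) * 65536 ≤
      (sumAbs u.1 u.2.1 u.2.2.2 (powers D N onePow) + u.2.2.1 * (sumErr (powers D N onePow) +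
        ((lastPow (powers D N onePow) onePow).2.2.2.2 * tailBound D / 65536 + 1)) : ℕ) := by
  have h1 := PowValid.lastPow h N 0 onePow (powValid_one z)
  have h2 := sum_powers_le h hu N 0 onePow (powValid_one z)
  rw [zero_add] at h1
  have hz : ‖z‖ < 1 := h.norm_lt.trans (by norm_num)
  have h3 := zonoidSupport_le hz (norm_dir hu) N
  have h4 : ‖z‖ / (1 - ‖z‖) ≤ tailBound D / 65536 := by
    have h5 := (div_bounds (D.rh * D.Sh)).2
    have h6 : ‖z‖ / (1 - ‖z‖) ≤ D.rh / 65536 * (D.Sh / 65536) := by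
      rw [div_eq_mul_one_div]
      exact mul_le_mul h.rh h.Sh (by rw [one_div, inv_nonneg]; linarith) (by positivity)
    unfold tailBound
    push_cast at h5 ⊢
    have h7 : (D.rh : ℝ) / 65536 * (D.Sh / 65536) = D.rh * D.Sh / 65536 / 65536 := by ring
    linarith
  set l := (lastPow (powers D N onePow) onePow).2.2.2.2 with hl
  have h8 : ‖z‖ ^ N * (‖z‖ / (1 - ‖z‖)) ≤ l / 65536 * (tailBound D / 65536) :=
    mul_le_mul h1.pow h4 (div_nonneg (norm_nonneg _) (by linarith)) (by positivity)
  have h9 := (div_bounds (l * tailBound D)).2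
  have hn : (0 : ℝ) < u.2.2.1 := by exact_mod_cast hu.1
  simp only [zero_add] at h2
  push_cast at h2 h9 ⊢
  have h10 : zonoidSupport z (dir u) * 65536 ≤
      (∑ k ∈ Finset.range N, |(conj (dir u) * z ^ (k + 1)).re|) * 65536 +
        (((l * tailBound D / 65536 : ℕ) : ℝ) + 1) := by
    have : (l : ℝ) / 65536 * (tailBound D / 65536) * 65536 = l * tailBound D / 65536 := by ring
    linarith
  have h11 := mul_le_mul_of_nonneg_left h10 hn.le
  linarith

/-- The conclusion of the computation for one orbit point. -/
def Separated (z : ℂ) (t : ℝ) (σ : ℂ) : Prop :=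
  (∃ u : ℂ, (2 + t) * (zonoidSupport z u - (conj u * (σ - 1)).re) < 2 * u.re) ∧
    ∃ u : ℂ, 0 ≤ u.re ∧ zonoidSupport z u < (1 + t) * (conj u * (σ - 1)).re

theorem re_dir_point {u : ℕ × ℕ × ℕ × Bool} (hu : DirValid u) {x y w e : ℕ} {σ : ℂ}
    (hyw : y + w = 524288) (he : ‖σ - pt x y‖ ≤ e / 65536) :
    ((u.1 * x + u.2.1 * (bif u.2.2.2 then w else y) : ℕ) : ℝ) - 262144 * (u.1 + u.2.1)
      - u.2.2.1 * e ≤ u.2.2.1 * (conj (dir u) * (σ - 1)).re * 65536 := by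
  have hw : (w : ℝ) = 524288 - y := by
    have : ((y + w : ℕ) : ℝ) = 524288 := by exact_mod_cast hyw
    push_cast at this; linarith
  have e1 : (conj (dir u) * (σ - 1)).re
      = (conj (dir u) * (pt x y - 1)).re + (conj (dir u) * (σ - pt x y)).re := by
    rw [← Complex.add_re]; ring_nf
  have e2 := (abs_le.1 ((re_conj_mul_le (norm_dir hu) _).trans he)).1
  have e3 := re_conj_dir_mul hu (pt x y - 1)
  have hn : (0 : ℝ) ≤ u.2.2.1 := by positivity
  have e4 := mul_le_mul_of_nonneg_left e2 hn
  rw [e1]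
  have e5 : (pt x y - 1).re = x / 65536 - 4 := by simp [pt]; ring
  have e6 : (pt x y - 1).im = y / 65536 - 4 := by simp [pt]
  rw [e5, e6] at e3
  have e7 : (u.1 : ℝ) * (x / 65536 - 4) + u.2.1 * (bif u.2.2.2 then -((y : ℝ) / 65536 - 4)
      else y / 65536 - 4) = (((u.1 * x + u.2.1 * (bif u.2.2.2 then w else y) : ℕ) : ℝ)
        - 262144 * (u.1 + u.2.1)) / 65536 := by
    cases u.2.2.2 <;> simp only [cond_true, cond_false] <;> push_cast [hw] <;> ring
  rw [e7] at e3
  linarith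

theorem tests_cons (T e err : ℕ) (L : List Pow) (i : ℕ) (us : List ℕ) :
    tests T e err L (i :: us) = thresholds T (lookup directions i)
      (262144 * ((lookup directions i).1 + (lookup directions i).2.1)
        + (lookup directions i).2.2.1 * e)
      (sumAbs (lookup directions i).1 (lookup directions i).2.1 (lookup directions i).2.2.2 L
        + (lookup directions i).2.2.1 * err) :: tests T e err L us := rfl

theorem exists_of_passA {x y w T e err : ℕ} {L : List Pow} {us : List ℕ}
    (h : passA x y w (tests T e err L us) = true) :
    ∃ u, DirValid u ∧ 262144 * (u.1 + u.2.1) + u.2.2.1 * e + (sumAbs u.1 u.2.1 u.2.2.2 L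
      + u.2.2.1 * err) + 1 - 13107200 * u.1 / (200 + T)
        ≤ u.1 * x + u.2.1 * (bif u.2.2.2 then w else y) := by
  induction us with
  | nil => simp [tests, passA] at h
  | cons i us ih =>
    rw [tests_cons] at h
    change (bif Nat.ble _ _ then true else passA x y w (tests T e err L us)) = true at h
    rw [bif_ble] at h
    split_ifs at h with hc
    · exact ⟨_, dirValid_lookup i, hc⟩
    · exact ih h

theorem exists_of_passB {x y w T e err : ℕ} {L : List Pow} {us : List ℕ}
    (h : passB x y w (tests T e err L us) = true) :
    ∃ u, DirValid u ∧ 262144 * (u.1 + u.2.1) + u.2.2.1 * e + 100 * (sumAbs u.1 u.2.1 u.2.2.2 L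
      + u.2.2.1 * err) / (100 + T) + 1 ≤ u.1 * x + u.2.1 * (bif u.2.2.2 then w else y) := by
  induction us with
  | nil => simp [tests, passB] at h
  | cons i us ih =>
    rw [tests_cons] at h
    change (bif Nat.ble _ _ then true else passB x y w (tests T e err L us)) = true at h
    rw [bif_ble] at h
    split_ifs at h with hc
    · exact ⟨_, dirValid_lookup i, hc⟩
    · exact ih h

theorem separated_of_finalTest {D : Data} {z : ℂ} (h : Valid D z) {N T e : ℕ} {us : List ℕ}
    {L : List (ℕ × ℕ × ℕ)} (hL : Covers z e L) (hf : finalTest N T e D us L = true) :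
    ∀ σ ∈ orbitPoints z, Separated z (T / 100) σ := by
  intro σ hσ
  obtain ⟨⟨x, y, w⟩, hp, hyw, -, he⟩ := hL σ hσ
  have hf' : allPts (fun x y z => passA x y z (tests T e (sumErr (powers D N onePow) +
      ((lastPow (powers D N onePow) onePow).2.2.2.2 * tailBound D / 65536 + 1))
      (powers D N onePow) us) && passB x y z (tests T e (sumErr (powers D N onePow) +
      ((lastPow (powers D N onePow) onePow).2.2.2.2 * tailBound D / 65536 + 1))
      (powers D N onePow) us)) L = true := hf
  have hxy := of_allPts hf' _ hp
  dsimp only at hxy hyw he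
  rw [Bool.and_eq_true] at hxy
  obtain ⟨hA, hB⟩ := hxy
  constructor
  · obtain ⟨u, hu, hle⟩ := exists_of_passA hA
    refine ⟨dir u, ?_⟩
    have h1 := re_dir_point hu hyw he
    have h2 := zonoidSupport_dir_le h hu N
    have hn : (0 : ℝ) < u.2.2.1 := by exact_mod_cast hu.1
    have hur : (dir u).re * u.2.2.1 = u.1 := by
      change (u.1 : ℝ) / u.2.2.1 * u.2.2.1 = u.1
      field_simp
    generalize sumAbs u.1 u.2.1 u.2.2.2 (powers D N onePow) + u.2.2.1 * _ = H at h2 hle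
    generalize u.1 * x + u.2.1 * (bif u.2.2.2 then w else y) = V at h1 hle
    have h3 : 262144 * (u.1 + u.2.1) + u.2.2.1 * e + H + 1 ≤ V + 13107200 * u.1 / (200 + T) := by
      omega
    have h4 : ((13107200 * u.1 / (200 + T) : ℕ) : ℝ) ≤ 13107200 * u.1 / (200 + T) := by
      exact_mod_cast Nat.cast_div_le (α := ℝ) (m := 13107200 * u.1) (n := 200 + T)
    have h5 : (262144 * (u.1 + u.2.1) + u.2.2.1 * e + H + 1 : ℝ)
        ≤ V + ((13107200 * u.1 / (200 + T) : ℕ) : ℝ) := by exact_mod_cast h3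
    have h6 : u.2.2.1 * (zonoidSupport z (dir u) - (conj (dir u) * (σ - 1)).re) * 65536
        < 13107200 * u.1 / (200 + T) := by linarith
    rw [lt_div_iff₀ (by positivity), ← hur] at h6
    have h7 : u.2.2.1 * 6553600 * ((2 + T / 100) *
        (zonoidSupport z (dir u) - (conj (dir u) * (σ - 1)).re))
        < u.2.2.1 * 6553600 * (2 * (dir u).re) := by linarith
    exact lt_of_mul_lt_mul_left h7 (by positivity)
  · obtain ⟨u, hu, hle⟩ := exists_of_passB hB
    refine ⟨dir u, by change 0 ≤ (u.1 : ℝ) / u.2.2.1; positivity, ?_⟩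
    have h1 := re_dir_point hu hyw he
    have h2 := zonoidSupport_dir_le h hu N
    have hn : (0 : ℝ) < u.2.2.1 := by exact_mod_cast hu.1
    generalize sumAbs u.1 u.2.1 u.2.2.2 (powers D N onePow) + u.2.2.1 * _ = H at h2 hle
    generalize u.1 * x + u.2.1 * (bif u.2.2.2 then w else y) = V at h1 hle
    have h3 : (100 * H : ℝ) / (100 + T) < ((100 * H / (100 + T) : ℕ) : ℝ) + 1 := by
      rw [div_lt_iff₀ (by positivity), mul_comm _ (100 + (T : ℝ))]
      exact_mod_cast Nat.lt_mul_div_succ (100 * H) (by omega : 0 < 100 + T)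
    have h5 : (262144 * (u.1 + u.2.1) + u.2.2.1 * e + ((100 * H / (100 + T) : ℕ) : ℝ) + 1 : ℝ)
        ≤ V := by exact_mod_cast hle
    have h6 : (100 * H : ℝ) / (100 + T) < u.2.2.1 * (conj (dir u) * (σ - 1)).re * 65536 := by
      linarith
    rw [div_lt_iff₀ (by positivity)] at h6
    have h7 : u.2.2.1 * 6553600 * zonoidSupport z (dir u)
        < u.2.2.1 * 6553600 * ((1 + T / 100) * (conj (dir u) * (σ - 1)).re) := by linarith
    exact lt_of_mul_lt_mul_left h7 (by positivity)


theorem norm_le_Sh {D : Data} {z : ℂ} (h : Valid D z) :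
    ∀ σ ∈ orbitPoints z, ‖σ‖ ≤ D.Sh / 65536 := fun _ hσ =>
  (orbitPoints_step hσ).2.1.trans h.Sh

theorem tail_le {D : Data} {z : ℂ} (h : Valid D z) :
    ‖z‖ * (1 / (1 - ‖z‖)) ≤ tailBound D / 65536 := by
  have h5 := (div_bounds (D.rh * D.Sh)).2
  have hz := h.norm_lt
  have h6 : ‖z‖ * (1 / (1 - ‖z‖)) ≤ D.rh / 65536 * (D.Sh / 65536) :=
    mul_le_mul h.rh h.Sh (by rw [one_div, inv_nonneg]; linarith) (by positivity)
  unfold tailBound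
  push_cast at h5 ⊢
  have h7 : (D.rh : ℝ) / 65536 * (D.Sh / 65536) = D.rh * D.Sh / 65536 / 65536 := by ring
  linarith

theorem covers_start {D : Data} {z : ℂ} (h : Valid D z) :
    Covers z (tailBound D) [(262144, 262144, 262144)] := by
  intro σ hσ
  have hpt : pt 262144 262144 = 1 := by apply Complex.ext <;> norm_num [pt]
  refine ⟨_, List.mem_singleton_self _, rfl, ?_, ?_⟩
  · dsimp only; rw [hpt]; norm_num
  · dsimp only
    rw [hpt]
    refine le_trans ?_ (tail_le h)
    obtain ⟨-, -, σ', hσ', hs⟩ := orbitPoints_step hσ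
    have h1 := (orbitPoints_step hσ').2.1
    have h2 : ‖σ - 1‖ = ‖z‖ * ‖σ'‖ := by
      rcases hs with hs | hs
      · rw [hs, add_sub_cancel_left, norm_mul]
      · rw [hs, show 1 - z * σ' - 1 = -(z * σ') by ring, norm_neg, norm_mul]
    rw [h2]
    gcongr

theorem separated_of_orbitCheck {D : Data} {z : ℂ} (h : Valid D z) {M n T : ℕ} {us : List ℕ}
    (hc : orbitCheck D M n T us = true) : ∀ σ ∈ orbitPoints z, Separated z (T / 100) σ := by
  obtain ⟨e, L, hL, hf⟩ := exists_of_levels h (norm_le_Sh h) 6 _ _ (covers_start h) hc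
  rw [cond_eq_ite, bif_ble] at hf
  split_ifs at hf with h1 hMe
  have hM : ∀ σ ∈ orbitPoints z, ‖σ‖ ≤ (4096 * M : ℕ) / 65536 := by
    intro σ hσ
    obtain ⟨p, hp, hyw, -, he⟩ := hL σ hσ
    have h2 := norm_le_of_normTest hyw (of_allPts h1 p hp)
    have h3 := norm_add_le (σ - pt p.1 p.2.1) (pt p.1 p.2.1)
    rw [sub_add_cancel] at h3
    rw [Nat.cast_sub hMe, sub_div] at h2
    linarith
  obtain ⟨e', L', hL', hf'⟩ := exists_of_levels h hM n _ _ hL hf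
  exact separated_of_finalTest h hL' hf'

/-- The point with fixed-point coordinates `(x, y)`, with another offset. -/
noncomputable def pt4 (x y : ℕ) : ℂ := ⟨x / 65536 - 4, y / 65536 - 4⟩

theorem mem_addPow {thr x y : ℕ} {q : ℕ × ℕ} {l : List (ℕ × ℕ)} :
    q ∈ addPow thr x y l ↔ (137438953472 ≤ thr * thr + x * (524288 - x) + y * (524288 - y)
      ∧ q = (x, y)) ∨ q ∈ l := by
  unfold addPow
  rw [bif_ble]
  split_ifs with h
  · rw [List.mem_cons]; tauto
  · tauto

theorem mem_extend {P : Pow} {thr : ℕ} {L : List (ℕ × ℕ)} {q : ℕ × ℕ} :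
    q ∈ extend P thr L ↔ ∃ p ∈ L,
      q ∈ addPow thr (p.1 + P.1 - 65536) (p.2 + P.2.1 - 65536)
        (addPow thr (p.1 + 65536 - P.1) (p.2 + 65536 - P.2.1) []) := by
  induction L with
  | nil => simp [extend]
  | cons p' L ih =>
    have e : extend P thr (p' :: L) = addPow thr (p'.1 + P.1 - 65536) (p'.2 + P.2.1 - 65536)
      (addPow thr (p'.1 + 65536 - P.1) (p'.2 + 65536 - P.2.1) (extend P thr L)) := rfl
    rw [e, List.exists_mem_cons_iff, ← ih]
    simp only [mem_addPow, List.not_mem_nil, or_false]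
    exact or_assoc.symm

theorem norm_pt4_le {thr x y : ℕ} (ht : thr ≤ 196608)
    (h : 137438953472 ≤ thr * thr + x * (524288 - x) + y * (524288 - y)) : ‖pt4 x y‖ ≤ 3 := by
  have h0 : thr * thr ≤ 196608 * 196608 := Nat.mul_le_mul ht ht
  have hb : ∀ t : ℕ, t * (524288 - t) ≤ 68719476736 := fun t => by
    rcases le_total t 524288 with h | h
    · obtain ⟨s, hs⟩ := Nat.exists_eq_add_of_le h
      have h1 := four_mul_le_sq_add t s
      rw [← hs, mul_assoc] at h1
      rw [show 524288 - t = s by omega]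
      omega
    · rw [Nat.sub_eq_zero_of_le h]; simp
  have hx : x ≤ 524288 := by
    by_contra hc
    rw [Nat.sub_eq_zero_of_le (by omega : 524288 ≤ x)] at h
    have := hb y
    omega
  have hy : y ≤ 524288 := by
    by_contra hc
    rw [Nat.sub_eq_zero_of_le (by omega : 524288 ≤ y)] at h
    have := hb x
    omega
  have h1 : (137438953472 : ℝ) ≤ 196608 * 196608 + x * (524288 - x) + y * (524288 - y) := by
    have : 137438953472 ≤ 196608 * 196608 + x * (524288 - x) + y * (524288 - y) := by omega
    have h2 : ((137438953472 : ℕ) : ℝ)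
      ≤ ((196608 * 196608 + x * (524288 - x) + y * (524288 - y) : ℕ) : ℝ) := by exact_mod_cast this
    push_cast [Nat.cast_sub hx, Nat.cast_sub hy] at h2
    linarith
  refine norm_mk_le (by norm_num) ?_
  linarith

theorem addPow_cond {thr x y : ℕ} {w : ℂ} {e t : ℕ} (hpt : ‖w - pt4 x y‖ ≤ e / 65536)
    (hw : ‖w‖ ≤ t / 65536) (hthr : thr = e + t) (h3 : ‖pt4 x y‖ ≤ 4) :
    137438953472 ≤ thr * thr + x * (524288 - x) + y * (524288 - y) := by
  have hre : (pt4 x y).re = x / 65536 - 4 := rfl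
  have him : (pt4 x y).im = y / 65536 - 4 := rfl
  have hx : x ≤ 524288 := by
    have := (abs_le.1 ((Complex.abs_re_le_norm _).trans h3)).2
    have : (x : ℝ) ≤ 524288 := by linarith
    exact_mod_cast this
  have hy : y ≤ 524288 := by
    have := (abs_le.1 ((Complex.abs_im_le_norm _).trans h3)).2
    have : (y : ℝ) ≤ 524288 := by linarith
    exact_mod_cast this
  have h4 : ‖pt4 x y‖ ≤ thr / 65536 := by
    have := norm_sub_le w (w - pt4 x y)
    rw [sub_sub_cancel] at this
    rw [hthr]; push_cast; linarith
  have h5 : ‖pt4 x y‖ ^ 2 ≤ (thr / 65536 : ℝ) ^ 2 := by gcongr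
  rw [Complex.sq_norm, Complex.normSq_apply, hre, him] at h5
  have h6 : (137438953472 : ℝ) ≤ thr * thr + x * (524288 - x) + y * (524288 - y) := by
    linarith
  have h2 : ((137438953472 : ℕ) : ℝ)
      ≤ ((thr * thr + x * (524288 - x) + y * (524288 - y) : ℕ) : ℝ) := by
    push_cast [Nat.cast_sub hx, Nat.cast_sub hy]
    exact h6
  exact_mod_cast h2

theorem norm_partial_le {z : ℂ} (hz : ‖z‖ < 1) {c : ℕ → ℤ} (hc : ∀ n, c n = 1 ∨ c n = -1)
    (h0 : ∑' n, (c n : ℂ) * z ^ n = 0) (j : ℕ) :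
    ‖∑ k ∈ Finset.range (j + 1), (c k : ℂ) * z ^ k‖ ≤ ‖z‖ ^ j * (‖z‖ * (1 / (1 - ‖z‖))) := by
  have hnorm : ∀ n, ‖(c n : ℂ) * z ^ n‖ = ‖z‖ ^ n := fun n => by
    rcases hc n with h | h <;> simp [h]
  have hs : Summable fun n => (c n : ℂ) * z ^ n :=
    Summable.of_norm (by simpa only [hnorm] using summable_geometric_of_lt_one (norm_nonneg z) hz)
  have h1 := hs.sum_add_tsum_nat_add (j + 1)
  rw [h0] at h1
  rw [eq_neg_of_add_eq_zero_left h1, norm_neg]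
  have h2 : HasSum (fun k : ℕ => ‖z‖ ^ j * (‖z‖ * ‖z‖ ^ k))
      (‖z‖ ^ j * (‖z‖ * (1 / (1 - ‖z‖)))) := by
    rw [one_div]
    exact ((hasSum_geometric_of_lt_one (norm_nonneg z) hz).mul_left _).mul_left _
  refine tsum_of_norm_bounded h2 fun k => le_of_eq ?_
  rw [hnorm]; ring

theorem not_noRoot {D : Data} {z : ℂ} (h : Valid D z) {c : ℕ → ℤ} (hc : ∀ n, c n = 1 ∨ c n = -1)
    (h0 : ∑' n, (c n : ℂ) * z ^ n = 0) (n : ℕ) :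
    ∀ (j : ℕ) (P : Pow) (e : ℕ) (L : List (ℕ × ℕ)), PowValid z j P →
      (∃ p ∈ L, ‖pt4 p.1 p.2‖ ≤ 3 ∧
        ‖∑ k ∈ Finset.range (j + 1), (c k : ℂ) * z ^ k - pt4 p.1 p.2‖ ≤ e / 65536) →
      noRoot D n P e L ≠ true := by
  have hz : ‖z‖ < 1 := h.norm_lt.trans (by norm_num)
  induction n with
  | zero =>
    rintro j P e L - ⟨p, hp, -⟩ hn
    cases L with
    | nil => simp at hp
    | cons p' L =>
      change false = true at hn
      cases hn
  | succ n ih =>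
    rintro j P e L hP ⟨p, hp, hp3, hpe⟩ hn
    have hP' := hP.next h
    change (bif Nat.ble (e + (nextPow D P).2.2.2.1 + ((nextPow D P).2.2.2.2 * tailBound D / 65536
      + 1)) 196608 then noRoot D n (nextPow D P) (e + (nextPow D P).2.2.2.1) (extend (nextPow D P)
      (e + (nextPow D P).2.2.2.1 + ((nextPow D P).2.2.2.2 * tailBound D / 65536 + 1)) L)
      else false) = true at hn
    generalize nextPow D P = P' at hP' hn
    rw [bif_ble] at hn
    split_ifs at hn with hthr
    set t := P'.2.2.2.2 * tailBound D / 65536 + 1 with ht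
    set thr := e + P'.2.2.2.1 + t with hthr'
    have hpart : ‖∑ k ∈ Finset.range (j + 1 + 1), (c k : ℂ) * z ^ k‖ ≤ t / 65536 := by
      refine (norm_partial_le hz hc h0 (j + 1)).trans ?_
      have h1 := (div_bounds (P'.2.2.2.2 * tailBound D)).2
      have h2 := mul_le_mul hP'.pow (tail_le h) (mul_nonneg (norm_nonneg _)
        (by rw [one_div, inv_nonneg]; linarith)) (by positivity)
      rw [ht]
      push_cast at h1 ⊢
      have h7 : (P'.2.2.2.2 : ℝ) / 65536 * (tailBound D / 65536)
        = P'.2.2.2.2 * tailBound D / 65536 / 65536 := by ring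
      linarith
    have hxb := (abs_le.1 ((Complex.abs_re_le_norm _).trans hp3)).1
    have hyb := (abs_le.1 ((Complex.abs_im_le_norm _).trans hp3)).1
    have hPx := (abs_le.1 ((Complex.abs_re_le_norm _).trans hP'.norm_le)).2
    have hPy := (abs_le.1 ((Complex.abs_im_le_norm _).trans hP'.norm_le)).2
    dsimp only [pt4] at hxb hyb hPx hPy
    have hx1 : 65536 ≤ p.1 := by
      have : (65536 : ℝ) ≤ p.1 := by linarith
      exact_mod_cast this
    have hy1 : 65536 ≤ p.2 := by
      have : (65536 : ℝ) ≤ p.2 := by linarith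
      exact_mod_cast this
    have hX : P'.1 ≤ 131072 := by
      have : (P'.1 : ℝ) ≤ 131072 := by linarith
      exact_mod_cast this
    have hY : P'.2.1 ≤ 131072 := by
      have : (P'.2.1 : ℝ) ≤ 131072 := by linarith
      exact_mod_cast this
    set pw : ℂ := ⟨P'.1 / 65536 - 1, P'.2.1 / 65536 - 1⟩ with hpw
    have e1 : pt4 (p.1 + P'.1 - 65536) (p.2 + P'.2.1 - 65536) = pt4 p.1 p.2 + pw := by
      apply Complex.ext
      · simp only [pt4, hpw, Complex.add_re]
        push_cast [Nat.cast_sub (by omega : 65536 ≤ p.1 + P'.1)]; ring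
      · simp only [pt4, hpw, Complex.add_im]
        push_cast [Nat.cast_sub (by omega : 65536 ≤ p.2 + P'.2.1)]; ring
    have e2 : pt4 (p.1 + 65536 - P'.1) (p.2 + 65536 - P'.2.1) = pt4 p.1 p.2 - pw := by
      apply Complex.ext
      · simp only [pt4, hpw, Complex.sub_re]
        push_cast [Nat.cast_sub (by omega : P'.1 ≤ p.1 + 65536)]; ring
      · simp only [pt4, hpw, Complex.sub_im]
        push_cast [Nat.cast_sub (by omega : P'.2.1 ≤ p.2 + 65536)]; ring
    have herr : ∀ s : ℂ, ‖s‖ ≤ 1 → ‖(∑ k ∈ Finset.range (j + 1), (c k : ℂ) * z ^ k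
        + s * z ^ (j + 1)) - (pt4 p.1 p.2 + s * pw)‖ ≤ (e + P'.2.2.2.1 : ℕ) / 65536 := by
      intro s hs
      have : (∑ k ∈ Finset.range (j + 1), (c k : ℂ) * z ^ k + s * z ^ (j + 1))
        - (pt4 p.1 p.2 + s * pw) = (∑ k ∈ Finset.range (j + 1), (c k : ℂ) * z ^ k - pt4 p.1 p.2)
          + s * (z ^ (j + 1) - pw) := by ring
      rw [this]
      refine (norm_add_le _ _).trans ?_
      rw [norm_mul]
      have := mul_le_mul hs hP'.err (norm_nonneg _) zero_le_one
      push_cast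
      linarith
    have h34 : ∀ s : ℂ, ‖s‖ ≤ 1 → ‖pt4 p.1 p.2 + s * pw‖ ≤ 4 := fun s hs => by
      refine (norm_add_le _ _).trans ?_
      rw [norm_mul]
      have := mul_le_mul hs hP'.norm_le (norm_nonneg _) zero_le_one
      linarith
    refine ih (j + 1) P' _ _ hP' ?_ hn
    rw [Finset.sum_range_succ _ (j + 1)] at hpart ⊢
    rcases hc (j + 1) with h1 | h1
    · have g1 := herr 1 (by simp)
      have g2 := h34 1 (by simp)
      rw [h1, Int.cast_one] at hpart ⊢
      rw [one_mul pw, ← e1] at g1 g2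
      have g3 := addPow_cond g1 hpart hthr' g2
      exact ⟨_, mem_extend.2 ⟨p, hp, mem_addPow.2 (Or.inl ⟨g3, rfl⟩)⟩, norm_pt4_le hthr g3, g1⟩
    · have g1 := herr (-1) (by simp)
      have g2 := h34 (-1) (by simp)
      rw [h1, Int.cast_neg, Int.cast_one] at hpart ⊢
      rw [neg_one_mul pw, ← sub_eq_add_neg, ← e2] at g1 g2
      have g3 := addPow_cond g1 hpart hthr' g2
      exact ⟨_, mem_extend.2 ⟨p, hp, mem_addPow.2 (Or.inr (mem_addPow.2 (Or.inl ⟨g3, rfl⟩)))⟩,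
        norm_pt4_le hthr g3, g1⟩


theorem valid_mkData {z : ℂ} {a b h s : ℕ} (hs : goodSqrt (a * a + b * b) s = true)
    (hx : |z.re * 65536 - a| ≤ h) (hy : |z.im * 65536 - b| ≤ h) (h1 : 1 / 2 ≤ ‖z‖)
    (h2 : ‖z‖ ^ 2 ≤ 1 / 2) : Valid (mkData a b (h * 92682 / 65536 + 1) s) z := by
  have hz : ‖z‖ ≤ 46341 / 65536 := abs_le_of_sq_le_sq' (by norm_num; linarith) (by norm_num) |>.2
  unfold goodSqrt at hs
  rw [bif_ble, bif_ble] at hs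
  split_ifs at hs with s1 s2
  have s3 : s ≤ 47000 := Nat.le_of_ble_eq_true hs
  set eta := h * 92682 / 65536 + 1 with heta
  have hc : ‖z - (⟨a / 65536, b / 65536⟩ : ℂ)‖ ≤ eta / 65536 := by
    have e1 : (h * 92682 : ℝ) ≤ 65536 * eta := by
      have : h * 92682 ≤ 65536 * eta := by omega
      exact_mod_cast this
    have e2 : |z.re - a / 65536| ≤ h / 65536 := by
      rw [show z.re - a / 65536 = (z.re * 65536 - a) / 65536 by ring, abs_div,
        abs_of_nonneg (by norm_num : (0 : ℝ) ≤ 65536)]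
      gcongr
    have e3 : |z.im - b / 65536| ≤ h / 65536 := by
      rw [show z.im - b / 65536 = (z.im * 65536 - b) / 65536 by ring, abs_div,
        abs_of_nonneg (by norm_num : (0 : ℝ) ≤ 65536)]
      gcongr
    have e4 := mul_self_le_mul_self (abs_nonneg _) e2
    have e5 := mul_self_le_mul_self (abs_nonneg _) e3
    rw [abs_mul_abs_self] at e4 e5
    have e6 := mul_self_le_mul_self (by positivity) e1
    have : z - (⟨a / 65536, b / 65536⟩ : ℂ) = ⟨z.re - a / 65536, z.im - b / 65536⟩ := rfl
    rw [this]
    refine norm_mk_le (by positivity) ?_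
    have e7 : (0 : ℝ) ≤ (h : ℝ) * h := by positivity
    linarith
  have hcn : ‖(⟨a / 65536, b / 65536⟩ : ℂ)‖ ≤ (s + 1) / 65536 := by
    refine norm_mk_le (by positivity) ?_
    have : (a * a + b * b : ℝ) ≤ (s + 1) * (s + 1) := by exact_mod_cast s1
    linarith
  have hcn' : ((s - 1 : ℕ) : ℝ) / 65536 ≤ ‖(⟨a / 65536, b / 65536⟩ : ℂ)‖ := by
    rw [Complex.norm_def, Complex.normSq_mk]
    apply Real.le_sqrt_of_sq_le
    have : ((s - 1 : ℕ) * (s - 1 : ℕ) : ℝ) ≤ a * a + b * b := by exact_mod_cast s2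
    linarith
  have hrh : ∀ r, r = (bif Nat.ble (s + 1 + eta) 46341 then s + 1 + eta else 46341) →
      ‖z‖ ≤ r / 65536 ∧ r ≤ 46341 := by
    intro r hr
    rw [bif_ble] at hr
    split_ifs at hr with hle
    · refine ⟨?_, hr ▸ hle⟩
      have := norm_add_le (z - (⟨a / 65536, b / 65536⟩ : ℂ)) ⟨a / 65536, b / 65536⟩
      rw [sub_add_cancel] at this
      rw [hr]; push_cast; linarith
    · subst hr; exact ⟨by exact_mod_cast hz, le_rfl⟩
  have hrl : ∀ r, r = (bif Nat.ble (s - 1 - eta) 32768 then 32768 else s - 1 - eta) →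
      (r : ℝ) / 65536 ≤ ‖z‖ := by
    intro r hr
    rw [bif_ble] at hr
    split_ifs at hr with hle
    · subst hr; push_cast; linarith
    · have := norm_sub_le z (z - (⟨a / 65536, b / 65536⟩ : ℂ))
      rw [sub_sub_cancel] at this
      rw [hr, Nat.cast_sub (by omega)]
      linarith
  have e : ∀ eta', mkData a b eta' s = ⟨a, b, eta', s + 1,
    (bif Nat.ble (s + 1 + eta') 46341 then s + 1 + eta' else 46341),
    4294967296 / (65536 - (bif Nat.ble (s + 1 + eta') 46341 then s + 1 + eta' else 46341)) + 1,
    4294967296 / (65536 - (bif Nat.ble (s - 1 - eta') 32768 then 32768 else s - 1 - eta'))⟩ :=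
    fun _ => rfl
  rw [e]
  obtain ⟨r, hr⟩ : ∃ r, r = (bif Nat.ble (s + 1 + eta) 46341 then s + 1 + eta else 46341) :=
    ⟨_, rfl⟩
  obtain ⟨r', hr'⟩ : ∃ r, r = (bif Nat.ble (s - 1 - eta) 32768 then 32768 else s - 1 - eta) :=
    ⟨_, rfl⟩
  rw [← hr, ← hr']
  obtain ⟨g1, g2⟩ := hrh r hr
  have g3 := hrl r' hr'
  have g4 : r' < 65536 := by
    have : (r' : ℝ) < 65536 := by linarith
    exact_mod_cast this
  have g5 : (0 : ℝ) < 1 - ‖z‖ := by linarith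
  refine ⟨s1, hc, by dsimp only; omega, g1, g2, ?_, ?_⟩
  · dsimp only
    have : ((4294967296 / (65536 - r') : ℕ) : ℝ) ≤ (4294967296 : ℕ) / (65536 - r' : ℕ) :=
      Nat.cast_div_le
    rw [Nat.cast_sub g4.le] at this
    push_cast at this
    have g6 : (0 : ℝ) < 65536 - r' := by
      have : (r' : ℝ) < 65536 := by exact_mod_cast g4
      linarith
    rw [div_le_iff₀ (by norm_num)]
    refine this.trans ?_
    rw [div_le_iff₀ g6, one_div, mul_assoc, ← div_eq_inv_mul, le_div_iff₀ g5]
    linarith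
  · dsimp only
    have g7 : (0 : ℝ) < 65536 - r := by
      have : (r : ℝ) ≤ 46341 := by exact_mod_cast g2
      linarith
    have : (4294967296 : ℝ) < (65536 - r) * ((4294967296 / (65536 - r) : ℕ) + 1) := by
      have := Nat.lt_mul_div_succ 4294967296 (by omega : 0 < 65536 - r)
      have h3 : ((4294967296 : ℕ) : ℝ)
        < (((65536 - r) * (4294967296 / (65536 - r) + 1) : ℕ) : ℝ) := by exact_mod_cast this
      push_cast [Nat.cast_sub (by omega : r ≤ 65536)] at h3
      exact h3
    push_cast
    generalize ((4294967296 / (65536 - r) : ℕ) : ℝ) = X at *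
    rw [div_le_iff₀ g5, div_mul_eq_mul_div, le_div_iff₀ (by norm_num)]
    have hX : 0 ≤ X + 1 := by
      by_contra hneg
      push Not at hneg
      nlinarith
    nlinarith

/-- `z` is a zero of a power series with coefficients `±1`. -/
def IsRoot (z : ℂ) : Prop :=
  ∃ c : ℕ → ℤ, (∀ n, c n = 1 ∨ c n = -1) ∧ c 0 = 1 ∧ ∑' n, (c n : ℂ) * z ^ n = 0

theorem exists_separated_of_check (c : Cert) : ∀ {a b h : ℕ}, h ≤ a → h ≤ b →
    check c a b h = true → ∀ {z : ℂ}, |z.re * 65536 - a| ≤ h → |z.im * 65536 - b| ≤ h →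
    1 / 2 ≤ ‖z‖ → ‖z‖ ^ 2 ≤ 1 / 2 → IsRoot z →
    ∃ t > 0, ∀ σ ∈ orbitPoints z, Separated z t σ := by
  induction c with
  | s =>
    intro a b h ha hb hc z hx hy h1 h2 hr
    exfalso
    change (bif Nat.ble 2147483649 ((a - h) * (a - h) + (b - h) * (b - h)) then true
      else Nat.ble ((a + h) * (a + h) + (b + h) * (b + h)) 1073741823) = true at hc
    rw [bif_ble] at hc
    have hn : ‖z‖ ^ 2 = z.re * z.re + z.im * z.im := by
      rw [Complex.sq_norm, Complex.normSq_apply]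
    rw [abs_le] at hx hy
    split_ifs at hc with h3
    · have h4 : (2147483649 : ℝ) ≤ (a - h) * (a - h) + (b - h) * (b - h) := by
        have : ((2147483649 : ℕ) : ℝ) ≤ (((a - h) * (a - h) + (b - h) * (b - h) : ℕ) : ℝ) := by
          exact_mod_cast h3
        push_cast [Nat.cast_sub ha, Nat.cast_sub hb] at this
        exact this
      have ha' : (h : ℝ) ≤ a := by exact_mod_cast ha
      have hb' : (h : ℝ) ≤ b := by exact_mod_cast hb
      have e1 := mul_self_le_mul_self (by linarith : (0 : ℝ) ≤ a - h)
        (by linarith : (a : ℝ) - h ≤ z.re * 65536)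
      have e2 := mul_self_le_mul_self (by linarith : (0 : ℝ) ≤ b - h)
        (by linarith : (b : ℝ) - h ≤ z.im * 65536)
      linarith
    · have h4 : ((a + h) * (a + h) + (b + h) * (b + h) : ℝ) ≤ 1073741823 := by
        have := Nat.le_of_ble_eq_true hc
        have h5 : (((a + h) * (a + h) + (b + h) * (b + h) : ℕ) : ℝ) ≤ ((1073741823 : ℕ) : ℝ) := by
          exact_mod_cast this
        push_cast at h5
        exact h5
      have ha' : (h : ℝ) ≤ a := by exact_mod_cast ha
      have hb' : (h : ℝ) ≤ b := by exact_mod_cast hb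
      have e1 := mul_self_le_mul_self (by linarith : (0 : ℝ) ≤ z.re * 65536)
        (by linarith : z.re * 65536 ≤ a + h)
      have e2 := mul_self_le_mul_self (by linarith : (0 : ℝ) ≤ z.im * 65536)
        (by linarith : z.im * 65536 ≤ b + h)
      have e3 : (1 / 2 : ℝ) ^ 2 ≤ ‖z‖ ^ 2 := by gcongr
      linarith
  | o n =>
    intro a b h ha hb hc z hx hy h1 h2 hr
    exfalso
    change (bif goodSqrt (a * a + b * b) (approxSqrt (a * a + b * b)) then
      noRoot (mkData a b (h * 92682 / 65536 + 1) (approxSqrt (a * a + b * b))) n onePow 0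
        [(327680, 262144)] else false) = true at hc
    rw [cond_eq_ite] at hc
    split_ifs at hc with hs
    have hV := valid_mkData hs hx hy h1 h2
    obtain ⟨c, hc1, hc0, hc2⟩ := hr
    have hpt : pt4 327680 262144 = 1 := by apply Complex.ext <;> norm_num [pt4]
    refine not_noRoot hV hc1 hc2 n 0 onePow 0 _ (powValid_one z)
      ⟨_, List.mem_singleton_self _, ?_, ?_⟩ hc
    · dsimp only; rw [hpt]; norm_num
    · dsimp only; rw [hpt]; simp [hc0]
  | k M n T us =>
    intro a b h ha hb hc z hx hy h1 h2 hr
    change (bif goodSqrt (a * a + b * b) (approxSqrt (a * a + b * b)) then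
      (bif Nat.ble 1 T then orbitCheck (mkData a b (h * 92682 / 65536 + 1)
        (approxSqrt (a * a + b * b))) M n T us else false) else false) = true at hc
    rw [cond_eq_ite, bif_ble] at hc
    split_ifs at hc with hs hT
    have hT' : (1 : ℝ) ≤ T := by exact_mod_cast hT
    exact ⟨T / 100, by positivity, separated_of_orbitCheck (valid_mkData hs hx hy h1 h2) hc⟩
  | q c₁ c₂ c₃ c₄ i₁ i₂ i₃ i₄ =>
    intro a b h ha hb hc z hx hy h1 h2 hr
    change (bif Nat.beq (2 * (h / 2)) h then
      bif check c₁ (a - h / 2) (b - h / 2) (h / 2) then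
        (bif check c₂ (a + h / 2) (b - h / 2) (h / 2) then
          (bif check c₃ (a - h / 2) (b + h / 2) (h / 2) then
            check c₄ (a + h / 2) (b + h / 2) (h / 2) else false) else false)
        else false else false) = true at hc
    simp only [cond_eq_ite] at hc
    split_ifs at hc with hh k1 k2 k3
    have hh' : 2 * (h / 2) = h := Nat.eq_of_beq_eq_true hh
    obtain ⟨g, hg⟩ : ∃ g, g = h / 2 := ⟨_, rfl⟩
    rw [← hg] at hc k1 k2 k3 hh'
    have hgr : (h : ℝ) = 2 * g := by rw [← hh']; push_cast; ring
    rw [hgr, abs_le] at hx hy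
    have ha1 : g ≤ a := by omega
    have hb1 : g ≤ b := by omega
    rcases le_total (z.re * 65536) a with hxa | hxa <;>
        rcases le_total (z.im * 65536) b with hyb | hyb
    · refine i₁ (by omega) (by omega) k1 ?_ ?_ h1 h2 hr <;> rw [abs_le] <;>
        push_cast [Nat.cast_sub ha1, Nat.cast_sub hb1] <;> constructor <;> linarith
    · refine i₃ (by omega) (by omega) k3 ?_ ?_ h1 h2 hr <;> rw [abs_le] <;>
        push_cast [Nat.cast_sub ha1, Nat.cast_sub hb1] <;> constructor <;> linarith
    · refine i₂ (by omega) (by omega) k2 ?_ ?_ h1 h2 hr <;> rw [abs_le] <;>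
        push_cast [Nat.cast_sub ha1, Nat.cast_sub hb1] <;> constructor <;> linarith
    · refine i₄ (by omega) (by omega) hc ?_ ?_ h1 h2 hr <;> rw [abs_le] <;>
        push_cast [Nat.cast_sub ha1, Nat.cast_sub hb1] <;> constructor <;> linarith


/-- The squares of a column of the grid have certificates. -/
def ColumnChecked (i : ℕ) : Prop :=
  ∀ j < 12, ∃ c, check c ((2 * i + 1) * 2048) ((2 * j + 1) * 2048) 2048 = true

theorem columnChecked_0 : ColumnChecked 0 := by
  intro j hj
  interval_cases j
  · exact ⟨.s, by decide +kernel⟩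
  · exact ⟨.s, by decide +kernel⟩
  · exact ⟨.s, by decide +kernel⟩
  · exact ⟨.s, by decide +kernel⟩
  · exact ⟨.s, by decide +kernel⟩
  · exact ⟨.s, by decide +kernel⟩
  · exact ⟨.s, by decide +kernel⟩
  · exact ⟨.o 1, by decide +kernel⟩
  · exact ⟨.o 1, by decide +kernel⟩
  · exact ⟨.o 2, by decide +kernel⟩
  · exact ⟨.q (.o 3) (.o 3) (.o 13) (.o 9), by decide +kernel⟩
  · exact ⟨.q (.q (.q (.o 8) (.o 8) (.q (.o 9) (.o 9) (.o 13) (.o 11)) (.o 13)) (.q (.o 7) (.o 7)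
    (.o 11) (.o 9)) (.q (.k 42 4 33 [0, 3, 4]) (.q (.o 15) (.o 13) (.q (.o 15) (.o 13) .s .s) .s)
    .s .s) (.q (.q (.o 11) (.o 11) .s .s) (.q (.o 11) (.o 9) .s .s) .s .s)) (.q (.o 13) (.q (.o 7)
    (.o 7) (.o 9) (.o 9)) (.q (.o 13) (.o 13) .s .s) (.q (.q (.o 9) (.o 9) .s .s) (.q (.o 9) (.o
    9) .s .s) .s .s)) .s .s, by decide +kernel⟩

theorem columnChecked_1 : ColumnChecked 1 := by
  intro j hj
  interval_cases j
  · exact ⟨.s, by decide +kernel⟩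
  · exact ⟨.s, by decide +kernel⟩
  · exact ⟨.s, by decide +kernel⟩
  · exact ⟨.s, by decide +kernel⟩
  · exact ⟨.s, by decide +kernel⟩
  · exact ⟨.s, by decide +kernel⟩
  · exact ⟨.s, by decide +kernel⟩
  · exact ⟨.o 1, by decide +kernel⟩
  · exact ⟨.o 1, by decide +kernel⟩
  · exact ⟨.o 3, by decide +kernel⟩
  · exact ⟨.q (.o 3) (.o 5) (.o 9) (.q (.o 5) (.o 5) (.o 9) (.q (.o 7) (.o 7) (.o 9) (.o 10))),
    by decide +kernel⟩
  · exact ⟨.q (.q (.o 12) (.o 18) (.q (.o 16) (.o 10) .s .s) .s) (.q (.q (.o 9) (.o 13) (.o 9) (.q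
    (.o 9) (.o 13) (.o 11) .s)) (.q (.q (.o 9) (.o 10) (.o 14) (.q (.o 10) (.o 12) (.o 12) (.o
    14))) (.q (.o 12) (.o 11) (.q (.o 12) (.o 12) (.o 14) (.o 14)) (.q (.o 12) (.o 12) (.o 19) (.o
    17))) (.q (.q (.o 12) (.o 14) (.o 15) (.q (.o 14) (.o 16) (.o 16) .s)) (.k 42 4 26 [6, 25, 5,
    8]) .s .s) (.k 43 5 28 [24, 7, 8, 5])) .s .s) .s .s, by decide +kernel⟩

theorem columnChecked_2 : ColumnChecked 2 := by
  intro j hj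
  interval_cases j
  · exact ⟨.s, by decide +kernel⟩
  · exact ⟨.s, by decide +kernel⟩
  · exact ⟨.s, by decide +kernel⟩
  · exact ⟨.s, by decide +kernel⟩
  · exact ⟨.s, by decide +kernel⟩
  · exact ⟨.s, by decide +kernel⟩
  · exact ⟨.s, by decide +kernel⟩
  · exact ⟨.o 1, by decide +kernel⟩
  · exact ⟨.o 1, by decide +kernel⟩
  · exact ⟨.o 5, by decide +kernel⟩
  · exact ⟨.q (.o 5) (.o 6) (.q (.o 6) (.o 6) (.q (.o 8) (.o 8) (.o 10) (.o 10)) (.q (.o 8) (.o 8)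
    (.o 8) (.o 10))) (.q (.o 6) (.o 6) (.q (.o 6) (.o 6) (.o 10) (.o 9)) (.o 9)),
    by decide +kernel⟩
  · exact ⟨.q (.q (.q (.q (.o 10) (.o 12) (.o 17) (.q (.o 12) (.o 12) (.o 14) (.o 19))) (.q (.o
    11) (.o 10) (.q (.o 12) (.o 12) (.o 17) (.o 15)) (.o 17)) (.q (.q (.q (.o 15) (.o 13) .s .s)
    (.o 17) .s .s) .s .s .s) .s) (.q (.o 17) (.q (.o 10) (.o 10) .s .s) .s .s) .s .s) (.q (.q (.q
    (.o 10) (.o 10) .s .s) (.q (.o 9) .s .s .s) .s .s) .s .s .s) .s .s, by decide +kernel⟩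

theorem columnChecked_3 : ColumnChecked 3 := by
  intro j hj
  interval_cases j
  · exact ⟨.s, by decide +kernel⟩
  · exact ⟨.s, by decide +kernel⟩
  · exact ⟨.s, by decide +kernel⟩
  · exact ⟨.s, by decide +kernel⟩
  · exact ⟨.s, by decide +kernel⟩
  · exact ⟨.s, by decide +kernel⟩
  · exact ⟨.o 1, by decide +kernel⟩
  · exact ⟨.o 1, by decide +kernel⟩
  · exact ⟨.o 4, by decide +kernel⟩
  · exact ⟨.q (.o 3) (.o 6) (.o 8) (.q (.o 6) (.o 11) (.o 8) (.q (.o 8) (.o 14) (.o 10) (.k 38 4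
    36 [6, 3, 4]))), by decide +kernel⟩
  · exact ⟨.q (.q (.o 5) (.o 8) (.o 5) (.o 10)) (.q (.q (.o 7) (.o 8) (.o 8) (.q (.o 8) (.o 9) (.o
    8) (.o 10))) (.q (.q (.o 8) (.o 9) (.o 9) (.o 11)) (.k 39 4 40 [6, 3, 4]) (.k 39 4 40 [6, 3,
    16, 7]) (.k 40 4 36 [6, 3, 4, 7])) (.q (.o 10) (.q (.o 10) (.o 12) (.o 10) (.o 12)) (.o 10)
    (.q (.o 10) (.o 15) (.o 10) (.q (.o 10) (.o 12) (.o 10) (.o 13)))) (.q (.k 40 4 33 [24, 3, 8,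
    7, 16]) (.k 41 4 40 [6, 3, 4, 7]) (.k 41 5 28 [17, 16, 24, 7, 12, 2]) (.k 42 5 36 [17, 4, 0,
    7]))) (.q (.o 7) (.o 12) (.o 10) (.q (.o 8) (.o 8) .s .s)) (.q (.q (.o 12) (.q (.o 12) (.q (.o
    10) (.o 12) (.o 10) (.o 12)) (.o 12) (.o 14)) (.o 10) (.q (.o 10) (.o 12) (.o 9) (.o 11))) (.q
    (.k 42 6 24 [24, 17, 16, 21, 22]) (.k 43 6 36 [6, 3, 4, 7]) (.q (.q (.o 12) (.o 15) (.o 12)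
    (.o 12)) (.q (.q (.o 14) (.o 17) (.o 14) (.o 14)) (.k 42 4 40 [6, 3, 16]) .s .s) .s .s) (.q
    (.q (.q (.k 42 4 40 [1, 4, 3]) .s .s .s) .s .s .s) .s .s .s)) (.q (.o 8) .s .s .s) .s),
    by decide +kernel⟩
  · exact ⟨.s, by decide +kernel⟩

theorem columnChecked_4 : ColumnChecked 4 := by
  intro j hj
  interval_cases j
  · exact ⟨.s, by decide +kernel⟩
  · exact ⟨.s, by decide +kernel⟩
  · exact ⟨.s, by decide +kernel⟩
  · exact ⟨.s, by decide +kernel⟩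
  · exact ⟨.s, by decide +kernel⟩
  · exact ⟨.s, by decide +kernel⟩
  · exact ⟨.o 1, by decide +kernel⟩
  · exact ⟨.o 2, by decide +kernel⟩
  · exact ⟨.q (.o 3) (.o 4) (.o 6) (.q (.o 4) (.o 4) (.o 6) (.o 7)), by decide +kernel⟩
  · exact ⟨.q (.q (.o 6) (.o 9) (.o 8) (.q (.o 6) (.o 9) (.o 9) (.k 37 2 33 [1, 8, 0, 7]))) (.q
    (.q (.o 6) (.o 7) (.o 9) (.o 10)) (.q (.o 7) (.o 9) (.o 10) (.q (.o 9) (.o 10) (.o 12) (.k 36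
    2 30 [1, 14, 12, 21]))) (.q (.q (.o 9) (.o 10) (.o 12) (.k 36 2 26 [1, 8, 6])) (.k 37 4 33 [1,
    8, 0, 21]) (.k 37 5 20 [20, 3, 12]) (.k 37 8 30 [1, 14])) (.q (.k 37 6 30 [1, 2, 21]) (.k 37 5
    30 [1, 8, 21, 0]) (.k 38 8 24 [1, 2]) (.k 38 10 22 [1, 2]))) (.q (.q (.o 6) (.o 8) (.o 9) (.o
    12)) (.q (.o 12) (.k 37 2 33 [1, 8, 7, 0]) (.k 38 2 40 [1, 16, 0, 3]) (.k 38 2 33 [1, 4, 11,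
    8, 0])) (.k 39 6 36 [6, 17, 8, 7]) (.k 40 8 40 [14, 17, 16, 0])) (.q (.q (.k 38 5 36 [1, 8,
    0]) (.k 38 7 28 [1, 8, 0]) (.k 39 5 40 [1, 8, 0]) (.k 39 10 26 [1, 8, 0])) (.q (.k 39 9 20 [1,
    2]) (.k 39 11 22 [1, 2]) (.k 39 12 20 [1, 2]) (.k 40 11 20 [1, 2])) (.q (.k 39 4 30 [1, 16, 0,
    3]) (.k 40 6 40 [1, 8, 0]) (.k 40 4 36 [1, 16, 0, 7]) (.k 41 6 22 [1, 8, 3, 6])) (.q (.k 40 8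
    33 [1, 8, 0]) (.k 41 9 26 [1, 2]) (.k 41 8 36 [1, 8, 0]) (.k 42 10 36 [1, 14]))),
    by decide +kernel⟩
  · exact ⟨.q (.q (.k 41 7 36 [6, 17, 8, 7, 10]) (.k 42 9 28 [1, 16, 7, 10, 8, 2]) (.k 43 9 33 [6,
    17, 16, 7, 0]) (.q (.k 42 4 36 [1, 16, 15, 0]) (.k 43 6 26 [1, 8, 6, 7]) (.k 43 5 33 [6, 17,
    8, 7]) (.k 44 6 26 [1, 8, 6, 7]))) (.q (.q (.k 41 5 36 [1, 16, 0, 3]) (.k 42 5 30 [1, 16, 0,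
    3]) (.k 42 5 30 [1, 8, 0, 3, 2]) (.k 43 6 36 [17, 8, 0])) (.q (.k 42 6 30 [1, 16, 0, 3]) (.k
    43 8 33 [6, 17, 8]) (.k 43 6 30 [1, 16, 0, 7]) (.k 44 6 26 [1, 8, 10, 11, 2])) (.q (.k 43 6 26
    [1, 8, 7, 6]) (.k 44 6 28 [1, 8, 7, 0]) (.q (.q (.k 43 3 28 [1, 8, 0, 7]) .s .s .s) .s .s .s)
    .s) (.q (.q (.k 43 4 33 [1, 16, 0, 3]) .s .s .s) .s .s .s)) (.q (.q (.k 43 5 40 [17, 4, 0, 7])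
    (.k 43 5 33 [17, 6, 8, 7]) .s .s) .s .s .s) .s, by decide +kernel⟩
  · exact ⟨.s, by decide +kernel⟩

theorem columnChecked_5 : ColumnChecked 5 := by
  intro j hj
  interval_cases j
  · exact ⟨.s, by decide +kernel⟩
  · exact ⟨.s, by decide +kernel⟩
  · exact ⟨.s, by decide +kernel⟩
  · exact ⟨.s, by decide +kernel⟩
  · exact ⟨.s, by decide +kernel⟩
  · exact ⟨.o 1, by decide +kernel⟩
  · exact ⟨.o 2, by decide +kernel⟩
  · exact ⟨.q (.o 2) (.o 4) (.o 4) (.q (.o 4) (.o 5) (.o 5) (.o 8)), by decide +kernel⟩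
  · exact ⟨.q (.o 10) (.q (.o 10) (.k 34 2 33 [23, 4, 11, 0]) (.q (.o 7) (.o 10) (.o 7) (.o 10))
    (.k 35 4 30 [1, 4, 0, 11, 8])) (.q (.o 5) (.o 10) (.o 9) (.o 12)) (.q (.q (.o 10) (.k 35 3 24
    [5, 4, 11]) (.o 16) (.k 36 5 22 [5, 4, 21, 1])) (.q (.k 35 3 28 [5, 4, 11]) (.k 36 3 26 [23,
    4, 11]) (.k 36 4 24 [23, 4, 21, 3]) (.k 36 3 28 [23, 4, 11, 3])) (.q (.q (.o 7) (.o 9) (.o 7)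
    (.o 9)) (.q (.q (.o 10) (.o 13) (.o 9) (.o 12)) (.k 36 3 22 [5, 4, 21, 3]) (.o 12) (.k 36 5 20
    [5, 2, 21, 3])) (.o 10) (.q (.o 10) (.q (.o 10) (.o 12) (.o 9) (.o 12)) (.o 9) (.q (.o 9) (.o
    12) (.o 9) (.o 12)))) (.q (.q (.k 36 3 20 [5, 4, 21, 1]) (.k 36 3 22 [5, 4, 7, 21]) (.k 36 5
    26 [5, 2, 25]) (.k 37 4 20 [18, 21, 0, 15])) (.k 37 8 20 [23, 4, 7, 21]) (.q (.k 37 6 20 [5,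
    2, 21, 15]) (.k 37 5 20 [5, 4, 21, 7]) (.k 37 6 14 [5, 18, 21]) (.k 37 7 18 [5, 4, 21, 7]))
    (.q (.k 37 5 24 [2, 11, 0, 7]) (.k 37 5 26 [2, 25, 0]) (.k 38 6 18 [5, 4, 21, 7]) (.k 38 5 18
    [5, 4, 21, 7, 0])))), by decide +kernel⟩
  · exact ⟨.q (.q (.q (.o 13) (.o 11) (.k 37 10 16 [1, 14]) (.q (.o 14) (.o 11) (.k 37 4 26 [1, 4,
    21, 0]) (.k 37 6 22 [1, 14, 21]))) (.q (.o 8) (.o 8) (.q (.o 9) (.o 8) (.o 14) (.o 13)) (.q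
    (.o 8) (.o 8) (.o 12) (.o 11))) (.q (.k 38 9 18 [1, 14]) (.k 38 11 18 [1, 14]) (.k 38 7 28 [1,
    2, 6, 21]) (.k 39 11 18 [1, 14])) (.q (.k 38 20 16 [13, 2]) (.q (.q (.o 14) (.o 12) (.q (.o
    14) (.o 14) (.q (.o 14) (.o 14) (.o 14) (.o 14)) (.o 17)) (.q (.o 12) (.o 11) (.o 14) (.o
    13))) (.q (.o 11) (.o 11) (.q (.o 11) (.o 11) (.o 14) (.o 14)) (.q (.o 11) (.o 11) (.o 14) (.o
    14))) (.k 39 11 12 [13, 2]) (.q (.k 38 9 18 [14, 1, 21]) (.k 38 10 16 [13, 2, 21, 1]) (.k 39 8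
    18 [13, 2, 1, 21]) (.k 39 9 16 [14, 1, 21, 2]))) (.k 39 12 20 [14, 1]) (.k 40 13 16 [13, 2])))
    (.q (.q (.o 9) (.q (.o 9) (.o 12) (.o 9) (.o 11)) (.q (.o 8) (.o 8) (.o 11) (.o 9)) (.o 12))
    (.q (.q (.q (.o 12) (.o 15) (.o 11) (.o 12)) (.k 38 6 14 [5, 18, 21]) (.o 15) (.q (.o 12) (.o
    14) (.o 11) (.o 11))) (.q (.k 38 9 14 [5, 4, 11]) (.k 38 10 18 [5, 4, 7, 21]) (.q (.o 14) (.o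
    14) (.o 11) (.o 11)) (.q (.o 13) (.o 14) (.o 11) (.o 11))) (.q (.o 11) (.o 12) (.o 10) (.o
    10)) (.q (.o 14) (.q (.o 11) (.o 11) (.o 11) (.o 13)) (.o 13) (.q (.o 13) (.o 16) (.o 13) (.q
    (.o 13) (.o 13) (.o 13) (.o 15))))) (.q (.q (.q (.o 11) (.o 11) (.o 17) (.o 12)) (.o 15) (.q
    (.k 39 10 16 [13, 2, 21]) (.q (.o 12) (.o 12) (.o 15) (.o 12)) (.k 39 9 16 [13, 2, 21]) (.q
    (.o 15) (.o 13) (.q (.o 15) (.o 13) (.o 15) (.o 15)) (.o 15))) (.q (.o 12) (.o 12) (.o 15) (.o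
    12))) (.q (.o 11) (.o 10) (.o 12) (.o 10)) (.q (.k 39 17 12 [13, 2]) (.q (.q (.o 12) (.o 12)
    (.o 15) (.o 12)) (.o 15) (.q (.o 18) (.o 15) (.q (.o 15) (.o 15) (.o 18) (.o 15)) (.o 15)) (.o
    18)) (.k 40 11 12 [13, 2]) (.k 40 14 12 [13, 2])) (.q (.q (.o 12) (.o 10) (.o 12) (.o 10)) (.o
    12) (.q (.o 13) (.o 11) (.o 13) (.o 11)) (.o 15))) (.q (.q (.o 10) (.o 13) (.o 13) (.q (.o 11)
    (.o 13) (.o 13) (.o 16))) (.q (.q (.o 10) (.o 13) (.o 11) (.o 13)) (.k 40 8 16 [5, 4, 11]) (.k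
    40 7 16 [2, 21, 5, 4]) (.k 40 8 14 [5, 18, 21])) (.q (.q (.o 10) (.o 13) (.o 12) (.o 14)) (.q
    (.o 14) (.q (.o 13) (.o 13) (.o 13) (.o 15)) (.q (.o 13) (.o 13) (.o 13) (.o 16)) (.k 40 8 16
    [5, 2, 21])) (.q (.o 13) (.q (.o 12) (.o 13) (.o 12) (.o 13)) (.o 13) (.q (.o 12) (.o 15) (.o
    13) (.o 15))) (.k 41 15 14 [5, 2, 21])) (.q (.k 41 9 14 [5, 18, 21]) (.k 41 8 14 [5, 18, 21])
    (.q (.k 41 8 16 [5, 2, 21]) (.k 41 6 16 [5, 18, 21]) (.k 41 9 22 [21, 2]) (.k 41 8 14 [5, 2,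
    21])) (.k 41 10 14 [2, 21, 5])))) (.q (.q (.k 39 10 20 [1, 14]) (.k 40 12 20 [1, 14]) (.k 40
    10 22 [1, 14]) (.k 41 11 18 [1, 14])) (.q (.k 40 9 30 [14, 1]) (.k 41 12 22 [1, 14]) (.k 41 11
    33 [1, 2]) (.k 42 11 30 [1, 14])) (.q (.k 41 12 22 [1, 2]) (.k 42 11 22 [1, 14]) (.k 42 9 28
    [1, 2, 0]) (.k 43 11 24 [1, 14])) (.q (.k 42 17 20 [1, 14]) (.k 43 11 33 [1, 2]) (.k 43 16 18
    [1, 14]) (.q (.k 43 9 18 [1, 14]) (.k 43 8 18 [1, 14]) (.k 43 9 16 [1, 14]) .s))) (.q (.q (.k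
    41 13 20 [13, 2]) (.q (.q (.o 15) (.o 14) (.q (.o 14) (.o 14) (.o 17) (.o 15)) (.o 18)) (.q
    (.o 12) (.o 12) (.o 15) (.o 12)) (.k 41 11 12 [13, 2]) (.q (.o 18) (.o 13) (.q (.o 15) (.o 13)
    (.o 15) (.o 15)) (.o 15))) (.k 42 13 24 [13, 2]) (.k 42 12 33 [14, 17])) (.q (.q (.q (.o 14)
    (.q (.o 12) (.o 15) (.o 12) (.o 15)) (.o 12) (.q (.o 12) (.o 15) (.o 12) (.o 14))) (.k 41 11
    14 [13, 2, 21]) (.q (.o 13) (.q (.o 12) (.o 13) (.o 12) (.o 15)) (.o 15) (.q (.o 13) (.o 15)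
    (.o 13) (.o 15))) (.k 42 17 14 [5, 2, 21])) (.q (.k 42 15 12 [5, 2, 21]) (.q (.k 41 8 14 [5,
    2, 21]) (.k 41 8 14 [5, 2, 21]) (.k 42 9 16 [13, 2, 21]) (.k 42 8 14 [5, 2, 21])) (.k 42 11 14
    [13, 2, 21]) (.k 42 12 12 [5, 2, 21])) (.q (.k 42 11 14 [13, 2]) (.k 42 13 14 [13, 2, 21]) (.k
    43 9 16 [13, 2]) (.q (.q (.o 15) (.o 20) (.o 14) .s) (.q (.q (.o 17) .s .s .s) .s .s .s) .s
    .s)) (.q (.k 43 14 14 [13, 2, 21]) (.q (.q (.k 42 8 12 [5, 2, 21]) .s .s .s) .s .s .s) .s .s))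
    (.q (.k 43 11 33 [1, 14]) (.k 43 13 36 [1, 2]) (.q (.q (.k 43 7 18 [14, 1]) .s .s .s) .s .s
    .s) .s) .s), by decide +kernel⟩
  · exact ⟨.q (.q (.q (.k 43 9 30 [1, 2, 0]) (.k 43 9 24 [1, 8, 6, 7]) (.q (.k 43 6 33 [1, 8, 0])
    .s .s .s) .s) (.q (.q (.k 43 10 16 [1, 14]) .s .s .s) .s .s .s) .s .s) .s .s .s,
    by decide +kernel⟩
  · exact ⟨.s, by decide +kernel⟩

theorem columnChecked_6 : ColumnChecked 6 := by
  intro j hj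
  interval_cases j
  · exact ⟨.s, by decide +kernel⟩
  · exact ⟨.s, by decide +kernel⟩
  · exact ⟨.s, by decide +kernel⟩
  · exact ⟨.o 1, by decide +kernel⟩
  · exact ⟨.o 2, by decide +kernel⟩
  · exact ⟨.o 2, by decide +kernel⟩
  · exact ⟨.q (.o 2) (.o 2) (.o 2) (.o 6), by decide +kernel⟩
  · exact ⟨.q (.o 8) (.q (.o 6) (.o 6) (.q (.o 5) (.o 6) (.o 6) (.o 9)) (.q (.o 6) (.o 7) (.o 11)
    (.o 11))) (.q (.o 5) (.q (.o 5) (.o 6) (.o 5) (.o 8)) (.q (.o 5) (.o 6) (.o 8) (.o 9)) (.q (.o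
    7) (.o 9) (.o 7) (.q (.o 7) (.o 8) (.o 7) (.o 10)))) (.q (.q (.o 10) (.k 35 2 33 [3, 2, 8,
    21]) (.k 34 3 33 [3, 2, 4, 21]) (.k 35 3 33 [0, 8, 3, 21])) (.q (.k 35 1 36 [3, 2, 8, 0, 21])
    (.k 36 1 36 [3, 2, 8, 0, 11]) (.k 36 4 33 [3, 2, 21, 4]) (.k 36 4 33 [0, 8, 3, 21])) (.q (.k
    35 3 30 [9, 4, 3, 0, 21]) (.k 35 5 40 [19, 4, 15]) (.k 35 6 30 [19, 4, 15, 21]) (.k 36 5 28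
    [6, 3, 4, 21])) (.q (.k 36 7 30 [3, 2, 21]) (.k 37 5 33 [9, 18, 3, 11]) (.k 36 5 28 [9, 8, 3,
    0, 21]) (.k 37 15 36 [1, 2]))), by decide +kernel⟩
  · exact ⟨.q (.q (.k 35 3 36 [5, 16, 7, 0]) (.q (.k 35 2 36 [19, 4, 3]) (.o 15) (.k 35 2 26 [20,
    15, 16]) (.k 36 2 40 [19, 4, 3])) (.k 36 4 40 [9, 4, 15]) (.k 37 5 33 [23, 16, 7, 0])) (.q (.q
    (.k 36 5 20 [6, 15, 8]) (.k 36 9 16 [6, 15, 8]) (.k 36 3 40 [19, 8, 3]) (.k 37 5 40 [19, 4,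
    3])) (.q (.q (.k 36 4 26 [3, 2, 8, 21]) (.k 37 3 28 [9, 8, 3, 0, 21]) (.k 37 5 16 [6, 15, 8])
    (.k 37 4 26 [9, 8, 15, 0, 21])) (.k 38 9 26 [9, 2, 3, 4, 21]) (.q (.k 37 4 33 [19, 4, 3]) (.k
    37 5 18 [6, 15, 8]) (.k 37 3 40 [19, 18, 3]) (.k 37 4 33 [19, 4, 3])) (.q (.k 37 5 26 [2, 15,
    4, 21]) (.k 38 6 24 [9, 2, 3, 4, 21]) (.k 38 5 18 [6, 15, 8]) (.k 38 6 33 [19, 4, 3]))) (.q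
    (.k 37 2 28 [20, 7, 8, 1]) (.k 38 4 24 [9, 8, 2, 7]) (.k 38 2 33 [9, 8, 7, 2]) (.k 38 3 30
    [23, 8, 7, 2])) (.q (.k 38 8 16 [10, 15, 8]) (.q (.k 38 4 36 [19, 4, 3]) (.k 38 6 33 [19, 4,
    3]) (.k 38 4 33 [19, 4, 3]) (.k 39 5 18 [6, 15, 8])) (.k 39 4 26 [9, 8, 7, 2]) (.k 39 9 33 [5,
    18, 3]))) (.q (.q (.k 36 2 36 [23, 4, 7, 3]) (.k 36 2 40 [23, 4, 15]) (.k 37 3 36 [5, 4, 7,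
    15]) (.k 37 3 33 [23, 4, 7])) (.q (.k 37 2 40 [9, 4, 15]) (.k 38 2 33 [5, 16, 0, 7]) (.k 38 3
    30 [5, 16, 7, 0]) (.k 38 3 28 [9, 16, 7, 0])) (.q (.k 37 6 24 [23, 4, 11, 15]) (.k 38 4 22 [1,
    4, 21, 0, 15, 8, 18]) (.q (.k 37 5 28 [2, 7, 0]) (.k 38 3 20 [1, 4, 0, 21, 8, 15]) (.k 38 6 20
    [5, 4, 11]) (.k 38 6 18 [23, 4, 21])) (.k 39 12 18 [0, 7, 4, 21])) (.q (.k 38 4 24 [25, 2, 8,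
    0, 3]) (.k 39 4 26 [25, 2, 8, 0]) (.q (.k 38 4 30 [23, 4, 7]) (.k 39 3 28 [5, 4, 7, 0]) (.k 39
    4 22 [11, 2, 8, 0, 15]) (.k 39 4 20 [11, 2, 8, 0, 7])) (.k 40 7 20 [5, 4, 11, 0, 2, 8, 15])))
    (.q (.k 40 9 28 [2, 7, 8, 9, 4]) (.q (.k 39 4 28 [20, 8, 15]) (.k 40 6 18 [13, 8, 10, 7]) (.k
    40 4 28 [2, 15, 16, 0]) (.k 41 4 33 [23, 16, 7, 2])) (.q (.k 40 4 26 [7, 2, 8, 0]) (.k 40 4 33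
    [2, 15, 8, 0]) (.k 40 7 26 [23, 4, 7, 0]) (.k 41 7 26 [2, 7, 8, 0])) (.q (.k 41 4 36 [2, 15,
    8, 0]) (.k 42 4 33 [2, 15, 16, 0]) (.k 42 5 26 [23, 16, 7, 14]) (.k 42 5 30 [23, 16, 7, 2]))),
    by decide +kernel⟩
  · exact ⟨.q (.q (.q (.q (.k 38 6 18 [5, 4, 21, 7]) (.q (.q (.o 14) (.o 14) (.o 14) (.o 13)) (.o
    15) (.o 14) (.o 13)) (.q (.o 14) (.o 14) (.o 11) (.o 11)) (.q (.o 11) (.o 11) (.o 11) (.o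
    12))) (.q (.q (.o 13) (.o 12) (.o 12) (.o 12)) (.q (.o 13) (.q (.o 13) (.o 13) (.o 12) (.o
    13)) (.o 12) (.o 15)) (.q (.o 11) (.o 12) (.o 13) (.o 14)) (.k 39 7 16 [5, 4, 11, 0, 21])) (.q
    (.q (.o 11) (.o 14) (.o 17) (.q (.o 13) (.o 14) (.o 14) (.o 14))) (.q (.o 14) (.o 18) (.q (.o
    14) (.o 14) (.o 16) (.q (.o 14) (.o 14) (.o 14) (.o 15))) (.k 39 9 14 [5, 4, 11])) (.k 40 9 16
    [5, 4, 11]) (.q (.k 39 7 12 [11, 18, 0]) (.k 40 9 14 [5, 4, 11]) (.k 40 6 16 [5, 4, 11]) (.k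
    40 7 12 [11, 18, 9]))) (.q (.q (.o 15) (.q (.o 13) (.o 14) (.o 14) (.o 14)) (.q (.o 15) (.o
    15) (.q (.o 15) (.o 15) (.o 15) (.o 15)) (.o 18)) (.k 40 6 16 [5, 4, 21, 0, 7])) (.k 40 13 16
    [23, 4, 21, 7]) (.q (.k 40 8 16 [5, 4, 21, 7, 0]) (.k 40 8 16 [2, 21, 0, 4, 7]) (.k 40 9 16
    [5, 4, 11]) (.k 40 9 16 [5, 4, 7, 21])) (.q (.k 40 9 18 [5, 4, 21, 7]) (.k 40 7 16 [21, 2, 4,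
    0, 7]) (.k 40 8 16 [2, 7, 0, 4, 21]) (.k 40 10 16 [21, 2, 4, 0, 7])))) (.q (.q (.k 39 6 18
    [23, 4, 11, 0, 15, 21]) (.k 39 6 18 [23, 4, 7, 0, 21]) (.k 40 8 20 [2, 11, 4, 0]) (.k 40 8 36
    [2, 11, 0])) (.q (.k 40 6 20 [23, 4, 11, 0]) (.k 40 6 28 [23, 4, 7]) (.k 40 8 20 [2, 11, 4,
    0]) (.k 40 7 20 [11, 2, 4, 0])) (.q (.k 40 9 16 [0, 21, 4, 7]) (.k 40 8 16 [2, 7, 4, 0, 21])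
    (.q (.k 40 6 16 [5, 4, 21, 0, 7]) (.k 40 6 16 [5, 4, 7, 0, 21]) (.k 40 9 16 [5, 4, 21, 0, 7])
    (.k 40 8 16 [2, 21, 0, 4, 7])) (.q (.k 40 7 26 [5, 4, 11]) (.k 40 7 26 [5, 4, 7]) (.k 40 7 16
    [7, 2, 4, 0, 21]) (.k 41 7 18 [11, 2, 4, 0]))) (.q (.k 40 10 30 [5, 4, 7]) (.k 41 9 18 [9, 4,
    11, 0]) (.k 41 10 18 [11, 2, 4, 0]) (.k 41 10 30 [5, 4, 11]))) (.q (.q (.k 40 8 16 [5, 18,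
    11]) (.k 40 10 16 [5, 4, 11]) (.k 41 8 16 [5, 18, 11]) (.k 41 9 18 [5, 4, 11])) (.q (.q (.k 40
    9 16 [5, 4, 11]) (.k 40 9 16 [5, 4, 11]) (.k 40 7 12 [18, 21, 9]) (.k 40 9 16 [5, 4, 11])) (.q
    (.k 40 11 16 [2, 7, 0, 4, 21]) (.k 40 9 16 [5, 4, 7, 0, 21]) (.k 41 10 16 [5, 4, 11]) (.k 41
    12 16 [5, 4, 7, 21])) (.k 41 13 14 [0, 11, 18]) (.q (.k 41 9 16 [5, 4, 11]) (.k 41 11 22 [2,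
    7, 0]) (.k 41 9 16 [5, 4, 11]) (.k 41 9 16 [5, 4, 11]))) (.q (.k 41 8 16 [5, 18, 21]) (.k 41 8
    18 [5, 4, 11]) (.k 42 8 18 [5, 18, 11]) (.k 42 8 18 [5, 18, 11])) (.k 42 16 16 [18, 21, 9,
    25])) (.q (.q (.q (.k 41 12 16 [5, 4, 21, 0, 7]) (.k 41 12 16 [5, 4, 21, 0, 7]) (.k 41 12 16
    [5, 4, 21, 0, 7]) (.k 41 13 14 [5, 4, 21, 0])) (.q (.k 41 9 16 [9, 4, 21, 7]) (.k 41 9 18 [9,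
    4, 11]) (.q (.k 41 9 14 [5, 2, 21, 4]) (.k 41 9 20 [5, 4, 11]) (.k 41 10 20 [5, 4, 11]) (.k 41
    9 14 [5, 2, 21, 4])) (.k 41 13 16 [5, 4, 21, 0, 11])) (.q (.q (.k 41 9 16 [5, 4, 7]) (.k 41 9
    16 [5, 4, 7, 0, 21]) (.k 41 9 16 [5, 4, 7]) (.k 41 10 18 [5, 4, 7])) (.q (.k 41 9 18 [5, 4,
    21]) (.k 41 9 14 [23, 4, 21]) (.k 41 10 18 [5, 4, 11]) (.k 41 9 14 [23, 4, 21])) (.k 41 13 16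
    [5, 4, 7]) (.q (.k 41 10 18 [5, 4, 7]) (.k 41 10 14 [21, 2, 4, 0]) (.k 41 9 14 [23, 4, 11])
    (.k 41 10 24 [1, 2, 7]))) (.q (.k 41 13 14 [5, 4, 21, 0]) (.q (.k 41 9 14 [5, 2, 21, 4]) (.k
    41 9 14 [5, 2, 21, 4]) (.k 41 10 22 [5, 4, 11]) (.k 41 10 14 [21, 2, 4, 0])) (.q (.k 41 9 14
    [23, 4, 21]) (.k 41 9 14 [5, 2, 21, 4]) (.k 41 11 14 [2, 21, 0, 4]) (.k 41 10 14 [21, 2, 4,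
    0])) (.k 42 16 14 [23, 4, 21, 0]))) (.q (.q (.k 41 7 16 [1, 4, 0, 7, 21]) (.k 41 7 18 [11, 2,
    4, 0]) (.k 41 9 16 [9, 4, 21, 11]) (.k 41 9 18 [9, 4, 11])) (.k 42 16 16 [5, 4, 11, 0, 21])
    (.q (.k 41 16 14 [5, 4, 21, 0, 11]) (.q (.k 41 7 16 [11, 2, 4, 0, 21]) (.q (.k 41 6 18 [9, 4,
    11]) .s .s .s) .s .s) (.q (.q (.k 41 9 14 [5, 2, 21, 4]) .s .s .s) .s .s .s) .s) .s) (.q (.k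
    42 15 14 [0, 4, 11]) (.q (.q (.k 42 11 22 [2, 7, 0]) (.q (.k 41 9 14 [23, 4, 21]) .s .s .s) .s
    .s) .s .s .s) .s .s) .s)) (.q (.q (.q (.k 40 5 20 [2, 25, 4, 0, 11]) (.k 41 4 24 [25, 2, 8,
    0]) (.k 41 6 20 [23, 4, 11, 0, 25]) (.k 41 6 22 [5, 2, 25, 4])) (.q (.k 41 4 26 [7, 2, 8, 0])
    (.k 41 4 24 [7, 2, 12, 0]) (.k 41 6 22 [5, 2, 25, 8]) (.k 42 6 33 [9, 4, 7])) (.q (.k 41 9 18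
    [23, 4, 11, 0, 25]) (.k 41 8 18 [2, 25, 4, 0, 21]) (.k 41 10 26 [23, 4, 7]) (.q (.k 41 7 18
    [11, 2, 4, 0]) (.q (.k 41 6 18 [11, 2, 4, 0]) .s .s .s) .s .s)) (.q (.k 42 7 20 [25, 2, 8, 0])
    (.q (.q (.q (.q (.k 41 3 26 [7, 2, 8, 0]) .s .s .s) .s .s .s) .s .s .s) .s .s .s) .s .s)) (.q
    (.k 42 8 24 [2, 7, 8, 0]) .s .s .s) (.q (.q (.q (.q (.k 41 7 30 [5, 4, 7]) .s .s .s) .s .s .s)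
    .s .s .s) .s .s .s) .s) (.q (.q (.q (.k 42 13 14 [2, 21, 5]) (.k 42 9 16 [5, 18, 21]) (.q (.k
    42 8 14 [5, 18, 21]) (.q (.k 42 6 14 [5, 18, 21, 0]) .s .s .s) .s .s) .s) (.q (.q (.k 42 7 22
    [2, 11, 0]) .s .s .s) .s .s .s) .s .s) .s .s .s) .s, by decide +kernel⟩
  · exact ⟨.s, by decide +kernel⟩
  · exact ⟨.s, by decide +kernel⟩

theorem columnChecked_7 : ColumnChecked 7 := by
  intro j hj
  interval_cases j
  · exact ⟨.q .s (.k 33 0 30 [0]) .s (.o 3), by decide +kernel⟩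
  · exact ⟨.o 3, by decide +kernel⟩
  · exact ⟨.o 2, by decide +kernel⟩
  · exact ⟨.o 2, by decide +kernel⟩
  · exact ⟨.o 2, by decide +kernel⟩
  · exact ⟨.o 3, by decide +kernel⟩
  · exact ⟨.q (.o 3) (.o 4) (.q (.o 3) (.o 3) (.o 6) (.o 7)) (.q (.o 4) (.o 4) (.o 8) (.o 12)),
    by decide +kernel⟩
  · exact ⟨.q (.q (.q (.o 6) (.o 6) (.o 6) (.o 10)) (.q (.o 7) (.o 7) (.k 36 2 36 [15, 18, 0]) (.k
    37 5 36 [3, 18])) (.k 37 3 40 [0, 4, 17, 11]) (.k 38 5 33 [0, 4, 1, 11])) (.q (.q (.o 7) (.o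
    11) (.k 37 4 24 [0, 4, 7]) (.k 38 5 33 [13, 18, 3])) (.q (.o 13) (.o 11) (.k 39 8 28 [13, 18,
    7]) (.q (.o 12) (.o 9) (.k 39 4 28 [0, 7, 4]) (.o 13))) (.k 39 9 28 [18, 1, 11, 0]) (.q (.k 39
    4 28 [0, 4, 7]) (.k 40 6 36 [3, 18]) (.k 40 4 33 [0, 4, 15]) (.k 41 4 33 [0, 4, 15]))) (.q (.q
    (.k 36 1 40 [0, 3, 4, 2, 11]) (.k 37 2 33 [3, 6, 4, 11]) (.k 37 4 36 [3, 2, 4, 11]) (.k 37 4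
    30 [0, 3, 4, 21])) (.q (.k 38 1 40 [0, 4, 17, 11]) (.k 38 1 40 [0, 4, 17, 11]) (.k 38 5 36 [3,
    18, 7]) (.k 39 4 30 [0, 4, 3, 21])) (.q (.k 37 6 28 [19, 3, 4, 21]) (.k 38 6 28 [19, 3, 4,
    21]) (.q (.k 37 4 36 [7, 2, 3]) (.k 37 5 36 [7, 2, 3]) (.k 37 5 30 [7, 2]) (.k 38 5 26 [9, 3,
    4, 21])) (.k 38 13 28 [9, 2, 3, 21])) (.q (.k 39 7 26 [0, 3, 4, 21]) (.k 39 9 24 [0, 3, 4,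
    21]) (.k 39 11 26 [0, 3, 4, 21]) (.k 40 11 26 [0, 3, 4, 21]))) (.q (.q (.k 39 2 33 [17, 4, 0,
    11]) (.k 40 2 30 [17, 18, 0, 21, 8]) (.k 39 4 28 [0, 4, 17, 21]) (.k 40 4 28 [0, 4, 17, 21]))
    (.q (.k 40 3 28 [17, 18, 21, 8, 0]) (.k 41 4 26 [4, 1, 6, 11]) (.k 41 4 28 [18, 17, 0, 21])
    (.k 42 5 24 [0, 18, 17, 21])) (.q (.k 40 8 26 [0, 4, 17, 21]) (.k 41 9 26 [0, 4, 17, 21]) (.k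
    41 11 24 [0, 3, 4, 21]) (.k 41 10 22 [3, 2, 4, 21])) (.q (.k 42 9 24 [0, 17, 4, 21]) (.k 42 13
    22 [0, 4, 17, 21]) (.k 42 11 26 [3, 18, 11]) (.q (.k 42 7 22 [17, 18, 21]) (.k 43 9 28 [15,
    18]) (.k 43 9 30 [15, 18]) (.k 43 8 22 [0, 4, 17, 21])))), by decide +kernel⟩
  · exact ⟨.q (.q (.q (.k 38 15 40 [1, 2]) (.q (.k 38 6 26 [3, 2, 21, 4]) (.k 39 6 30 [3, 2, 11])
    (.k 38 5 24 [19, 4, 3, 21]) (.k 39 8 12 [6, 3, 4])) (.q (.k 38 7 36 [19, 2, 15]) (.k 38 5 24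
    [19, 8, 3, 21, 0]) (.k 38 7 24 [9, 2, 3, 4, 21]) (.k 39 8 22 [9, 2, 3, 21])) (.k 40 15 40 [1,
    2])) (.q (.q (.k 39 7 24 [3, 2, 21, 4]) (.k 39 5 26 [19, 4, 3, 21]) (.k 39 7 24 [3, 2, 21, 4])
    (.k 40 9 24 [19, 2, 3, 21])) (.q (.k 40 5 26 [3, 2, 4, 21]) (.k 40 5 24 [3, 2, 4, 21]) (.k 40
    10 24 [9, 3, 2, 21]) (.k 40 10 24 [3, 2, 21])) (.q (.k 39 8 22 [19, 4, 3, 21]) (.k 40 13 12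
    [6, 3, 4]) (.k 40 7 24 [19, 4, 3, 21]) (.k 40 9 12 [6, 3, 4])) (.q (.k 40 14 28 [1, 2]) (.q
    (.k 40 7 24 [3, 2, 21, 4]) (.k 40 7 22 [19, 2, 3, 21]) (.k 40 7 22 [19, 4, 3, 21]) (.k 41 8 22
    [19, 2, 3, 21])) (.k 41 13 12 [6, 3, 4]) (.k 41 14 28 [1, 2]))) (.q (.q (.k 39 8 33 [19, 4,
    3]) (.k 39 10 22 [9, 4, 15, 0, 21]) (.k 39 6 33 [19, 4, 3]) (.k 39 8 33 [19, 18, 3])) (.q (.k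
    39 8 22 [9, 2, 15, 21]) (.k 40 8 22 [9, 4, 3, 21]) (.q (.k 39 6 33 [19, 4, 3]) (.k 39 8 36 [1,
    2]) (.k 39 6 33 [19, 18, 3]) (.k 40 6 33 [5, 18, 3])) (.k 40 12 14 [19, 4, 3])) (.q (.k 39 5
    28 [2, 3, 4]) (.k 40 6 36 [19, 4, 3]) (.k 40 5 36 [5, 18, 3]) (.k 40 6 33 [5, 18, 3])) (.q (.k
    40 12 30 [19, 18, 3]) (.q (.k 40 7 30 [5, 18, 3]) (.k 40 9 36 [1, 2]) (.k 40 6 33 [19, 18, 3])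
    (.k 40 8 30 [5, 18, 3])) (.k 40 7 36 [19, 4, 3]) (.k 41 12 30 [5, 18, 3]))) (.q (.k 41 17 18
    [19, 4, 3]) (.q (.k 41 9 12 [6, 3, 4]) (.k 41 13 12 [6, 3, 4]) (.k 41 9 12 [6, 3, 4]) (.k 42 9
    12 [6, 3, 4])) (.q (.k 41 13 14 [19, 4, 3]) (.k 41 11 40 [1, 2]) (.q (.k 41 8 30 [5, 18, 3])
    (.k 41 9 12 [19, 4, 7]) (.k 41 7 33 [5, 18, 3]) (.k 41 9 30 [5, 18, 3])) (.k 41 13 14 [19, 4,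
    3])) (.k 42 18 14 [10, 15, 4]))) (.q (.q (.q (.k 40 6 24 [0, 3, 4, 21]) (.k 41 7 24 [0, 3, 4,
    21]) (.k 41 10 22 [0, 3, 4, 21]) (.k 41 11 22 [0, 3, 4, 21])) (.q (.k 41 7 22 [0, 3, 4, 21])
    (.k 42 7 22 [0, 3, 4, 21]) (.k 42 9 22 [3, 2, 4, 21]) (.k 42 8 22 [0, 3, 4, 21])) (.q (.q (.k
    41 7 22 [19, 4, 3, 21]) (.k 41 8 22 [3, 2, 21]) (.k 41 8 22 [19, 2, 3, 21]) (.k 41 8 22 [19,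
    2, 3, 21])) (.q (.k 41 8 22 [3, 2, 21]) (.q (.o 15) (.o 13) (.o 16) (.o 15)) (.k 41 9 22 [19,
    2, 3, 21]) (.k 41 10 22 [3, 2, 21])) (.q (.k 41 9 22 [9, 2, 3, 21]) (.k 41 10 22 [3, 2, 21])
    (.k 41 8 22 [19, 4, 3, 21]) (.k 41 9 22 [9, 2, 3, 21])) (.q (.k 41 11 22 [9, 2, 3, 21]) (.k 42
    12 22 [3, 2, 21]) (.k 42 13 24 [1, 2]) (.k 42 17 24 [1, 2]))) (.q (.q (.o 19) (.o 15) (.q (.o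
    15) (.o 13) (.o 16) (.o 13)) (.o 16)) (.k 42 12 22 [3, 18, 21, 0]) (.q (.q (.o 16) (.o 15) (.o
    16) (.o 16)) (.o 17) (.q (.o 17) (.o 16) (.o 19) (.o 16)) (.q (.o 13) (.o 13) (.o 13) (.o
    13))) (.q (.o 15) (.q (.o 13) (.o 15) (.o 12) (.o 15)) (.o 16) (.o 16)))) (.q (.q (.k 42 9 20
    [0, 3, 4, 21]) (.k 43 9 20 [0, 3, 4, 21]) (.k 42 9 22 [0, 3, 4, 21]) (.k 43 10 24 [3, 18,
    11])) (.k 44 18 20 [0, 17, 4, 21]) (.q (.k 43 13 20 [0, 3, 4, 21]) (.k 43 14 20 [0, 3, 4, 21])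
    (.q (.k 43 11 20 [0, 3, 4, 21]) (.k 43 11 20 [0, 3, 4, 21]) (.q (.o 15) (.o 15) (.o 14) .s)
    .s) .s) .s) (.q (.q (.k 42 14 30 [1, 2]) (.q (.k 42 11 22 [9, 2, 3, 21]) (.k 42 13 24 [1, 2])
    (.k 42 13 12 [6, 3, 4]) (.k 42 13 12 [6, 3, 4])) (.k 42 13 12 [6, 3, 4]) (.k 42 14 30 [1, 2]))
    (.q (.q (.q (.o 17) (.o 16) (.o 17) (.o 16)) (.q (.o 15) (.o 14) (.o 15) (.o 15)) (.k 42 13 26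
    [1, 2]) (.q (.o 16) (.o 15) (.o 19) (.o 16))) (.q (.o 19) (.o 16) (.q (.o 15) (.o 13) (.o 15)
    .s) .s) (.q (.k 42 13 12 [6, 3, 4]) (.q (.q (.o 15) (.o 15) (.o 16) (.o 16)) (.o 19) (.q (.o
    16) .s .s .s) .s) (.q (.k 42 10 26 [1, 2]) (.q (.q (.o 19) .s .s .s) .s .s .s) .s .s) .s) .s)
    (.q (.k 42 10 33 [1, 2]) (.k 43 13 12 [6, 3, 4]) (.k 43 9 12 [6, 3, 4]) .s) .s) .s) (.q (.q
    (.k 41 10 16 [5, 8, 7, 10]) (.q (.k 41 6 36 [5, 18, 3]) (.k 41 8 26 [2, 3, 4]) (.k 41 5 36 [5,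
    18, 3]) (.k 41 6 36 [5, 18, 3])) (.k 42 9 33 [19, 4, 3]) (.q (.k 41 5 36 [19, 18, 3]) (.k 42 7
    30 [2, 3, 4]) (.k 42 4 24 [19, 16, 7, 2]) (.k 42 5 40 [19, 4, 3]))) (.q (.q (.k 41 13 30 [5,
    18, 3]) (.q (.k 41 9 30 [5, 18, 3]) (.k 42 11 12 [19, 4, 7]) (.k 42 8 33 [5, 18, 3]) (.k 42 9
    30 [5, 18, 3])) (.k 42 9 33 [5, 18, 3]) (.q (.k 42 7 33 [5, 18, 3]) (.k 42 9 30 [5, 18, 3])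
    (.k 42 6 36 [5, 18, 3]) (.q (.k 42 6 33 [5, 18, 3]) .s .s .s))) (.q (.k 42 13 14 [19, 4, 7])
    (.q (.k 42 10 14 [19, 4, 3]) .s .s .s) (.q (.k 42 9 30 [5, 18, 3]) .s .s .s) .s) (.q (.k 42 7
    36 [19, 4, 3]) (.q (.q (.q (.o 16) (.o 17) (.o 17) .s) .s .s .s) .s .s .s) .s .s) .s) (.q (.k
    42 5 33 [9, 16, 7, 2]) (.q (.k 42 4 26 [2, 15, 8, 19]) .s .s .s) (.q (.q (.k 42 3 28 [23, 2,
    7, 12]) .s .s .s) .s .s .s) .s) .s) .s, by decide +kernel⟩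
  · exact ⟨.s, by decide +kernel⟩
  · exact ⟨.s, by decide +kernel⟩
  · exact ⟨.s, by decide +kernel⟩

theorem columnChecked_8 : ColumnChecked 8 := by
  intro j hj
  interval_cases j
  · exact ⟨.q (.k 35 0 33 [0]) (.k 38 0 36 [0]) (.o 5) (.o 11), by decide +kernel⟩
  · exact ⟨.q (.o 4) (.o 5) (.o 3) (.o 4), by decide +kernel⟩
  · exact ⟨.o 4, by decide +kernel⟩
  · exact ⟨.q (.o 3) (.o 4) (.o 2) (.o 5), by decide +kernel⟩
  · exact ⟨.q (.o 2) (.k 37 3 40 [3, 7]) (.o 3) (.q (.o 3) (.o 7) (.o 3) (.o 7)),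
    by decide +kernel⟩
  · exact ⟨.q (.o 3) (.q (.o 5) (.o 6) (.o 5) (.o 6)) (.o 5) (.q (.o 5) (.o 6) (.o 5) (.o 6)),
    by decide +kernel⟩
  · exact ⟨.q (.o 5) (.q (.o 5) (.o 6) (.o 5) (.o 6)) (.q (.o 5) (.o 5) (.o 13) (.o 13)) (.q (.o
    6) (.o 7) (.o 9) (.o 9)), by decide +kernel⟩
  · exact ⟨.q (.q (.q (.o 12) (.o 13) (.q (.o 11) (.o 12) (.o 16) (.q (.o 11) (.o 12) (.o 12) (.o
    12))) (.q (.o 12) (.o 12) (.q (.o 12) (.o 12) (.o 13) (.o 13)) (.q (.o 12) (.o 10) (.o 13) (.o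
    13)))) (.q (.o 12) (.o 9) (.q (.o 10) (.o 9) (.q (.o 10) (.o 9) (.o 13) (.o 11)) (.o 13)) (.q
    (.o 9) (.o 9) (.o 10) (.o 10))) (.q (.q (.k 40 4 30 [0, 4, 7]) (.k 40 6 30 [3, 18]) (.k 40 4
    30 [0, 4, 7]) (.k 41 4 30 [0, 4, 7])) (.q (.k 41 7 30 [3, 18]) (.k 41 10 22 [13, 18, 7]) (.k
    41 5 30 [5, 18, 3]) (.k 41 7 30 [3, 18])) (.k 41 6 40 [3, 18]) (.k 42 10 26 [0, 4, 7])) (.q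
    (.q (.q (.o 14) (.o 13) (.k 41 6 30 [3, 18]) (.q (.o 13) (.o 13) (.o 14) (.o 13))) (.q (.o 13)
    (.o 10) (.o 14) (.o 13)) (.k 42 8 24 [5, 18, 7]) (.q (.o 15) (.o 14) (.q (.o 14) (.o 14) (.o
    15) (.o 14)) (.o 14))) (.q (.o 14) (.o 12) (.q (.o 11) (.o 10) (.o 13) (.o 12)) (.o 17)) (.q
    (.k 42 6 30 [5, 18, 3]) (.k 42 8 33 [3, 18]) (.k 42 4 40 [18, 3]) (.k 43 6 33 [0, 3, 4])) (.q
    (.q (.o 14) (.o 13) (.o 17) (.q (.o 12) (.o 13) (.o 13) (.o 13))) (.q (.o 13) (.o 13) (.q (.o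
    13) (.o 13) (.o 13) (.o 13)) (.q (.o 13) (.o 13) (.o 13) (.o 13))) (.k 43 7 33 [3, 18]) (.k 44
    10 20 [0, 4, 7])))) (.q (.q (.o 9) (.o 9) (.o 13) (.o 13)) (.q (.o 9) (.o 6) (.o 9) .s) (.q
    (.q (.o 12) (.o 12) (.o 16) (.o 14)) (.q (.o 10) .s (.o 13) .s) (.q (.q (.o 13) (.o 13) (.o
    17) (.o 17)) (.q (.o 13) .s .s .s) (.q (.q (.o 14) (.o 14) (.o 17) .s) .s .s .s) .s) .s) .s)
    (.q (.q (.k 42 4 26 [4, 1, 6, 11]) (.k 43 5 24 [6, 1, 4, 11]) (.k 43 5 22 [5, 4, 20, 17, 21])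
    (.k 43 6 22 [1, 4, 10, 11, 17])) (.q (.k 44 8 40 [18, 3]) (.q (.k 44 6 33 [0, 3, 4]) (.k 44 7
    36 [3, 18]) (.k 44 4 33 [0, 4, 15]) .s) (.k 44 6 22 [1, 4, 6, 11, 17]) .s) (.q (.q (.k 42 4 22
    [0, 18, 17, 21]) (.k 43 4 22 [0, 4, 17, 21, 2]) (.k 43 5 22 [0, 17, 4, 21]) (.k 43 5 20 [0,
    17, 18, 21])) (.q (.k 43 5 20 [0, 18, 17, 21]) (.k 44 5 22 [0, 18, 3, 11]) (.k 44 5 20 [0, 18,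
    17, 21]) .s) (.q (.k 43 8 20 [18, 17, 21]) (.k 43 8 20 [0, 4, 11, 17, 21]) (.k 43 10 30 [15,
    18]) .s) .s) .s) .s, by decide +kernel⟩
  · exact ⟨.q (.q (.q (.q (.q (.q (.q (.q (.k 43 5 22 [17, 18, 21]) .s .s .s) .s .s .s) .s .s .s)
    .s .s .s) .s .s .s) .s .s .s) .s .s .s) .s .s .s, by decide +kernel⟩
  · exact ⟨.s, by decide +kernel⟩
  · exact ⟨.s, by decide +kernel⟩
  · exact ⟨.s, by decide +kernel⟩

theorem columnChecked_9 : ColumnChecked 9 := by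
  intro j hj
  interval_cases j
  · exact ⟨.q (.k 41 1 33 [0]) (.k 44 2 36 [0]) (.k 40 1 33 [0]) (.k 44 2 36 [0]),
    by decide +kernel⟩
  · exact ⟨.q (.k 40 0 40 [0]) (.k 44 2 33 [0]) (.k 40 0 40 [0]) (.k 44 1 40 [19]),
    by decide +kernel⟩
  · exact ⟨.q (.o 4) (.k 43 2 33 [5]) (.o 5) (.k 43 2 36 [1]), by decide +kernel⟩
  · exact ⟨.q (.o 6) (.k 43 2 40 [1]) (.k 39 2 40 [3]) (.k 43 7 40 [0, 7]), by decide +kernel⟩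
  · exact ⟨.q (.q (.k 38 0 36 [1]) (.k 39 0 40 [1]) (.k 38 0 40 [3]) (.k 40 1 33 [15])) (.q (.k 41
    1 33 [3]) (.k 42 1 40 [3]) (.k 41 1 40 [3]) (.k 43 2 40 [3])) (.q (.k 38 0 40 [3]) (.k 40 2 40
    [3]) (.k 39 1 36 [3, 21]) (.k 40 1 40 [3, 1, 11])) (.q (.k 42 2 40 [17, 7]) (.k 43 3 40 [1,
    7]) (.k 42 5 40 [1, 11]) (.q (.k 42 1 40 [17, 7]) (.k 43 1 40 [17, 1, 7]) (.k 43 4 36 [1, 7])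
    (.k 44 5 36 [1, 11]))), by decide +kernel⟩
  · exact ⟨.q (.q (.k 39 5 40 [1, 21]) (.k 41 10 40 [1, 21]) (.o 18) (.q (.o 12) (.k 41 4 40 [11,
    13]) (.o 10) (.o 15))) (.q (.q (.k 41 1 36 [1, 11]) (.k 42 4 36 [17, 11]) (.k 41 5 36 [1, 21])
    (.k 42 7 36 [5, 21])) (.q (.k 43 6 36 [1, 11]) (.k 44 11 36 [5, 11]) (.k 43 11 36 [5, 21]) (.q
    (.k 43 7 33 [1, 21]) (.k 44 10 33 [1, 11]) (.k 44 10 33 [1, 21]) (.k 44 11 33 [1, 21]))) (.q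
    (.k 42 10 40 [5, 11]) (.k 43 12 40 [7, 13]) (.q (.o 10) (.o 11) (.o 10) (.o 11)) (.q (.o 13)
    (.k 43 11 36 [5, 21]) (.o 12) (.q (.o 12) (.o 13) (.o 11) (.o 12)))) (.q (.q (.k 43 9 36 [5,
    11]) (.k 43 11 36 [5, 11]) (.k 43 11 36 [5, 11]) (.k 43 12 36 [5, 11])) (.q (.k 44 12 33 [1,
    21]) (.k 44 13 33 [5, 21]) (.k 44 14 33 [5, 21]) (.q (.k 44 10 33 [5, 21]) (.k 44 10 33 [5,
    21]) (.k 44 10 33 [5, 21]) (.k 44 12 33 [5, 11]))) (.q (.k 43 11 36 [11, 13]) (.q (.k 43 9 33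
    [1, 21]) (.k 43 9 33 [5, 21]) (.k 43 10 33 [1, 11]) (.k 44 17 12 [])) (.k 44 21 36 [11, 13])
    (.q (.k 44 13 12 []) (.k 44 11 12 []) (.k 44 9 12 []) (.k 44 9 12 []))) (.q (.q (.k 44 10 33
    [5, 21]) (.k 44 10 33 [5, 21]) (.k 44 14 12 []) (.k 44 13 12 [])) (.q (.k 44 16 12 []) .s (.k
    44 11 12 []) .s) (.q (.k 44 10 12 []) (.k 44 9 12 []) (.k 44 9 12 []) .s) .s))) (.q (.o 12)
    (.q (.o 8) (.o 14) (.o 12) (.q (.o 9) (.o 13) (.o 12) (.k 42 9 12 []))) (.q (.o 6) (.o 8) (.o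
    6) (.o 10)) (.q (.q (.o 7) (.o 11) (.o 8) (.o 12)) (.k 43 13 12 []) (.q (.o 10) (.o 12) (.o
    11) (.o 12)) (.k 44 12 12 []))) (.q (.q (.q (.o 9) (.o 10) (.o 10) (.o 14)) (.q (.o 11) (.o
    12) (.o 15) (.o 14)) (.q (.k 43 10 12 []) (.k 43 10 12 []) (.k 43 10 12 []) (.k 43 10 12 []))
    (.q (.k 43 10 12 []) (.k 44 10 12 []) (.k 44 10 12 []) (.k 44 10 12 []))) (.q (.q (.k 44 15 12
    []) (.k 44 12 12 []) (.k 44 10 12 []) (.k 44 10 12 [])) (.q (.k 45 10 12 []) .s .s .s) (.k 45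
    13 12 []) .s) (.q (.k 44 13 12 []) (.k 45 14 12 []) (.k 44 13 12 []) (.k 45 14 12 [])) .s),
    by decide +kernel⟩
  · exact ⟨.q (.q (.q (.o 6) (.o 10) (.o 6) (.o 10)) (.q (.q (.o 10) (.o 12) (.o 10) (.o 12)) (.q
    (.k 43 11 12 []) (.k 44 11 12 []) (.q (.o 12) (.o 18) (.o 12) (.o 17)) (.k 44 14 12 [])) (.q
    (.o 10) (.o 11) (.o 10) (.o 10)) (.k 45 11 22 [17, 4, 21, 0])) (.q (.o 6) (.o 10) (.o 7) (.o
    9)) (.q (.o 16) (.q (.o 11) .s (.o 11) .s) (.o 11) .s)) (.q (.q (.k 45 21 12 []) .s (.q (.q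
    (.k 44 6 36 [1, 4, 3]) .s .s .s) .s .s .s) .s) .s .s .s) (.q (.q (.o 7) (.o 9) (.o 7) (.o 8))
    (.q (.o 9) .s .s .s) (.q (.o 7) .s .s .s) .s) .s, by decide +kernel⟩
  · exact ⟨.s, by decide +kernel⟩
  · exact ⟨.s, by decide +kernel⟩
  · exact ⟨.s, by decide +kernel⟩
  · exact ⟨.s, by decide +kernel⟩
  · exact ⟨.s, by decide +kernel⟩

theorem columnChecked_10 : ColumnChecked 10 := by
  intro j hj
  interval_cases j
  · exact ⟨.q (.k 48 2 40 [0]) (.k 53 3 40 [0]) (.k 48 2 40 [0]) (.k 53 4 36 [0]),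
    by decide +kernel⟩
  · exact ⟨.q (.k 48 2 40 [0]) (.k 53 4 36 [0]) (.k 48 2 40 [0]) (.k 53 4 36 [5]),
    by decide +kernel⟩
  · exact ⟨.q (.k 48 2 40 [9]) (.k 53 4 40 [1]) (.k 47 3 40 [1]) (.k 52 4 40 [1]),
    by decide +kernel⟩
  · exact ⟨.q (.k 47 4 40 [17]) (.q (.k 49 2 33 [1]) (.k 51 2 36 [1]) (.k 49 2 33 [1]) (.k 51 2 36
    [1])) (.q (.k 44 1 36 [1]) (.k 46 2 33 [3]) (.k 44 1 40 [1]) (.k 46 2 33 [3])) (.q (.k 49 2 36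
    [17]) (.k 51 2 40 [1]) (.k 48 3 40 [17]) .s), by decide +kernel⟩
  · exact ⟨.q (.q (.k 44 2 36 [3]) (.k 47 2 36 [1, 15]) (.k 45 2 36 [1, 11]) (.k 47 13 36 [5, 7]))
    (.q (.k 49 10 33 [1, 21]) .s .s .s) (.q (.k 45 15 36 [1, 21]) (.q (.k 46 2 40 [3, 13]) (.k 46
    6 33 [11, 13]) (.k 46 7 33 [1, 11]) .s) (.q (.k 44 4 36 [1, 7]) (.k 45 8 33 [1, 21]) (.k 45 11
    36 [1, 7]) (.k 45 14 33 [1, 21])) (.q (.k 46 13 33 [1, 21]) .s .s .s)) .s, by decide +kernel⟩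
  · exact ⟨.q (.q (.q (.q (.k 44 6 33 [1, 11]) (.k 45 9 33 [1, 11]) (.k 44 10 33 [1, 11]) (.k 45
    11 33 [1, 11])) (.q (.k 45 11 33 [1, 11]) .s .s .s) (.q (.k 44 11 33 [1, 11]) (.k 45 13 33 [1,
    11]) (.k 45 13 33 [5, 21]) .s) .s) .s (.q (.q (.q (.k 44 11 33 [1, 11]) .s (.k 44 11 33 [1,
    11]) .s) .s .s .s) .s .s .s) .s) .s .s .s, by decide +kernel⟩
  · exact ⟨.s, by decide +kernel⟩
  · exact ⟨.s, by decide +kernel⟩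
  · exact ⟨.s, by decide +kernel⟩
  · exact ⟨.s, by decide +kernel⟩
  · exact ⟨.s, by decide +kernel⟩
  · exact ⟨.s, by decide +kernel⟩

theorem columnChecked_11 : ColumnChecked 11 := by
  intro j hj
  interval_cases j
  · exact ⟨.q (.k 58 5 40 [0]) .s (.k 58 5 36 [0]) .s, by decide +kernel⟩
  · exact ⟨.q (.k 58 4 40 [19]) .s (.k 58 4 40 [5]) .s, by decide +kernel⟩
  · exact ⟨.q (.k 57 5 40 [5]) .s (.q (.k 54 2 36 [1]) .s .s .s) .s, by decide +kernel⟩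
  · exact ⟨.s, by decide +kernel⟩
  · exact ⟨.s, by decide +kernel⟩
  · exact ⟨.s, by decide +kernel⟩
  · exact ⟨.s, by decide +kernel⟩
  · exact ⟨.s, by decide +kernel⟩
  · exact ⟨.s, by decide +kernel⟩
  · exact ⟨.s, by decide +kernel⟩
  · exact ⟨.s, by decide +kernel⟩
  · exact ⟨.s, by decide +kernel⟩


theorem columnChecked {i : ℕ} (hi : i < 12) : ColumnChecked i := by
  interval_cases i
  exacts [columnChecked_0, columnChecked_1, columnChecked_2, columnChecked_3, columnChecked_4,
    columnChecked_5, columnChecked_6, columnChecked_7, columnChecked_8, columnChecked_9,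
    columnChecked_10, columnChecked_11]

theorem exists_cell {x : ℝ} (h0 : 0 ≤ x) (h1 : x ^ 2 ≤ 1 / 2) :
    ∃ i < 12, |x * 65536 - ((2 * i + 1) * 2048 : ℕ)| ≤ (2048 : ℕ) := by
  have hx : x < 3 / 4 := by nlinarith
  refine ⟨⌊x * 16⌋₊, ?_, ?_⟩
  · rw [Nat.floor_lt (by positivity)]; push_cast; linarith
  · have e1 := Nat.floor_le (by positivity : 0 ≤ x * 16)
    have e2 := Nat.lt_floor_add_one (x * 16)
    rw [abs_le]
    push_cast
    constructor <;> linarith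

theorem exists_separated_of_nonneg {z : ℂ} (hre : 0 ≤ z.re) (him : 0 ≤ z.im) (h1 : 1 / 2 ≤ ‖z‖)
    (h2 : ‖z‖ ^ 2 ≤ 1 / 2) (hr : IsRoot z) :
    ∃ t > 0, ∀ σ ∈ orbitPoints z, Separated z t σ := by
  have hn : ‖z‖ ^ 2 = z.re ^ 2 + z.im ^ 2 := by
    rw [Complex.sq_norm, Complex.normSq_apply]; ring
  obtain ⟨i, hi, hx⟩ := exists_cell hre (by nlinarith [sq_nonneg z.im])
  obtain ⟨j, hj, hy⟩ := exists_cell him (by nlinarith [sq_nonneg z.re])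
  obtain ⟨c, hc⟩ := columnChecked hi j hj
  exact exists_separated_of_check c (by omega) (by omega) hc hx hy h1 h2 hr

theorem orbitPoints_neg (z : ℂ) : orbitPoints (-z) = orbitPoints z := by
  unfold orbitPoints IsGood
  ext σ
  simp only [norm_neg, neg_mul, sub_neg_eq_add, ← sub_eq_add_neg]
  simp only [Set.mem_ofPred_eq, or_comm]

theorem separated_neg {z : ℂ} {t : ℝ} {σ : ℂ} (h : Separated (-z) t σ) : Separated z t σ := by
  have : zonoidSupport (-z) = zonoidSupport z := by
    funext u
    unfold zonoidSupport
    congr 1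
    funext k
    rcases neg_one_pow_eq_or ℂ (k + 1) with h | h
    · rw [neg_pow, h, one_mul]
    · rw [neg_pow, h, neg_one_mul, mul_neg, Complex.neg_re, abs_neg]
  rwa [Separated, this] at h

theorem IsRoot.neg {z : ℂ} (h : IsRoot z) : IsRoot (-z) := by
  obtain ⟨c, h1, h0, h2⟩ := h
  refine ⟨fun n => (-1) ^ n * c n, fun n => ?_, by simp [h0], ?_⟩
  · rcases neg_one_pow_eq_or ℤ n with h | h <;> rcases h1 n with h' | h' <;> simp [h, h']
  · rw [← h2]
    congr 1
    funext n
    rw [neg_pow]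
    push_cast
    have : ((-1 : ℂ) ^ n) * (-1) ^ n = 1 := by rw [← mul_pow]; simp
    linear_combination (c n : ℂ) * z ^ n * this

theorem mem_orbitPoints_conj {z σ : ℂ} (h : σ ∈ orbitPoints z) : conj σ ∈ orbitPoints (conj z) := by
  obtain ⟨s, rfl, hs⟩ := h
  refine ⟨fun k => conj (s k), rfl, fun k => ?_⟩
  obtain ⟨⟨h1, h2⟩, h3, h4⟩ := hs k
  have e : conj (s k) - 1 = conj (s k - 1) := by simp
  refine ⟨⟨?_, by simpa using h2⟩, by simpa [RCLike.norm_conj] using h3, ?_⟩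
  · rw [e, RCLike.norm_conj, RCLike.norm_conj, RCLike.norm_conj]; exact h1
  · rcases h4 with h4 | h4
    · left; dsimp only; rw [h4]; simp
    · right; dsimp only; rw [h4]; simp

theorem separated_conj {z : ℂ} {t : ℝ} {σ : ℂ} (h : Separated (conj z) t (conj σ)) :
    Separated z t σ := by
  have e1 : ∀ u, zonoidSupport (conj z) u = zonoidSupport z (conj u) := by
    intro u
    unfold zonoidSupport
    congr 1
    funext k
    rw [← Complex.conj_re (conj u * conj z ^ (k + 1))]
    simp
  have e2 : ∀ u, (conj u * (conj σ - 1)).re = (conj (conj u) * (σ - 1)).re := by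
    intro u
    rw [← Complex.conj_re (conj u * (conj σ - 1))]
    simp
  obtain ⟨⟨u, hu⟩, v, hv0, hv⟩ := h
  refine ⟨⟨conj u, ?_⟩, conj v, by simpa using hv0, ?_⟩
  · rw [← e1, ← e2, Complex.conj_re]; exact hu
  · rw [← e1, ← e2]; exact hv

theorem IsRoot.conj {z : ℂ} (h : IsRoot z) : IsRoot (conj z) := by
  obtain ⟨c, h1, h0, h2⟩ := h
  refine ⟨c, h1, h0, ?_⟩
  have := congrArg (starRingEnd ℂ) h2
  rw [Complex.conj_tsum] at this
  simpa using this

theorem exists_separated_of_re_nonneg {z : ℂ} (hre : 0 ≤ z.re) (h1 : 1 / 2 ≤ ‖z‖)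
    (h2 : ‖z‖ ^ 2 ≤ 1 / 2) (hr : IsRoot z) :
    ∃ t > 0, ∀ σ ∈ orbitPoints z, Separated z t σ := by
  rcases le_total 0 z.im with him | him
  · exact exists_separated_of_nonneg hre him h1 h2 hr
  · obtain ⟨t, ht, h⟩ := exists_separated_of_nonneg (z := starRingEnd ℂ z) (by simpa using hre)
      (by simpa using him) (by rwa [RCLike.norm_conj]) (by rwa [RCLike.norm_conj]) hr.conj
    exact ⟨t, ht, fun σ hσ => separated_conj (h _ (mem_orbitPoints_conj hσ))⟩

/-- The separation properties of the good orbit points. -/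
theorem exists_separated {z : ℂ} (h1 : 1 / 2 ≤ ‖z‖) (h2 : ‖z‖ ^ 2 ≤ 1 / 2) (hr : IsRoot z) :
    ∃ t > 0, ∀ σ ∈ orbitPoints z, Separated z t σ := by
  rcases le_total 0 z.re with hre | hre
  · exact exists_separated_of_re_nonneg hre h1 h2 hr
  · obtain ⟨t, ht, h⟩ := exists_separated_of_re_nonneg (z := -z) (by simpa using hre)
      (by rwa [norm_neg]) (by rwa [norm_neg]) hr.neg
    rw [orbitPoints_neg] at h
    exact ⟨t, ht, fun σ hσ => separated_neg (h σ hσ)⟩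

end BoxCheck

open Filter Topology

/-- The value at `w` of the power series with coefficients `a`. -/
noncomputable def seriesVal (w : ℂ) (a : ℕ → ℤ) : ℂ := ∑' n, (a n : ℂ) * w ^ n

theorem norm_coeff_mul_le {a : ℤ} {C : ℝ} (ha : ‖(a : ℂ)‖ ≤ C) (w : ℂ) (n : ℕ) :
    ‖(a : ℂ) * w ^ n‖ ≤ C * ‖w‖ ^ n := by
  rw [norm_mul, norm_pow]
  gcongr

theorem summable_series {w : ℂ} (hw : ‖w‖ < 1) {a : ℕ → ℤ} {C : ℝ} (ha : ∀ n, ‖(a n : ℂ)‖ ≤ C) :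
    Summable fun n => (a n : ℂ) * w ^ n :=
  Summable.of_norm_bounded ((summable_geometric_of_lt_one (norm_nonneg w) hw).mul_left C)
    fun n => norm_coeff_mul_le (ha n) w n

theorem norm_le_one_of_sign {a : ℤ} (h : a = -1 ∨ a = 1) : ‖(a : ℂ)‖ ≤ 1 := by
  rcases h with rfl | rfl <;> simp

theorem norm_le_one_of_mem {a : ℤ} (h : a = -1 ∨ a = 0 ∨ a = 1) : ‖(a : ℂ)‖ ≤ 1 := by
  rcases h with rfl | rfl | rfl <;> simp

/-- The value at `w` depends continuously on the coefficients. -/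
theorem continuousOn_seriesVal {w : ℂ} (hw : ‖w‖ < 1) :
    ContinuousOn (seriesVal w) {a | ∀ n, ‖(a n : ℂ)‖ ≤ 1} := by
  unfold seriesVal
  refine continuousOn_tsum (u := fun n => ‖w‖ ^ n) (fun n => ?_)
    (summable_geometric_of_lt_one (norm_nonneg w) hw) fun n a ha => ?_
  · have h : Continuous fun m : ℤ => (m : ℂ) := continuous_of_discreteTopology
    exact ((h.comp (continuous_apply n)).mul continuous_const).continuousOn
  · simpa using norm_coeff_mul_le (ha n) w n

theorem isCompact_seq {s : Set ℤ} (hs : s.Finite) : IsCompact {a : ℕ → ℤ | ∀ n, a n ∈ s} := by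
  have := isCompact_univ_pi (s := fun _ : ℕ => s) fun _ => hs.isCompact
  simpa [Set.pi] using this

theorem attractor_eq_image (w : ℂ) :
    attractor w = seriesVal w '' {a | ∀ n, a n ∈ ({-1, 1} : Set ℤ)} := by
  ext x
  constructor
  · rintro ⟨a, ha, rfl⟩; exact ⟨a, ha, rfl⟩
  · rintro ⟨a, ha, rfl⟩; exact ⟨a, ha, rfl⟩

theorem isCompact_attractor {w : ℂ} (hw : ‖w‖ < 1) : IsCompact (attractor w) := by
  rw [attractor_eq_image]
  refine (isCompact_seq (by simp)).image_of_continuousOn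
    ((continuousOn_seriesVal hw).mono fun a ha n => norm_le_one_of_sign (ha n))

/-- Splitting off the first term. -/
theorem seriesVal_succ {w : ℂ} (hw : ‖w‖ < 1) {a : ℕ → ℤ} {C : ℝ} (ha : ∀ n, ‖(a n : ℂ)‖ ≤ C) :
    seriesVal w a = a 0 + w * seriesVal w fun n => a (n + 1) := by
  unfold seriesVal
  rw [(summable_series hw ha).tsum_eq_zero_add, ← tsum_mul_left]
  congr 1
  · simp
  · congr 1; funext n; ring

theorem mem_vanishingSeries {w : ℂ} {a : ℕ → ℤ} (h : ∀ n, a n = -1 ∨ a n = 0 ∨ a n = 1)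
    (h0 : a 0 = 1) (hs : seriesVal w a = 0) : PowerSeries.mk a ∈ vanishingSeries w := by
  refine ⟨⟨fun j => by simpa using h j, by simpa using h0⟩, ?_⟩
  simpa [seriesVal] using hs

theorem vanishingSeries_nonempty_of_mem_thurstonSet {w : ℂ} (h : w ∈ thurstonSet) :
    (vanishingSeries w).Nonempty := by
  obtain ⟨-, a, ha, hs⟩ := h
  refine ⟨_, mem_vanishingSeries (a := fun n => a 0 * a n) (fun n => ?_) ?_ ?_⟩
  · rcases ha 0 with h0 | h0 <;> rcases ha n with hn | hn <;> simp [h0, hn]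
  · rcases ha 0 with h0 | h0 <;> simp [h0]
  · have : seriesVal w (fun n => a 0 * a n) = a 0 * seriesVal w a := by
      unfold seriesVal
      rw [← tsum_mul_left]
      congr 1; funext n; push_cast; ring
    rw [this, seriesVal, ← hs, mul_zero]

theorem vanishingSeries_nonempty_of_mem_connectednessLocus {w : ℂ} (h : w ∈ connectednessLocus) :
    (vanishingSeries w).Nonempty := by
  obtain ⟨hw, -, hconn⟩ := h
  have hcl : ∀ s : ℂ, IsClosed ((fun x => s + w * x) '' attractor w) := fun s =>
    ((isCompact_attractor hw).image (by fun_prop)).isClosed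
  have hstep : ∀ s : ℤ, (s = -1 ∨ s = 1) → ∀ a : ℕ → ℤ, (∀ n, a n = -1 ∨ a n = 1) →
      (s : ℂ) + w * seriesVal w a ∈ attractor w := by
    intro s hs a ha
    refine ⟨fun n => Nat.casesOn n s a, fun n => ?_, ?_⟩
    · cases n with
      | zero => exact hs
      | succ n => exact ha n
    · have := seriesVal_succ hw (a := fun n => Nat.casesOn n s a) (C := 1) (fun n => ?_)
      · exact this.symm
      · cases n with
        | zero => exact norm_le_one_of_sign hs
        | succ n => exact norm_le_one_of_sign (ha n)
  have hone : seriesVal w (fun _ => 1) ∈ attractor w := ⟨fun _ => 1, fun _ => Or.inr rfl, rfl⟩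
  obtain ⟨x, -, ⟨y, ⟨a, ha, rfl⟩, hy⟩, ⟨y', ⟨b, hb, rfl⟩, hy'⟩⟩ :=
    isPreconnected_closed_iff.1 hconn _ _ (hcl (-1)) (hcl 1) (by
      rintro x ⟨a, ha, rfl⟩
      have := seriesVal_succ hw (a := a) (C := 1) fun n => norm_le_one_of_sign (ha n)
      rcases ha 0 with h0 | h0
      · left
        refine ⟨_, ⟨fun n => a (n + 1), fun n => ha _, rfl⟩, ?_⟩
        change _ = seriesVal w a
        rw [this, h0]; simp [seriesVal]
      · right
        refine ⟨_, ⟨fun n => a (n + 1), fun n => ha _, rfl⟩, ?_⟩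
        change _ = seriesVal w a
        rw [this, h0]; simp [seriesVal])
      ⟨_, by simpa using hstep (-1) (Or.inl rfl) (fun _ => 1) (fun _ => Or.inr rfl), _, hone, rfl⟩
      ⟨_, by simpa using hstep 1 (Or.inr rfl) (fun _ => 1) (fun _ => Or.inr rfl), _, hone, rfl⟩
  have hd : ∀ n, (b n - a n) / 2 = -1 ∨ (b n - a n) / 2 = 0 ∨ (b n - a n) / 2 = 1 := fun n => by
    rcases ha n with h1 | h1 <;> rcases hb n with h2 | h2 <;> simp [h1, h2]
  have hd2 : ∀ n, (((b n - a n) / 2 : ℤ) : ℂ) = ((b n : ℂ) - a n) / 2 := fun n => by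
    rcases ha n with h1 | h1 <;> rcases hb n with h2 | h2 <;> norm_num [h1, h2]
  refine ⟨_, mem_vanishingSeries (a := fun n => Nat.casesOn n 1 fun k => (b k - a k) / 2)
    (fun n => ?_) rfl ?_⟩
  · cases n with
    | zero => exact Or.inr (Or.inr rfl)
    | succ n => exact hd n
  · rw [seriesVal_succ hw (C := 1)]
    · have hs : seriesVal w (fun k => (b k - a k) / 2) = (seriesVal w b - seriesVal w a) / 2 := by
        unfold seriesVal
        rw [← (summable_series hw fun n => norm_le_one_of_sign (hb n)).tsum_sub
          (summable_series hw fun n => norm_le_one_of_sign (ha n)), ← tsum_div_const]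
        congr 1; funext n; rw [hd2]; ring
      have e : (-1 : ℂ) + w * seriesVal w a = 1 + w * seriesVal w b := hy.trans hy'.symm
      change ((1 : ℤ) : ℂ) + w * seriesVal w (fun k => (b k - a k) / 2) = 0
      rw [hs]
      push_cast
      linear_combination -e / 2
    · intro n
      cases n with
      | zero => exact norm_le_one_of_sign (Or.inr rfl)
      | succ n => exact norm_le_one_of_mem (hd n)

/-- Distance of the sequences of powers. -/
noncomputable def powDist (z w : ℂ) : ℝ := ∑' n, ‖w ^ n - z ^ n‖

theorem summable_powDist {z w : ℂ} (hz : ‖z‖ < 1) (hw : ‖w‖ < 1) :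
    Summable fun n => ‖w ^ n - z ^ n‖ := by
  refine Summable.of_nonneg_of_le (fun _ => norm_nonneg _) (fun n => norm_sub_le _ _) ?_
  simp only [norm_pow]
  exact (summable_geometric_of_lt_one (norm_nonneg w) hw).add
    (summable_geometric_of_lt_one (norm_nonneg z) hz)

theorem tendsto_powDist {z : ℂ} (hz : ‖z‖ < 1) : Tendsto (powDist z) (𝓝 z) (𝓝 0) := by
  obtain ⟨ρ, h1, h2⟩ := exists_between hz
  have h0 : 0 ≤ ρ := (norm_nonneg z).trans h1.le
  have := tendsto_tsum_of_dominated_convergence (𝓕 := 𝓝 z) (f := fun w n => ‖w ^ n - z ^ n‖)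
    (g := fun _ => (0 : ℝ)) (bound := fun n => 2 * ρ ^ n)
    ((summable_geometric_of_lt_one h0 h2).mul_left 2) (fun n => ?_) ?_
  · have e : powDist z = fun w => ∑' n, ‖w ^ n - z ^ n‖ := rfl
    rw [e]
    simpa using this
  · have : Continuous fun w : ℂ => ‖w ^ n - z ^ n‖ := by fun_prop
    simpa using this.tendsto z
  · filter_upwards [(continuous_norm.tendsto z).eventually (gt_mem_nhds h1)] with w hw n
    rw [norm_norm, two_mul]
    refine (norm_sub_le _ _).trans ?_
    rw [norm_pow, norm_pow]
    gcongr

theorem norm_seriesVal_sub_le {z w : ℂ} (hz : ‖z‖ < 1) (hw : ‖w‖ < 1) {a : ℕ → ℤ} {C : ℝ}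
    (ha : ∀ n, ‖(a n : ℂ)‖ ≤ C) : ‖seriesVal w a - seriesVal z a‖ ≤ C * powDist z w := by
  unfold seriesVal powDist
  rw [← (summable_series hw ha).tsum_sub (summable_series hz ha), ← tsum_mul_left]
  refine tsum_of_norm_bounded ((summable_powDist hz hw).mul_left C).hasSum fun n => ?_
  rw [← mul_sub, norm_mul]
  exact mul_le_mul_of_nonneg_right (ha n) (norm_nonneg _)

/-- If `f` is the only vanishing series at `z`, the vanishing series at nearby parameters share a
long initial segment with `f`. -/
theorem eventually_agree {z : ℂ} (hz : ‖z‖ < 1) {f : ℤ⟦X⟧} (hf : vanishingSeries z = {f}) (N : ℕ) :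
    ∀ᶠ w in 𝓝 z, ∀ g ∈ vanishingSeries w, ∀ j < N, g.coeff j = f.coeff j := by
  set K : Set (ℕ → ℤ) := {a | ∀ n, a n ∈ ({-1, 0, 1} : Set ℤ)} ∩
    {a | a 0 = 1 ∧ ∃ j < N, a j ≠ f.coeff j} with hK
  have hclosed : IsClosed {a : ℕ → ℤ | a 0 = 1 ∧ ∃ j < N, a j ≠ f.coeff j} := by
    have e : {a : ℕ → ℤ | a 0 = 1 ∧ ∃ j < N, a j ≠ f.coeff j}
        = (fun a => a 0) ⁻¹' {1} ∩ ⋃ j ∈ Finset.range N, (fun a => a j) ⁻¹' {f.coeff j}ᶜ := by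
      ext a; simp
    rw [e]
    refine ((isClosed_discrete _).preimage (continuous_apply 0)).inter ?_
    exact isClosed_biUnion_finset fun j _ =>
      (isClosed_discrete _).preimage (continuous_apply j)
  have hcomp : IsCompact K := (isCompact_seq (by simp)).inter_right hclosed
  have hle : ∀ a ∈ K, ∀ n, ‖(a n : ℂ)‖ ≤ 1 := fun a ha n => norm_le_one_of_mem (ha.1 n)
  have hcont : ContinuousOn (fun a => ‖seriesVal z a‖) K :=
    ((continuousOn_seriesVal hz).mono hle).norm
  have hpos : ∃ ε > 0, ∀ a ∈ K, ε ≤ ‖seriesVal z a‖ := by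
    rcases K.eq_empty_or_nonempty with he | hne
    · exact ⟨1, one_pos, fun a ha => by simp [he] at ha⟩
    · obtain ⟨a, ha, hmin⟩ := hcomp.exists_isMinOn hne hcont
      refine ⟨‖seriesVal z a‖, norm_pos_iff.2 fun h0 => ?_, fun b hb => hmin hb⟩
      have hmem := mem_vanishingSeries ha.1 ha.2.1 h0
      rw [hf, Set.mem_singleton_iff] at hmem
      obtain ⟨j, -, hj⟩ := ha.2.2
      exact hj (by rw [← hmem]; simp)
  obtain ⟨ε, hε, hmin⟩ := hpos
  filter_upwards [(tendsto_powDist hz).eventually (gt_mem_nhds hε),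
    (continuous_norm.tendsto z).eventually (gt_mem_nhds hz)] with w hw1 hw2 g hg j hj
  by_contra hne
  have hgK : (fun n => g.coeff n) ∈ K := ⟨hg.1.1, hg.1.2, j, hj, hne⟩
  have h1 := hmin _ hgK
  have h2 := norm_seriesVal_sub_le hz hw2 (hle _ hgK)
  have h3 : seriesVal w (fun n => g.coeff n) = 0 := hg.2
  rw [h3, zero_sub, norm_neg, one_mul] at h2
  linarith

/-- The normalised tail `∑ c_q c_{q+k} z^k` of a series with coefficients `±1`. -/
noncomputable def tailVal (z : ℂ) (c : ℕ → ℤ) (q : ℕ) : ℂ := seriesVal z fun k => c q * c (q + k)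

theorem coeff_mul_self {c : ℕ → ℤ} (hc : ∀ n, c n = 1 ∨ c n = -1) (n : ℕ) : c n * c n = 1 := by
  rcases hc n with h | h <;> simp [h]

theorem coeff_mul_self_complex {c : ℕ → ℤ} (hc : ∀ n, c n = 1 ∨ c n = -1) (n : ℕ) :
    (c n : ℂ) * c n = 1 := by
  exact_mod_cast coeff_mul_self hc n

theorem norm_sign {c : ℕ → ℤ} (hc : ∀ n, c n = 1 ∨ c n = -1) (n : ℕ) : ‖(c n : ℂ)‖ = 1 := by
  rcases hc n with h | h <;> simp [h]

theorem norm_sign_mul_le {c : ℕ → ℤ} (hc : ∀ n, c n = 1 ∨ c n = -1) (m n : ℕ) :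
    ‖((c m * c n : ℤ) : ℂ)‖ ≤ 1 := by
  push_cast
  rw [norm_mul, norm_sign hc, norm_sign hc, one_mul]

theorem tailVal_eq_succ {z : ℂ} (hz : ‖z‖ < 1) {c : ℕ → ℤ} (hc : ∀ n, c n = 1 ∨ c n = -1) (q : ℕ) :
    tailVal z c q = 1 + c q * c (q + 1) * z * tailVal z c (q + 1) := by
  unfold tailVal
  rw [seriesVal_succ hz fun n => norm_sign_mul_le hc q (q + n)]
  have e : seriesVal z (fun n => c q * c (q + (n + 1)))
      = c q * c (q + 1) * seriesVal z fun n => c (q + 1) * c (q + 1 + n) := by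
    unfold seriesVal
    rw [← tsum_mul_left]
    congr 1; funext n
    have h := coeff_mul_self_complex hc (q + 1)
    simp only [show q + (n + 1) = q + 1 + n by ring]
    push_cast
    linear_combination (-(c q : ℂ) * c (q + 1 + n) * z ^ n) * h
  rw [e, add_zero, coeff_mul_self hc]
  push_cast
  ring

theorem seriesVal_eq_tailVal {z : ℂ} (hz : ‖z‖ < 1) {c : ℕ → ℤ} (hc : ∀ n, c n = 1 ∨ c n = -1)
    (q : ℕ) :
    seriesVal z c = (∑ j ∈ Finset.range q, (c j : ℂ) * z ^ j) + c q * z ^ q * tailVal z c q := by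
  induction q with
  | zero =>
    have h := coeff_mul_self_complex hc 0
    simp only [tailVal, seriesVal, ← tsum_mul_left, Finset.range_zero, Finset.sum_empty, zero_add]
    congr 1; funext n
    push_cast
    linear_combination (-(c n : ℂ) * z ^ n) * h
  | succ q ih =>
    rw [ih, Finset.sum_range_succ, tailVal_eq_succ hz hc q]
    have h := coeff_mul_self_complex hc q
    linear_combination (z ^ (q + 1) * c (q + 1) * tailVal z c (q + 1)) * h

theorem norm_seriesVal_le {z : ℂ} (hz : ‖z‖ < 1) {a : ℕ → ℤ} {C : ℝ} (ha : ∀ n, ‖(a n : ℂ)‖ ≤ C) :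
    ‖seriesVal z a‖ ≤ C * (1 - ‖z‖)⁻¹ :=
  tsum_of_norm_bounded ((hasSum_geometric_of_lt_one (norm_nonneg z) hz).mul_left C) fun n =>
    norm_coeff_mul_le (ha n) z n

theorem norm_tailVal_le {z : ℂ} (hz : ‖z‖ < 1) {c : ℕ → ℤ} (hc : ∀ n, c n = 1 ∨ c n = -1) (q : ℕ) :
    ‖tailVal z c q‖ ≤ 1 / (1 - ‖z‖) := by
  have := norm_seriesVal_le hz fun n => norm_sign_mul_le hc q (q + n)
  rw [one_mul, ← one_div] at this
  exact this

theorem aeval_taylorPoly (f : ℤ⟦X⟧) (k : ℕ) (z : ℂ) :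
    Polynomial.aeval z (taylorPoly f k)
      = ∑ j ∈ Finset.range (k + 1), ((f.coeff j : ℤ) : ℂ) * z ^ j := by
  rw [taylorPoly, Polynomial.aeval_def, PowerSeries.eval₂_trunc_eq_sum_range]
  simp

theorem taylorPoly_add (f : ℤ⟦X⟧) (l n : ℕ) :
    taylorPoly f (l + 1 + n) = taylorPoly f l + Polynomial.X ^ (l + 1) *
      ∑ i ∈ Finset.range (n + 1), Polynomial.monomial i (f.coeff (l + 1 + i)) := by
  ext j
  rw [taylorPoly, taylorPoly, Polynomial.coeff_add, Polynomial.coeff_X_pow_mul',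
    PowerSeries.coeff_trunc, PowerSeries.coeff_trunc, Polynomial.finsetSum_coeff]
  simp only [Polynomial.coeff_monomial, Finset.sum_ite_eq', Finset.mem_range]
  split_ifs <;> first | omega | simp_all

/-- A periodic property. -/
theorem forall_of_periodic {P : ℕ → Prop} {l p : ℕ} (hp : 1 ≤ p) (h0 : ∀ n < p, P (l + 1 + n))
    (h : ∀ m, l < m → P m → P (m + p)) : ∀ m, l < m → P m := by
  intro m
  induction m using Nat.strong_induction_on with
  | _ m ih =>
    intro hm
    by_cases hlt : m < l + 1 + p
    · have := h0 (m - (l + 1)) (by omega)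
      rwa [Nat.add_sub_cancel' (by omega)] at this
    · have := h (m - p) (by omega) (ih (m - p) (by omega) (by omega))
      rwa [Nat.sub_add_cancel (by omega)] at this

theorem tailVal_add_period {z : ℂ} {f : ℤ⟦X⟧} {l p : ℕ} (h : HasRationalForm f l p) {q : ℕ}
    (hq : l < q) : tailVal z (fun n => f.coeff n) (q + p) = tailVal z (fun n => f.coeff n) q := by
  unfold tailVal
  congr 1; funext k
  beta_reduce
  rw [h.2 q hq, show q + p + k = q + k + p by ring, h.2 (q + k) (by omega)]

section Conditions

variable {z : ℂ} {f : ℤ⟦X⟧} {l p : ℕ}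

theorem aeval_taylorPoly_eq (hz : ‖z‖ < 1) (hc : ∀ n, f.coeff n = 1 ∨ f.coeff n = -1)
    (h0 : seriesVal z (fun n => f.coeff n) = 0) (k : ℕ) :
    Polynomial.aeval z (taylorPoly f k)
      = -(f.coeff (k + 1) * z ^ (k + 1) * tailVal z (fun n => f.coeff n) (k + 1)) := by
  have h := seriesVal_eq_tailVal hz hc (k + 1)
  rw [h0] at h
  rw [aeval_taylorPoly]
  linear_combination -h

theorem aeval_taylorPoly_eq_sub_one (hz : ‖z‖ < 1) (hc : ∀ n, f.coeff n = 1 ∨ f.coeff n = -1)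
    (h0 : seriesVal z (fun n => f.coeff n) = 0) (k : ℕ) :
    Polynomial.aeval z (taylorPoly f k)
      = -(f.coeff k * z ^ k * (tailVal z (fun n => f.coeff n) k - 1)) := by
  have h := seriesVal_eq_tailVal hz hc k
  rw [h0] at h
  rw [aeval_taylorPoly, Finset.sum_range_succ]
  linear_combination -h

theorem norm_add_norm_sub_one_gt (hz : ‖z‖ < 1)
    (hc : ∀ n, f.coeff n = 1 ∨ f.coeff n = -1) (h0 : seriesVal z (fun n => f.coeff n) = 0)
    (hT : TaylorConditions f l p z) {n : ℕ} (hn : n < p) :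
    1 / (1 - ‖z‖) < ‖tailVal z (fun n => f.coeff n) (l + 1 + n + 1)‖
      + ‖tailVal z (fun n => f.coeff n) (l + 1 + n + 1) - 1‖ := by
  have h := (hT n hn).2.1
  rw [aeval_taylorPoly_eq hz hc h0, aeval_taylorPoly_eq_sub_one hz hc h0, norm_neg, norm_neg,
    norm_mul, norm_mul, norm_mul, norm_mul, norm_sign hc, one_mul, ← mul_add, gt_iff_lt,
    ← mul_one_div] at h
  exact lt_of_mul_lt_mul_left h (norm_nonneg _)

theorem re_tailVal_gt (hz : ‖z‖ < 1)
    (hc : ∀ n, f.coeff n = 1 ∨ f.coeff n = -1) (h0 : seriesVal z (fun n => f.coeff n) = 0)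
    (hT : TaylorConditions f l p z) {n : ℕ} (hn : n < p) :
    3 / 4 < (tailVal z (fun n => f.coeff n) (l + 1 + n)).re := by
  set m := l + 1 + n with hm
  set σ := tailVal z (fun n => f.coeff n) m with hσ
  set R : Polynomial ℤ :=
    ∑ i ∈ Finset.range (n + 1), Polynomial.monomial i (f.coeff (l + 1 + i)) with hR
  have hRc : ∀ i, R.coeff i = if i < n + 1 then f.coeff (l + 1 + i) else 0 := fun i => by
    rw [hR, Polynomial.finsetSum_coeff]
    simp only [Polynomial.coeff_monomial, Finset.sum_ite_eq', Finset.mem_range]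
  have hadd : taylorPoly f m = taylorPoly f l + Polynomial.X ^ (l + 1) * R := taylorPoly_add f l n
  set P : Polynomial ℤ := 2 * R - Polynomial.monomial n (f.coeff m) with hP
  have hPc : ∀ i, P.coeff i = 2 * R.coeff i - if n = i then f.coeff m else 0 := fun i => by
    rw [hP, Polynomial.coeff_sub, Polynomial.coeff_ofNat_mul, Polynomial.coeff_monomial]
  have h := (hT n hn).2.2 (2 * R) (by rw [← hm, hadd]; ring) P
    (by
      rw [Polynomial.natDegree_le_iff_coeff_eq_zero]
      intro i hi
      rw [hPc, hRc, if_neg (by omega), if_neg (by omega)]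
      rfl)
    (fun i => by
      rw [hPc, hRc]
      by_cases hi : n = i
      · subst hi
        rw [if_pos (by omega), if_pos rfl]
        rcases hc m with h | h <;> rw [← hm, h] <;> simp
      · rw [if_neg hi]
        split_ifs
        · rcases hc (l + 1 + i) with h | h <;> rw [h] <;> simp
        · simp)
    (fun he => by
      have := congrArg (fun q => Polynomial.coeff q n) he
      simp only [hP, Polynomial.coeff_sub, Polynomial.coeff_monomial, if_true] at this
      rcases hc m with h | h <;> omega)
  have e1 : 2 * Polynomial.aeval z (taylorPoly f l) + z ^ (l + 1) * Polynomial.aeval z P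
      = f.coeff m * z ^ m * (1 - 2 * σ) := by
    have e2 := aeval_taylorPoly_eq_sub_one hz hc h0 m
    have e3 := congrArg (Polynomial.aeval z) hadd
    rw [e2] at e3
    simp only [map_add, map_mul, map_pow, Polynomial.aeval_X] at e3
    rw [hP, map_sub, map_mul, Polynomial.aeval_monomial]
    have e4 : z ^ m = z ^ (l + 1) * z ^ n := by rw [hm, pow_add]
    simp only [map_ofNat, algebraMap_int_eq, eq_intCast]
    linear_combination -2 * e3 + (f.coeff m : ℂ) * e4
  rw [← hm, e1, aeval_taylorPoly_eq_sub_one hz hc h0, norm_neg, norm_mul, norm_mul, norm_mul,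
    norm_mul, norm_sign hc, one_mul, mul_left_comm] at h
  have h' := lt_of_mul_lt_mul_left h (norm_nonneg _)
  have h2 : (2 * ‖σ - 1‖) ^ 2 < ‖1 - 2 * σ‖ ^ 2 := by
    gcongr
  rw [mul_pow, Complex.sq_norm, Complex.sq_norm, Complex.normSq_apply, Complex.normSq_apply] at h2
  simp at h2
  nlinarith

theorem tailVal_mem_orbitPoints (hz : ‖z‖ < 1)
    (hc : ∀ n, f.coeff n = 1 ∨ f.coeff n = -1) (h0 : seriesVal z (fun n => f.coeff n) = 0)
    (hper : HasRationalForm f l p) (hT : TaylorConditions f l p z) {q : ℕ} (hq : l + 2 ≤ q) :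
    tailVal z (fun n => f.coeff n) q ∈ orbitPoints z := by
  set c : ℕ → ℤ := fun n => f.coeff n with hcdef
  have hre : ∀ m, l < m → 3 / 4 < (tailVal z c m).re :=
    forall_of_periodic hper.1 (fun n hn => re_tailVal_gt hz hc h0 hT hn)
      fun m hm h => by rwa [tailVal_add_period hper hm]
  have hsum : ∀ m, l < m → 1 / (1 - ‖z‖) < ‖tailVal z c (m + 1)‖ + ‖tailVal z c (m + 1) - 1‖ :=
    forall_of_periodic hper.1 (fun n hn => norm_add_norm_sub_one_gt hz hc h0 hT hn)
      fun m hm h => by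
        rwa [show m + p + 1 = m + 1 + p by ring, tailVal_add_period hper (by omega)]
  refine ⟨fun k => tailVal z c (q + k), rfl, fun k => ⟨⟨?_, (hre _ (by omega)).le⟩,
    norm_tailVal_le hz hc _, ?_⟩⟩
  · have := hsum (q + k - 1) (by omega)
    rwa [Nat.sub_add_cancel (by omega)] at this
  · have h := tailVal_eq_succ hz hc (q + k)
    change tailVal z c (q + k) = 1 + z * tailVal z c (q + k + 1) ∨
      tailVal z c (q + k) = 1 - z * tailVal z c (q + k + 1)
    rw [h]
    rcases hc (q + k) with h1 | h1 <;> rcases hc (q + k + 1) with h2 | h2 <;>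
      simp [hcdef, h1, h2, sub_eq_add_neg]

theorem half_le_norm (hz : ‖z‖ < 1) {c : ℕ → ℤ} (hc : ∀ n, c n = 1 ∨ c n = -1)
    (h0 : seriesVal z c = 0) : 1 / 2 ≤ ‖z‖ := by
  rw [seriesVal_eq_tailVal hz hc 1] at h0
  have h1 : ‖z‖ * ‖tailVal z c 1‖ = 1 := by
    have := norm_sign hc 0
    rw [← this, ← norm_neg (c 0 : ℂ)]
    have e : -(c 0 : ℂ) = c 1 * z * tailVal z c 1 := by
      simp at h0
      linear_combination -h0
    rw [e, norm_mul, norm_mul, norm_sign hc, one_mul]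
  have h2 := norm_tailVal_le hz hc 1
  have h3 : ‖z‖ * (1 / (1 - ‖z‖)) ≥ 1 :=
    h1.symm.le.trans (mul_le_mul_of_nonneg_left h2 (norm_nonneg z))
  rw [mul_one_div, ge_iff_le, le_div_iff₀ (by linarith)] at h3
  linarith

end Conditions

theorem zonoidSupport_smul (z u : ℂ) {a : ℝ} (ha : 0 ≤ a) :
    zonoidSupport z (a * u) = a * zonoidSupport z u := by
  unfold zonoidSupport
  rw [← tsum_mul_left]
  congr 1; funext k
  rw [map_mul, conj_ofReal, mul_assoc, re_ofReal_mul, abs_mul, abs_of_nonneg ha]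

/-- A quantitative form of `BoxCheck.Separated`, with directions of modulus at most one. -/
def SeparatedBy (z : ℂ) (t ε : ℝ) (σ : ℂ) : Prop :=
  (∃ u : ℂ, ‖u‖ ≤ 1 ∧
    (2 + t) * (zonoidSupport z u - (conj u * (σ - 1)).re) + ε ≤ 2 * u.re) ∧
  ∃ u : ℂ, ‖u‖ ≤ 1 ∧ 0 ≤ u.re ∧ zonoidSupport z u + ε ≤ (1 + t) * (conj u * (σ - 1)).re

theorem SeparatedBy.mono {z σ : ℂ} {t ε ε' : ℝ} (h : SeparatedBy z t ε σ) (hε : ε' ≤ ε) :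
    SeparatedBy z t ε' σ := by
  obtain ⟨⟨u, h1, h2⟩, v, h3, h4, h5⟩ := h
  exact ⟨⟨u, h1, by linarith⟩, v, h3, h4, by linarith⟩

theorem exists_norm_le_one_smul (u : ℂ) : ∃ a : ℝ, 0 < a ∧ ‖(a : ℂ) * u‖ ≤ 1 := by
  have h := norm_nonneg u
  refine ⟨1 / (1 + ‖u‖), by positivity, ?_⟩
  rw [norm_mul, norm_real, Real.norm_of_nonneg (by positivity), one_div,
    inv_mul_le_iff₀ (by positivity)]
  linarith

theorem BoxCheck.Separated.exists_separatedBy {z σ : ℂ} {t : ℝ} (h : BoxCheck.Separated z t σ) :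
    ∃ ε > 0, SeparatedBy z t ε σ := by
  obtain ⟨⟨u, h1⟩, v, h2, h3⟩ := h
  obtain ⟨a, ha, ha'⟩ := exists_norm_le_one_smul u
  obtain ⟨b, hb, hb'⟩ := exists_norm_le_one_smul v
  have hre : ∀ (a : ℝ) (u : ℂ), (conj ((a : ℂ) * u) * (σ - 1)).re = a * (conj u * (σ - 1)).re :=
    fun a u => by rw [map_mul, conj_ofReal, mul_assoc, re_ofReal_mul]
  refine ⟨min (a * (2 * u.re - (2 + t) * (zonoidSupport z u - (conj u * (σ - 1)).re)))
    (b * ((1 + t) * (conj v * (σ - 1)).re - zonoidSupport z v)),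
    lt_min (mul_pos ha (by linarith)) (mul_pos hb (by linarith)),
    ⟨a * u, ha', ?_⟩, b * v, hb', ?_, ?_⟩
  · rw [hre, zonoidSupport_smul z u ha.le, re_ofReal_mul]
    refine (add_le_add_right (min_le_left _ _) _).trans (le_of_eq ?_)
    ring
  · rw [re_ofReal_mul]; positivity
  · rw [hre, zonoidSupport_smul z v hb.le]
    refine (add_le_add_right (min_le_right _ _) _).trans (le_of_eq ?_)
    ring

theorem exists_uniform_separatedBy {z : ℂ} {f : ℤ⟦X⟧} {l p : ℕ} (hz : ‖z‖ < 1)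
    (hz2 : ‖z‖ ^ 2 ≤ 1 / 2) (hc : ∀ n, f.coeff n = 1 ∨ f.coeff n = -1) (hc0 : f.coeff 0 = 1)
    (h0 : seriesVal z (fun n => f.coeff n) = 0) (hper : HasRationalForm f l p)
    (hT : TaylorConditions f l p z) :
    ∃ t > 0, ∃ ε > 0, ∀ q, l + 2 ≤ q → SeparatedBy z t ε (tailVal z (fun n => f.coeff n) q) := by
  have hhalf := half_le_norm hz hc h0
  obtain ⟨t, ht, hsep⟩ := BoxCheck.exists_separated hhalf hz2 ⟨fun n => f.coeff n, hc, hc0, h0⟩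
  have hall : ∀ n : ℕ, ∃ ε > 0, ∀ k < n,
      SeparatedBy z t ε (tailVal z (fun n => f.coeff n) (l + 1 + 1 + k)) := by
    intro n
    induction n with
    | zero => exact ⟨1, one_pos, fun k hk => absurd hk (by omega)⟩
    | succ n ih =>
      obtain ⟨ε, hε, h⟩ := ih
      obtain ⟨ε', hε', h'⟩ := (hsep _ (tailVal_mem_orbitPoints hz hc h0 hper hT
        (q := l + 1 + 1 + n) (by omega))).exists_separatedBy
      refine ⟨min ε ε', lt_min hε hε', fun k hk => ?_⟩
      rcases Nat.lt_succ_iff_lt_or_eq.1 hk with hk | rfl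
      · exact (h k hk).mono (min_le_left _ _)
      · exact h'.mono (min_le_right _ _)
  obtain ⟨ε, hε, h⟩ := hall p
  refine ⟨t, ht, ε, hε, fun q hq => ?_⟩
  exact forall_of_periodic (P := fun q => SeparatedBy z t ε (tailVal z (fun n => f.coeff n) q))
    (l := l + 1) hper.1 h (fun m hm hm' => by rwa [tailVal_add_period hper (by omega)]) q
    (by omega)

/-- The value at `w` of the power series with complex coefficients `a`. -/
noncomputable def powerSum (w : ℂ) (a : ℕ → ℂ) : ℂ := ∑' n, a n * w ^ n

theorem summable_powerSum {w : ℂ} (hw : ‖w‖ < 1) {a : ℕ → ℂ} {C : ℝ} (ha : ∀ n, ‖a n‖ ≤ C) :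
    Summable fun n => a n * w ^ n := by
  refine Summable.of_norm_bounded ((summable_geometric_of_lt_one (norm_nonneg w) hw).mul_left C)
    fun n => ?_
  rw [norm_mul, norm_pow]
  gcongr
  exact ha n

theorem norm_powerSum_le {w : ℂ} (hw : ‖w‖ < 1) {a : ℕ → ℂ} {C : ℝ} (ha : ∀ n, ‖a n‖ ≤ C) :
    ‖powerSum w a‖ ≤ C * (1 - ‖w‖)⁻¹ := by
  refine tsum_of_norm_bounded ((hasSum_geometric_of_lt_one (norm_nonneg w) hw).mul_left C)
    fun n => ?_
  rw [norm_mul, norm_pow]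
  gcongr
  exact ha n

theorem norm_powerSum_sub_le {z w : ℂ} (hz : ‖z‖ < 1) (hw : ‖w‖ < 1) {a : ℕ → ℂ} {C : ℝ}
    (ha : ∀ n, ‖a n‖ ≤ C) : ‖powerSum w a - powerSum z a‖ ≤ C * powDist z w := by
  unfold powerSum powDist
  rw [← (summable_powerSum hw ha).tsum_sub (summable_powerSum hz ha), ← tsum_mul_left]
  refine tsum_of_norm_bounded ((summable_powDist hz hw).mul_left C).hasSum fun n => ?_
  rw [← mul_sub, norm_mul]
  exact mul_le_mul_of_nonneg_right (ha n) (norm_nonneg _)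

theorem powerSum_add {w : ℂ} (hw : ‖w‖ < 1) {a b : ℕ → ℂ} {C D : ℝ} (ha : ∀ n, ‖a n‖ ≤ C)
    (hb : ∀ n, ‖b n‖ ≤ D) : powerSum w (fun n => a n + b n) = powerSum w a + powerSum w b := by
  unfold powerSum
  rw [← (summable_powerSum hw ha).tsum_add (summable_powerSum hw hb)]
  congr 1; funext n; ring

theorem powerSum_mul_left (w s : ℂ) (a : ℕ → ℂ) :
    powerSum w (fun n => s * a n) = s * powerSum w a := by
  unfold powerSum
  rw [← tsum_mul_left]
  congr 1; funext n; ring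

theorem powerSum_shift {w : ℂ} (hw : ‖w‖ < 1) {a : ℕ → ℂ} {C : ℝ} (ha : ∀ n, ‖a n‖ ≤ C) {q : ℕ}
    (h : ∀ j < q, a j = 0) : powerSum w a = w ^ q * powerSum w fun k => a (q + k) := by
  unfold powerSum
  rw [← (summable_powerSum hw ha).sum_add_tsum_nat_add q, ← tsum_mul_left,
    Finset.sum_eq_zero fun j hj => by rw [h j (Finset.mem_range.1 hj), zero_mul], zero_add]
  congr 1; funext k; rw [add_comm k q, pow_add]; ring

/-- The separation inequalities bound from below the sums whose relative digits `b k` lie in the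
relevant range. -/
theorem lower_bound_of_separatedBy {z : ℂ} (hz : ‖z‖ < 1) {c : ℕ → ℤ}
    (hc : ∀ n, c n = 1 ∨ c n = -1) {q : ℕ} {t ε : ℝ} (ht : 0 < t) (hε : 0 < ε)
    (hsep : SeparatedBy z t ε (tailVal z c q)) {b : ℕ → ℝ} (h0 : ∀ k, 0 ≤ b k)
    (h2 : ∀ k, b k ≤ 2 + t) (hb : 1 ≤ b 0 ∨ ∀ k, t ≤ b (k + 1)) :
    ε / 2 ≤ ‖powerSum z fun k => b k * (c q * c (q + k))‖ := by
  have hcc : ∀ k, ‖(c q : ℂ) * c (q + k)‖ = 1 := fun k => by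
    rw [norm_mul, norm_sign hc, norm_sign hc, one_mul]
  have hnorm : ∀ k, ‖(b k : ℂ) * (c q * c (q + k))‖ ≤ 2 + t := fun k => by
    rw [norm_mul, hcc, mul_one, norm_real, Real.norm_of_nonneg (h0 k)]; exact h2 k
  set x : ℂ → ℕ → ℝ := fun u k => c q * c (q + (k + 1)) * (conj u * z ^ (k + 1)).re with hx
  have habs : ∀ u k, |x u k| = |(conj u * z ^ (k + 1)).re| := fun u k => by
    have : |((c q * c (q + (k + 1)) : ℤ) : ℝ)| = 1 := by
      rcases hc q with h | h <;> rcases hc (q + (k + 1)) with h' | h' <;> simp [h, h']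
    push_cast at this
    rw [hx]; beta_reduce
    rw [abs_mul, this, one_mul]
  have hsx : ∀ u, Summable fun k => |x u k| := fun u => by
    simp only [habs]; exact BoxCheck.summable_zonoid hz u
  have hH : ∀ u, ∑' k, |x u k| = zonoidSupport z u := fun u => by
    simp only [habs]; rfl
  have hexp : ∀ (u : ℂ) (b : ℕ → ℝ), (∀ k, ‖(b k : ℂ) * (c q * c (q + k))‖ ≤ 2 + t) →
      HasSum (fun k => b (k + 1) * x u k)
        ((conj u * powerSum z fun k => b k * (c q * c (q + k))).re - b 0 * u.re) := by
    intro u b hb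
    have hs := (summable_powerSum hz hb).hasSum
    have h1 := (hasSum_nat_add_iff' 1).2 ((hs.mul_left (conj u)).mapL reCLM)
    have hq := coeff_mul_self_complex hc q
    have e1 : (fun k => b (k + 1) * x u k) = fun k =>
        reCLM (conj u * (b (k + 1) * (c q * c (q + (k + 1))) * z ^ (k + 1))) := by
      funext k
      rw [hx, reCLM_apply]; beta_reduce
      have : conj u * ((b (k + 1) : ℂ) * (c q * c (q + (k + 1))) * z ^ (k + 1))
          = ((b (k + 1) * (c q * c (q + (k + 1))) : ℝ) : ℂ) * (conj u * z ^ (k + 1)) := by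
        push_cast; ring
      rw [this, re_ofReal_mul]; ring
    rw [e1]
    rw [Finset.sum_range_one, reCLM_apply, reCLM_apply, add_zero, hq, pow_zero, mul_one, mul_one,
      mul_comm (conj u) (b 0 : ℂ), re_ofReal_mul, conj_re] at h1
    exact h1
  have htail : ∀ u, HasSum (x u) (conj u * (tailVal z c q - 1)).re := by
    intro u
    have := hexp u (fun _ => 1) fun k => by rw [norm_mul, hcc]; simp; linarith
    simp only [one_mul, ofReal_one] at this
    rw [mul_sub, sub_re, mul_one, conj_re]
    convert this using 3
    · unfold tailVal seriesVal powerSum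
      congr 2; funext n; push_cast; ring
  have hle : ∀ u : ℂ, ‖u‖ ≤ 1 → (conj u * powerSum z fun k => b k * (c q * c (q + k))).re
      ≤ ‖powerSum z fun k => b k * (c q * c (q + k))‖ := fun u hu => by
    refine (re_le_norm _).trans ?_
    rw [norm_mul, norm_conj]
    exact mul_le_of_le_one_left (norm_nonneg _) hu
  rcases hb with hb | hb
  · obtain ⟨⟨u, hu, h⟩, -⟩ := hsep
    refine le_trans ?_ (hle u hu)
    have hlow : HasSum (fun k => -((2 + t) / 2) * (|x u k| - x u k))
        (-((2 + t) / 2) * (zonoidSupport z u - (conj u * (tailVal z c q - 1)).re)) := by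
      rw [← hH]
      exact ((hsx u).hasSum.sub (htail u)).mul_left _
    have h3 := hasSum_le (fun k => ?_) hlow (hexp u b hnorm)
    · have h4 : (conj u * (tailVal z c q - 1)).re ≤ zonoidSupport z u := by
        rw [← hH]; exact hasSum_le (fun k => le_abs_self _) (htail u) (hsx u).hasSum
      have h5 : 0 ≤ u.re := by nlinarith
      nlinarith
    · have h5 := h0 (k + 1)
      have h6 := h2 (k + 1)
      rcases le_total 0 (x u k) with h7 | h7
      · rw [abs_of_nonneg h7, sub_self, mul_zero]; positivity
      · rw [abs_of_nonpos h7]; nlinarith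
  · obtain ⟨-, u, hu, hre, h⟩ := hsep
    refine le_trans ?_ (hle u hu)
    have hlow : HasSum (fun k => (1 + t) * x u k - |x u k|)
        ((1 + t) * (conj u * (tailVal z c q - 1)).re - zonoidSupport z u) := by
      rw [← hH]
      exact ((htail u).mul_left _).sub (hsx u).hasSum
    have h3 := hasSum_le (fun k => ?_) hlow (hexp u b hnorm)
    · have := mul_nonneg (h0 0) hre
      linarith
    · have h5 := hb k
      have h6 := h2 (k + 1)
      rcases le_total 0 (x u k) with h7 | h7
      · rw [abs_of_nonneg h7]; nlinarith
      · rw [abs_of_nonpos h7]; nlinarith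

/-- Coefficients which vanish up to the index `τ` and are equal to `t` from the index `τ + 1` on. -/
noncomputable def rampDigit (t τ : ℝ) (j : ℕ) : ℝ := t * min 1 (max 0 (j - τ))

/-- The series with the coefficients `c j`, multiplied by `rampDigit t τ j`. -/
noncomputable def rampVal (z : ℂ) (c : ℕ → ℤ) (t τ : ℝ) : ℂ :=
  powerSum z fun j => rampDigit t τ j * c j

theorem rampDigit_nonneg {t : ℝ} (ht : 0 < t) (τ : ℝ) (j : ℕ) : 0 ≤ rampDigit t τ j := by
  unfold rampDigit; positivity

theorem rampDigit_le {t : ℝ} (ht : 0 < t) (τ : ℝ) (j : ℕ) : rampDigit t τ j ≤ t :=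
  mul_le_of_le_one_right ht.le (min_le_left _ _)

theorem rampDigit_eq_zero (t : ℝ) {τ : ℝ} {j : ℕ} (h : (j : ℝ) ≤ τ) : rampDigit t τ j = 0 := by
  unfold rampDigit
  rw [max_eq_left (by linarith), min_eq_right zero_le_one, mul_zero]

theorem rampDigit_eq (t : ℝ) {τ : ℝ} {j : ℕ} (h : τ + 1 ≤ j) : rampDigit t τ j = t := by
  unfold rampDigit
  rw [min_eq_left (le_max_of_le_right (by linarith)), mul_one]

section RampVal

variable {z : ℂ} {c : ℕ → ℤ} {t : ℝ}

theorem norm_rampDigit_mul_le (hc : ∀ n, c n = 1 ∨ c n = -1) (ht : 0 < t) (τ : ℝ) (j : ℕ) :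
    ‖(rampDigit t τ j : ℂ) * c j‖ ≤ t := by
  rw [norm_mul, norm_sign hc, mul_one, norm_real, Real.norm_of_nonneg (rampDigit_nonneg ht τ j)]
  exact rampDigit_le ht τ j

theorem continuous_rampVal (hz : ‖z‖ < 1) (hc : ∀ n, c n = 1 ∨ c n = -1) (ht : 0 < t) :
    Continuous (rampVal z c t) := by
  unfold rampVal powerSum
  refine continuous_tsum (u := fun n => t * ‖z‖ ^ n) (fun n => ?_)
    ((summable_geometric_of_lt_one (norm_nonneg z) hz).mul_left t) fun n τ => ?_
  · unfold rampDigit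
    fun_prop
  · rw [norm_mul, norm_pow]
    gcongr
    exact norm_rampDigit_mul_le hc ht τ n

theorem rampVal_shift (hz : ‖z‖ < 1) (hc : ∀ n, c n = 1 ∨ c n = -1) (ht : 0 < t) {τ : ℝ} {q : ℕ}
    (hq : (q : ℝ) ≤ τ + 1) :
    rampVal z c t τ
      = c q * z ^ q * powerSum z fun k => rampDigit t τ (q + k) * (c q * c (q + k)) := by
  unfold rampVal
  rw [powerSum_shift hz (norm_rampDigit_mul_le hc ht τ) (q := q) fun j hj => by
    rw [rampDigit_eq_zero t, ofReal_zero, zero_mul]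
    have : (j : ℝ) + 1 ≤ q := by exact_mod_cast hj
    linarith]
  rw [mul_right_comm, ← powerSum_mul_left z (c q : ℂ), mul_comm]
  congr 2; funext k
  have := coeff_mul_self_complex hc q
  linear_combination (-(rampDigit t τ (q + k) : ℂ) * c (q + k)) * this

theorem norm_rampVal_le (hz : ‖z‖ < 1) (hc : ∀ n, c n = 1 ∨ c n = -1) (ht : 0 < t) {τ : ℝ}
    {q : ℕ} (hq : (q : ℝ) ≤ τ + 1) : ‖rampVal z c t τ‖ ≤ t * (1 - ‖z‖)⁻¹ * ‖z‖ ^ q := by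
  rw [rampVal_shift hz hc ht hq, norm_mul, norm_mul, norm_sign hc, one_mul, norm_pow, mul_comm]
  gcongr
  refine norm_powerSum_le hz fun k => ?_
  rw [norm_mul, ← Int.cast_mul]
  refine (mul_le_of_le_one_right (norm_nonneg _) (norm_sign_mul_le hc _ _)).trans ?_
  rw [norm_real, Real.norm_of_nonneg (rampDigit_nonneg ht _ _)]
  exact rampDigit_le ht _ _

theorem rampVal_ne_zero (hz : ‖z‖ < 1) (hz0 : z ≠ 0) (hc : ∀ n, c n = 1 ∨ c n = -1) (ht : 0 < t)
    {ε : ℝ} (hε : 0 < ε) {N : ℕ} (hsep : ∀ q, N ≤ q → SeparatedBy z t ε (tailVal z c q)) {τ : ℝ}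
    (hτ : N ≤ τ) : rampVal z c t τ ≠ 0 := by
  have hτ0 : 0 ≤ τ := (Nat.cast_nonneg N).trans hτ
  have h1 := Nat.floor_le hτ0
  have h2 := Nat.lt_floor_add_one τ
  have h3 := Nat.le_floor hτ
  have h4 := lower_bound_of_separatedBy hz hc ht hε (hsep (⌊τ⌋₊ + 1) (by omega))
    (b := fun k => rampDigit t τ (⌊τ⌋₊ + 1 + k)) (fun k => rampDigit_nonneg ht _ _)
    (fun k => (rampDigit_le ht _ _).trans (by linarith)) (Or.inr fun k => (rampDigit_eq t (by
      push_cast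
      have : (0 : ℝ) ≤ k := Nat.cast_nonneg k
      linarith)).ge)
  rw [rampVal_shift hz hc ht (q := ⌊τ⌋₊ + 1) (by push_cast; linarith)]
  refine mul_ne_zero (mul_ne_zero ?_ (pow_ne_zero _ hz0)) fun h => ?_
  · rw [← norm_ne_zero_iff, norm_sign hc]; exact one_ne_zero
  · rw [h, norm_zero] at h4
    linarith

/-- Parameters at which the series `f` takes the value `-G * rampVal z c t τ` with `G` close to one
are not zeros of any series with coefficients `-1, 0, 1` that shares a long initial segment with
`f`. -/
theorem vanishingSeries_eq_empty (hz : ‖z‖ < 1) {f : ℤ⟦X⟧}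
    (hc : ∀ n, f.coeff n = 1 ∨ f.coeff n = -1) (ht : 0 < t)
    {ε : ℝ} (hε : 0 < ε) {N : ℕ}
    (hsep : ∀ q, N ≤ q → SeparatedBy z t ε (tailVal z (fun n => f.coeff n) q)) {τ : ℝ}
    (hτ : N ≤ τ) {w G : ℂ} (hw : ‖w‖ < 1) (hw0 : w ≠ 0)
    (hagree : ∀ g ∈ vanishingSeries w, ∀ j < N, g.coeff j = f.coeff j)
    (hfw0 : seriesVal w (fun n => f.coeff n) ≠ 0)
    (hfw : seriesVal w (fun n => f.coeff n) = -(G * rampVal z (fun n => f.coeff n) t τ))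
    (hG : ∀ q : ℕ, (q : ℝ) ≤ τ + 1 →
      2 * powDist z w + t * (1 - ‖z‖)⁻¹ * ‖G * (z / w) ^ q - 1‖ < ε / 2) :
    vanishingSeries w = ∅ := by
  rw [Set.eq_empty_iff_forall_notMem]
  intro g hg
  set c : ℕ → ℤ := fun n => f.coeff n with hcdef
  set δ : ℕ → ℤ := fun n => 1 - c n * g.coeff n with hδ
  have hδ0 : ∀ j, 0 ≤ δ j := fun j => by
    rcases hc j with h | h <;> rcases hg.1.1 j with h' | h' | h' <;> simp [hδ, hcdef, h, h']
  have hδ2 : ∀ j, δ j ≤ 2 := fun j => by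
    rcases hc j with h | h <;> rcases hg.1.1 j with h' | h' | h' <;> simp [hδ, hcdef, h, h']
  have hδc : ∀ j, δ j * c j = c j - g.coeff j := fun j => by
    have := coeff_mul_self hc j
    simp only [hδ]
    linear_combination (-g.coeff j) * this
  have hδ1 : ∀ j, g.coeff j ≠ f.coeff j → 1 ≤ δ j := fun j hj => by
    rcases hc j with h | h <;> rcases hg.1.1 j with h' | h' | h' <;> simp_all
  have hδn : ∀ j m n, ‖(δ j : ℂ) * (c m * c n)‖ ≤ 2 := fun j m n => by
    rw [norm_mul, ← Int.cast_mul (c m)]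
    refine (mul_le_of_le_one_right (norm_nonneg _) (norm_sign_mul_le hc _ _)).trans ?_
    rw [Complex.norm_intCast, abs_of_nonneg (by exact_mod_cast hδ0 j)]
    exact_mod_cast hδ2 j
  have hfδ : seriesVal w c = powerSum w fun j => δ j * c j := by
    have h1 : seriesVal w (fun n => g.coeff n) = 0 := hg.2
    rw [← sub_zero (seriesVal w c), ← h1]
    unfold seriesVal powerSum
    rw [← (summable_series hw fun n => (norm_sign hc n).le).tsum_sub
      (summable_series hw fun n => norm_le_one_of_mem (hg.1.1 n))]
    congr 1; funext n
    have := hδc n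
    beta_reduce
    rw [← sub_mul, ← Int.cast_mul, this, Int.cast_sub]
  have hex : ∃ j, g.coeff j ≠ f.coeff j := by
    by_contra! h
    refine hfw0 ?_
    have h1 : seriesVal w (fun n => g.coeff n) = 0 := hg.2
    simpa only [h] using h1
  classical
  set q₀ := Nat.find hex with hq₀
  have hq₀N : N ≤ q₀ := by
    by_contra! h
    exact Nat.find_spec hex (hagree g hg _ h)
  have hτ0 : 0 ≤ τ := (Nat.cast_nonneg N).trans hτ
  have h1 := Nat.floor_le hτ0
  have h2 := Nat.lt_floor_add_one τ
  have h3 := Nat.le_floor hτ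
  set q := min q₀ (⌊τ⌋₊ + 1) with hq
  have hqN : N ≤ q := le_min hq₀N (by omega)
  have hqτ : (q : ℝ) ≤ τ + 1 := by
    have : (q : ℝ) ≤ (⌊τ⌋₊ + 1 : ℕ) := by exact_mod_cast min_le_right _ _
    push_cast at this
    linarith
  have hδq : ∀ j < q, δ j = 0 := fun j hj => by
    have : g.coeff j = f.coeff j := by
      by_contra h
      exact absurd (Nat.find_min' hex h) (not_le.2 (hj.trans_le (min_le_left _ _)))
    simp only [hδ, this]
    have := coeff_mul_self hc j
    simp only [hcdef]
    omega
  set A := powerSum z fun k => δ (q + k) * (c q * c (q + k)) with hA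
  set A' := powerSum w fun k => δ (q + k) * (c q * c (q + k)) with hA'
  set B := powerSum z fun k => rampDigit t τ (q + k) * (c q * c (q + k)) with hB
  have hBn : ∀ k, ‖(rampDigit t τ (q + k) : ℂ) * (c q * c (q + k))‖ ≤ t := fun k => by
    rw [norm_mul, ← Int.cast_mul]
    refine (mul_le_of_le_one_right (norm_nonneg _) (norm_sign_mul_le hc _ _)).trans ?_
    rw [norm_real, Real.norm_of_nonneg (rampDigit_nonneg ht _ _)]
    exact rampDigit_le ht _ _
  have hcq : (c q : ℂ) ≠ 0 := by rw [← norm_ne_zero_iff, norm_sign hc]; exact one_ne_zero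
  have hAeq : seriesVal w c = c q * w ^ q * A' := by
    rw [hfδ, powerSum_shift hw (C := 2) (q := q), mul_right_comm, hA',
      ← powerSum_mul_left w (c q : ℂ), mul_comm]
    · congr 2; funext k
      have := coeff_mul_self_complex hc q
      linear_combination (-(δ (q + k) : ℂ) * c (q + k)) * this
    · intro n
      rw [norm_mul, norm_sign hc, mul_one, Complex.norm_intCast,
        abs_of_nonneg (by exact_mod_cast hδ0 n)]
      exact_mod_cast hδ2 n
    · intro j hj
      rw [hδq j hj]; simp
  have hrel : A' = -(G * (z / w) ^ q * B) := by
    rw [hAeq, rampVal_shift hz hc ht hqτ, ← hB] at hfw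
    have hwq : w ^ q ≠ 0 := pow_ne_zero _ hw0
    have h4 : w ^ q * A' = -(G * z ^ q * B) :=
      mul_left_cancel₀ hcq (by linear_combination hfw)
    rw [div_pow]
    field_simp
    linear_combination h4
  have hlow := lower_bound_of_separatedBy hz hc ht hε (hsep q hqN)
    (b := fun k => δ (q + k) + rampDigit t τ (q + k))
    (fun k => add_nonneg (by exact_mod_cast hδ0 _) (rampDigit_nonneg ht _ _))
    (fun k => add_le_add (by exact_mod_cast hδ2 _) (rampDigit_le ht _ _)) (by
      rcases le_total q₀ (⌊τ⌋₊ + 1) with h | h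
      · left
        have e : q = q₀ := min_eq_left h
        have h4 : (1 : ℝ) ≤ δ q := by
          rw [e]; exact_mod_cast hδ1 _ (Nat.find_spec hex)
        have := rampDigit_nonneg ht τ (q + 0)
        rw [add_zero] at *
        linarith
      · right
        intro k
        have e : q = ⌊τ⌋₊ + 1 := min_eq_right h
        have h4 : (0 : ℝ) ≤ δ (q + (k + 1)) := by exact_mod_cast hδ0 _
        have h5 := rampDigit_eq t (τ := τ) (j := q + (k + 1)) (by
          rw [e]; push_cast
          have : (0 : ℝ) ≤ k := Nat.cast_nonneg k
          linarith)
        linarith)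
  have hsplit : (powerSum z fun k =>
      ((δ (q + k) + rampDigit t τ (q + k) : ℝ) : ℂ) * (c q * c (q + k))) = A + B := by
    rw [hA, hB, ← powerSum_add hz (fun n => hδn _ _ _) hBn]
    congr 1; funext k; push_cast; ring
  rw [hsplit] at hlow
  have h6 : A + B = -(A' - A) - (G * (z / w) ^ q - 1) * B := by
    linear_combination hrel
  have h7 : ‖A' - A‖ ≤ 2 * powDist z w := norm_powerSum_sub_le hz hw fun n => hδn _ _ _
  have h8 : ‖B‖ ≤ t * (1 - ‖z‖)⁻¹ := norm_powerSum_le hz hBn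
  have h9 : ‖A + B‖ ≤ ‖A' - A‖ + ‖G * (z / w) ^ q - 1‖ * ‖B‖ := by
    rw [h6, ← norm_mul, ← norm_neg (A' - A)]
    exact norm_sub_le _ _
  have h10 : ‖G * (z / w) ^ q - 1‖ * ‖B‖ ≤ t * (1 - ‖z‖)⁻¹ * ‖G * (z / w) ^ q - 1‖ := by
    rw [mul_comm]; gcongr
  have := hG q hqτ
  linarith

end RampVal

theorem exists_continuous_log {Y : ℝ → ℂ} (hY : Continuous Y) (h0 : ∀ τ, Y τ ≠ 0) :
    ∃ L : ℝ → ℂ, Continuous L ∧ ∀ τ, exp (L τ) = Y τ := by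
  obtain ⟨F, ⟨-, hF⟩, -⟩ := isCoveringMapOn_exp.existsUnique_continuousMap_lifts
    (⟨Y, hY⟩ : C(ℝ, ℂ)) (a₀ := 0) (e₀ := log (Y 0)) (exp_log (h0 0)) h0
  exact ⟨F, F.continuous, fun τ => congrFun hF τ⟩

theorem analyticAt_seriesVal {c : ℕ → ℤ} (hc : ∀ n, c n = 1 ∨ c n = -1) :
    AnalyticOnNhd ℂ (fun w => seriesVal w c) (Metric.ball 0 1) := by
  intro z hz
  rw [mem_ball_zero_iff] at hz
  obtain ⟨ρ, h1, h2⟩ := exists_between hz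
  have h0 : 0 ≤ ρ := (norm_nonneg z).trans h1.le
  have hd : DifferentiableOn ℂ (fun w => seriesVal w c) (Metric.ball 0 ρ) := by
    unfold seriesVal
    refine differentiableOn_tsum_of_summable_norm (u := fun n => ρ ^ n)
      (summable_geometric_of_lt_one h0 h2) (fun n => by fun_prop) Metric.isOpen_ball
      fun n w hw => ?_
    rw [mem_ball_zero_iff] at hw
    rw [norm_mul, norm_pow, norm_sign hc, one_mul]
    gcongr
  exact hd.analyticAt (Metric.isOpen_ball.mem_nhds (mem_ball_zero_iff.2 h1))

theorem exists_eventually_eq_pow_mul {z : ℂ} (hz : ‖z‖ < 1) {c : ℕ → ℤ}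
    (hc : ∀ n, c n = 1 ∨ c n = -1) (h0 : seriesVal z c = 0) :
    ∃ (d : ℕ) (g : ℂ → ℂ), d ≠ 0 ∧ ContinuousAt g z ∧ g z ≠ 0 ∧
      ∀ᶠ w in 𝓝 z, seriesVal w c = (w - z) ^ d * g w := by
  have han := analyticAt_seriesVal hc
  have hzb : z ∈ Metric.ball (0 : ℂ) 1 := mem_ball_zero_iff.2 hz
  have hne : ¬∀ᶠ w in 𝓝 z, seriesVal w c = 0 := fun h => by
    have h1 := han.eqOn_zero_of_preconnected_of_eventuallyEq_zero
      (convex_ball (0 : ℂ) 1).isPreconnected hzb h (Metric.mem_ball_self one_pos)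
    rw [Pi.zero_apply] at h1
    beta_reduce at h1
    rw [seriesVal_succ (by simp) fun n => (norm_sign hc n).le, zero_mul, add_zero] at h1
    have := norm_sign hc 0
    rw [h1, norm_zero] at this
    exact zero_ne_one this
  obtain ⟨d, g, hg, hgz, heq⟩ := (han z hzb).exists_eventuallyEq_pow_smul_nonzero_iff.2 hne
  refine ⟨d, g, ?_, hg.continuousAt, hgz, heq⟩
  rintro rfl
  have := heq.self_of_nhds
  rw [h0, pow_zero, one_smul] at this
  exact hgz this.symm

theorem norm_one_add_pow_sub_one_le_exp (x : ℂ) (n : ℕ) :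
    ‖(1 + x) ^ n - 1‖ ≤ Real.exp (n * ‖x‖) - 1 := by
  have h1 : ‖(1 + x) ^ n - 1‖ ≤ (1 + ‖x‖) ^ n - 1 := by
    induction n with
    | zero => simp
    | succ n ih =>
      have e : (1 + x) ^ (n + 1) - 1 = ((1 + x) ^ n - 1) + (1 + x) ^ n * x := by ring
      have h2 : ‖(1 + x) ^ n * x‖ ≤ (1 + ‖x‖) ^ n * ‖x‖ := by
        rw [norm_mul, norm_pow]
        gcongr
        simpa using norm_add_le (1 : ℂ) x
      rw [e]
      refine (norm_add_le _ _).trans ?_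
      rw [pow_succ]
      linarith
  refine h1.trans ?_
  rw [Real.exp_nat_mul]
  gcongr
  linarith [Real.add_one_le_exp ‖x‖]

/-- An analytic function takes the values of a decaying path near each of its zeros, along a path
that ends at the zero. -/
theorem exists_path_of_values {F g : ℂ → ℂ} {z : ℂ} {d : ℕ} (hd : d ≠ 0) (hg : ContinuousAt g z)
    (hgz : g z ≠ 0) (hF : ∀ᶠ w in 𝓝 z, F w = (w - z) ^ d * g w) {Y : ℝ → ℂ} (hY : Continuous Y)
    (hY0 : ∀ τ, Y τ ≠ 0) {C r : ℝ} (hr0 : 0 ≤ r) (hr1 : r < 1)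
    (hYr : ∀ᶠ τ in atTop, ‖Y τ‖ ≤ C * r ^ (⌊τ⌋₊ + 1)) :
    ∃ W G : ℝ → ℂ, Continuous W ∧ Tendsto W atTop (𝓝 z) ∧ Tendsto G atTop (𝓝 1) ∧
      Tendsto (fun τ => (τ + 1) * ‖W τ - z‖) atTop (𝓝 0) ∧
      ∀ᶠ τ in atTop, F (W τ) = -(G τ * Y τ) := by
  obtain ⟨L, hL, hLY⟩ := exists_continuous_log (Y := fun τ => -(Y τ / g z)) (by fun_prop)
    fun τ => neg_ne_zero.2 (div_ne_zero (hY0 τ) hgz)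
  have hpow : ∀ τ, exp (L τ / d) ^ d = -(Y τ / g z) := fun τ => by
    rw [← exp_nat_mul, mul_div_cancel₀ _ (Nat.cast_ne_zero.2 hd), hLY]
  have hfast : Tendsto (fun τ : ℝ => (τ + 1) * ‖exp (L τ / d)‖) atTop (𝓝 0) := by
    have hlim : Tendsto (fun τ : ℝ => 2 ^ d * (C / ‖g z‖) *
        (((⌊τ⌋₊ + 1 : ℕ) : ℝ) ^ d * r ^ (⌊τ⌋₊ + 1))) atTop (𝓝 0) := by
      have h := tendsto_pow_const_mul_const_pow_of_abs_lt_one d (r := r)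
        (by rwa [abs_of_nonneg hr0])
      have h2 := (h.comp
        ((tendsto_add_atTop_nat 1).comp (tendsto_nat_floor_atTop (α := ℝ)))).const_mul (2 ^ d * (C / ‖g z‖))
      rw [mul_zero] at h2
      exact h2
    rw [Metric.tendsto_nhds]
    intro η hη
    filter_upwards [hYr, hlim.eventually (gt_mem_nhds (pow_pos hη d)), eventually_ge_atTop 0]
      with τ h1 h2 h3
    rw [Real.dist_0_eq_abs, abs_of_nonneg (by positivity)]
    refine lt_of_pow_lt_pow_left₀ d hη.le (lt_of_le_of_lt ?_ h2)
    rw [mul_pow, ← norm_pow, hpow, norm_neg, norm_div]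
    have h4 := Nat.lt_floor_add_one τ
    have h5 : τ + 1 ≤ 2 * ((⌊τ⌋₊ + 1 : ℕ) : ℝ) := by
      push_cast
      have : (0 : ℝ) ≤ ⌊τ⌋₊ := Nat.cast_nonneg _
      linarith
    calc (τ + 1) ^ d * (‖Y τ‖ / ‖g z‖)
        ≤ (2 * ((⌊τ⌋₊ + 1 : ℕ) : ℝ)) ^ d * (C * r ^ (⌊τ⌋₊ + 1) / ‖g z‖) := by gcongr
      _ = _ := by rw [mul_pow]; ring
  have hexp0 : Tendsto (fun τ : ℝ => exp (L τ / d)) atTop (𝓝 0) := by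
    refine squeeze_zero_norm' ?_ hfast
    filter_upwards [eventually_ge_atTop 0] with τ hτ
    exact le_mul_of_one_le_left (norm_nonneg _) (by linarith)
  have hW : Tendsto (fun τ : ℝ => z + exp (L τ / d)) atTop (𝓝 z) := by
    simpa using hexp0.const_add z
  refine ⟨fun τ => z + exp (L τ / d), fun τ => g (z + exp (L τ / d)) / g z, by fun_prop, hW, ?_,
    ?_, ?_⟩
  · have := (hg.tendsto.comp hW).div_const (g z)
    rwa [div_self hgz] at this
  · simpa using hfast
  · filter_upwards [hW.eventually hF] with τ h
    rw [h, add_sub_cancel_left, hpow]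
    field_simp

theorem isPathAccessibleFrom_of_tendsto {V : Set ℂ} {z : ℂ} {W : ℝ → ℂ} (hW : Continuous W)
    (hlim : Tendsto W atTop (𝓝 z)) (hV : ∀ᶠ τ in atTop, W τ ∈ V) :
    ∃ U, IsComponentOf U V ∧ IsPathAccessibleFrom U z := by
  obtain ⟨M, hM⟩ := eventually_atTop.1 hV
  set γ : ℝ → ℂ := fun s => if s < 1 then W (M + (1 - s)⁻¹) else z with hγ
  have hlt : ∀ s < 1, γ s = W (M + (1 - s)⁻¹) := fun s hs => if_pos hs
  have hmem : ∀ s < 1, γ s ∈ V := fun s hs => by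
    rw [hlt s hs]
    exact hM _ (le_add_of_nonneg_right (inv_nonneg.2 (sub_nonneg.2 hs.le)))
  have hγ1 : γ 1 = z := if_neg (lt_irrefl _)
  have hcont : ∀ s < 1, ContinuousAt γ s := fun s hs => by
    have h1 : ContinuousAt (fun s : ℝ => W (M + (1 - s)⁻¹)) s :=
      hW.continuousAt.comp (continuousAt_const.add
        (ContinuousAt.inv₀ (by fun_prop) (sub_ne_zero.2 hs.ne')))
    refine h1.congr ?_
    filter_upwards [gt_mem_nhds hs] with s' hs'
    exact (hlt s' hs').symm
  refine ⟨connectedComponentIn V (γ 0), ⟨γ 0, hmem 0 one_pos, rfl⟩, γ, ?_, ?_, hγ1⟩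
  · intro s hs
    rcases hs.2.lt_or_eq with h | rfl
    · exact (hcont s h).continuousWithinAt
    · have h1 : ContinuousWithinAt γ (Set.Iio 1) 1 := by
        have h2 : Tendsto (fun s : ℝ => 1 - s) (𝓝[<] 1) (𝓝[>] 0) := by
          refine tendsto_nhdsWithin_of_tendsto_nhds_of_eventually_within _ ?_ ?_
          · have : Continuous fun s : ℝ => 1 - s := by fun_prop
            have h3 : Tendsto (fun s : ℝ => 1 - s) (𝓝 1) (𝓝 0) := by simpa using this.tendsto 1
            exact h3.mono_left nhdsWithin_le_nhds
          · filter_upwards [self_mem_nhdsWithin] with s hs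
            exact sub_pos.2 (Set.mem_Iio.1 hs)
        have h3 := hlim.comp
          (tendsto_atTop_add_const_left _ M (tendsto_inv_nhdsGT_zero.comp h2))
        unfold ContinuousWithinAt
        rw [hγ1]
        refine h3.congr' ?_
        filter_upwards [self_mem_nhdsWithin] with s hs
        exact (hlt s hs).symm
      refine (continuousWithinAt_insert_self.2 h1).mono fun s hs => ?_
      rcases hs.2.lt_or_eq with h | h
      · exact Set.mem_insert_of_mem _ h
      · exact Set.mem_insert_iff.2 (Or.inl h)
  · intro s hs
    have hpre : IsPreconnected (γ '' Set.Ico 0 1) :=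
      isPreconnected_Ico.image _ fun s hs => (hcont s hs.2).continuousWithinAt
    refine hpre.subset_connectedComponentIn ⟨0, ⟨le_rfl, one_pos⟩, rfl⟩ ?_ ⟨s, hs, rfl⟩
    rintro _ ⟨s, hs, rfl⟩
    exact hmem s hs.2

/-- The multiplicative errors along a path that converges fast enough to `z` tend to zero,
uniformly for the exponents up to `τ + 1`. -/
theorem exists_tendsto_norm_mul_pow_sub_one_le {z : ℂ} (hz0 : z ≠ 0) {W G : ℝ → ℂ}
    (hW : Tendsto W atTop (𝓝 z)) (hG : Tendsto G atTop (𝓝 1))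
    (hfast : Tendsto (fun τ => (τ + 1) * ‖W τ - z‖) atTop (𝓝 0)) :
    ∃ E : ℝ → ℝ, Tendsto E atTop (𝓝 0) ∧ ∀ᶠ τ in atTop, ∀ q : ℕ, (q : ℝ) ≤ τ + 1 →
      ‖G τ * (z / W τ) ^ q - 1‖ ≤ E τ := by
  refine ⟨fun τ => ‖G τ‖ * (Real.exp ((τ + 1) * ‖W τ - z‖ / ‖W τ‖) - 1) + ‖G τ - 1‖, ?_, ?_⟩
  · have h1 : Tendsto (fun τ => (τ + 1) * ‖W τ - z‖ / ‖W τ‖) atTop (𝓝 0) := by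
      have := hfast.div hW.norm (norm_ne_zero_iff.2 hz0)
      rwa [zero_div] at this
    have h2 := (hG.norm.mul (((Real.continuous_exp.tendsto 0).comp h1).sub_const 1)).add
      (hG.sub_const 1).norm
    simpa using h2
  · filter_upwards [hW.eventually_ne hz0] with τ hτ q hq
    have e : z / W τ = 1 + (z - W τ) / W τ := by field_simp; ring
    have h1 := norm_one_add_pow_sub_one_le_exp ((z - W τ) / W τ) q
    have h2 : (q : ℝ) * ‖(z - W τ) / W τ‖ ≤ (τ + 1) * ‖W τ - z‖ / ‖W τ‖ := by
      rw [norm_div, norm_sub_rev, mul_div_assoc]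
      gcongr
    have h3 := Real.exp_le_exp.2 h2
    have e2 : G τ * (z / W τ) ^ q - 1 = G τ * ((z / W τ) ^ q - 1) + (G τ - 1) := by ring
    rw [e2]
    refine (norm_add_le _ _).trans ?_
    rw [norm_mul, e]
    gcongr
    linarith

theorem corollary4p5 (z : ℂ) (hzM : z ∈ connectednessLocus) (hzim : z.im ≠ 0)
    (hznorm : ‖z‖ ≤ 1 / Real.sqrt 2)
    (f : PowerSeries ℤ) (hf : vanishingSeries z = {f})
    (l p : ℕ) (htype : IsRationalType f l p)
    (hcoeff : ∀ j, f.coeff j ≠ 0)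
    (hTaylor : TaylorConditions f l p z) :
    z ∈ frontier connectednessLocus ∩ frontier thurstonSet ∧
      ∃ U : Set ℂ, IsComponentOf U (Metric.ball 0 1 \ connectednessLocus) ∧
        IsPathAccessibleFrom U z := by
  have hz : ‖z‖ < 1 := hzM.1
  have hz0 : z ≠ 0 := fun h => hzim (by rw [h, zero_im])
  have hz2 : ‖z‖ ^ 2 ≤ 1 / 2 := by
    refine (pow_le_pow_left₀ (norm_nonneg z) hznorm 2).trans (le_of_eq ?_)
    rw [div_pow, one_pow, Real.sq_sqrt zero_le_two]
  obtain ⟨hfn, h0⟩ : f ∈ vanishingSeries z := hf ▸ Set.mem_singleton f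
  have hc : ∀ n, f.coeff n = 1 ∨ f.coeff n = -1 := fun n => by
    rcases hfn.1 n with h | h | h
    · exact Or.inr h
    · exact absurd h (hcoeff n)
    · exact Or.inl h
  set c : ℕ → ℤ := fun n => f.coeff n with hcdef
  have h0' : seriesVal z c = 0 := h0
  obtain ⟨t, ht, ε, hε, hsep⟩ :=
    exists_uniform_separatedBy hz hz2 hc hfn.2 h0' htype.1 hTaylor
  set Y : ℝ → ℂ := fun τ => rampVal z c t (max τ (l + 2 : ℕ)) with hYdef
  obtain ⟨d, g, hd, hg, hgz, hF⟩ := exists_eventually_eq_pow_mul hz hc h0'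
  have hYτ : ∀ τ : ℝ, (l + 2 : ℕ) ≤ τ → Y τ = rampVal z c t τ := fun τ hτ => by
    rw [hYdef]; beta_reduce; rw [max_eq_left hτ]
  have hY0 : ∀ τ, Y τ ≠ 0 := fun τ => rampVal_ne_zero hz hz0 hc ht hε hsep (le_max_right _ _)
  obtain ⟨W, G, hWc, hW, hG, hfast, hFW⟩ := exists_path_of_values (Y := Y)
    (C := t * (1 - ‖z‖)⁻¹) (r := ‖z‖) hd hg hgz hF
    ((continuous_rampVal hz hc ht).comp (by fun_prop)) hY0 (norm_nonneg z) hz (by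
      filter_upwards [eventually_ge_atTop ((l + 2 : ℕ) : ℝ)] with τ hτ
      rw [hYτ τ hτ]
      refine norm_rampVal_le hz hc ht ?_
      push_cast
      exact add_le_add_left (Nat.floor_le ((Nat.cast_nonneg _).trans hτ)) 1)
  obtain ⟨E, hE, hGE⟩ := exists_tendsto_norm_mul_pow_sub_one_le hz0 hW hG hfast
  have hsmall : Tendsto (fun τ => 2 * powDist z (W τ) + t * (1 - ‖z‖)⁻¹ * E τ) atTop (𝓝 0) := by
    simpa using (((tendsto_powDist hz).comp hW).const_mul 2).add (hE.const_mul (t * (1 - ‖z‖)⁻¹))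
  have hWlt : ∀ᶠ τ in atTop, ‖W τ‖ < 1 := hW.norm.eventually (gt_mem_nhds hz)
  have hempty : ∀ᶠ τ in atTop, vanishingSeries (W τ) = ∅ := by
    filter_upwards [hWlt, hW.eventually_ne hz0, hG.eventually_ne one_ne_zero, hGE, hFW,
      hsmall.eventually (gt_mem_nhds (half_pos hε)), hW.eventually (eventually_agree hz hf (l + 2)),
      eventually_ge_atTop ((l + 2 : ℕ) : ℝ)] with τ h1 h2 h3 h4 h5 h6 h7 h8
    refine vanishingSeries_eq_empty hz hc ht hε hsep h8 h1 h2 h7 ?_ (G := G τ) ?_ fun q hq => ?_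
    · rw [h5]
      exact neg_ne_zero.2 (mul_ne_zero h3 (hY0 τ))
    · rw [← hYτ τ h8]; exact h5
    · refine lt_of_le_of_lt ?_ h6
      have : 0 ≤ t * (1 - ‖z‖)⁻¹ := mul_nonneg ht.le (inv_nonneg.2 (sub_nonneg.2 hz.le))
      gcongr
      exact h4 q hq
  have hM : ∀ᶠ τ in atTop, W τ ∉ connectednessLocus := hempty.mono fun τ h h' =>
    (vanishingSeries_nonempty_of_mem_connectednessLocus h').ne_empty h
  have hT : ∀ᶠ τ in atTop, W τ ∉ thurstonSet := hempty.mono fun τ h h' =>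
    (vanishingSeries_nonempty_of_mem_thurstonSet h').ne_empty h
  have hzT : z ∈ thurstonSet := ⟨hz, c, fun n => (hc n).symm, h0.symm⟩
  refine ⟨⟨?_, ?_⟩, isPathAccessibleFrom_of_tendsto hWc hW ?_⟩
  · rw [frontier_eq_closure_inter_closure]
    exact ⟨subset_closure hzM, mem_closure_of_tendsto hW hM⟩
  · rw [frontier_eq_closure_inter_closure]
    exact ⟨subset_closure hzT, mem_closure_of_tendsto hW hT⟩
  · filter_upwards [hWlt, hM] with τ h1 h2
    exact ⟨mem_ball_zero_iff.2 h1, h2⟩
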